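/- Let $L>0$ and $\alpha\in\{2,-2\}$. For $a\in(0,L)$ let $H_{\alpha,a}$ be the operator in $L^2((0,L))\oplus H^1((0,L))$ (complex-valued functions) given by $H_{\alpha,a}(v,w)=(w'',v)$, with $w''$ taken on $(0,a)\cup(a,L)$, on the domain of all pairs $(v,w)$ such that $v\in H^1_0((0,L))$, $w\in H^1_0((0,L))\cap H^2((0,a))\cap H^2((a,L))$ and $w'(a^+)-w'(a^-)=\alpha\,v(a)$. Let $(\lambda_j)_{j\ge1}$ be its eigenvalues, repeated according to their algebraic multiplicities. Fix one of the following two choices of the branch cut of the logarithm: (i) ("below the negative real axis") the ray $e^{i(\pi+\varepsilon)}(0,\infty)$, with arguments in $(-\pi+\varepsilon,\pi+\varepsilon]$, where $\varepsilon\in(0,\pi/2)$ is such that no $\lambda_j$ has an argument in $(\pi,\pi+\varepsilon]$; (ii) ("below the positive real axis") the ray $e^{-i\varepsilon}(0,\infty)$, with arguments in $(-\varepsilon,2\pi-\varepsilon]$, where $\varepsilon\in(0,\pi/2)$ is such that no $\lambda_j$ has an argument in $[-\varepsilon,0)$. (The number $\varepsilon$ may depend on $a$.) Let $\zeta(s)=\sum_j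 e^{-s\log\lambda_j}$ for $\operatorname{Re}s>1$, continued meromorphically to $\mathbb{C}$, and let $\det(H_{\alpha,a})=\exp(-\zeta'(0))$ be the spectral determinant. Theorem. For either choice of the branch cut, the following holds. For every $a\in(0,L/2)$ the spectral determinant $\det(H_{\alpha,a})$ is well defined: an admissible $\varepsilon$ exists, the sum $\zeta(s)$ converges absolutely for $\operatorname{Re}s>1$ and has a meromorphic continuation to $\mathbb{C}$ that is analytic at $0$, and the value $\exp(-\zeta'(0))$ does not depend on the choices made. Moreover, the function $a\mapsto\det(H_{\alpha,a})$ is continuous on $(0,L/2)$. -/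

import Mathlib

open MeasureTheory Filter Topology Set
open scoped ContDiff

noncomputable section

namespace DampedWave

/-! ## Sobolev spaces on an interval, through weak derivatives -/

/-- Lebesgue measure on the open interval `(c, d)`. -/
abbrev vol (c d : ℝ) : Measure ℝ := volume.restrict (Ioo c d)

/-- `f` and `g` belong to `L²((c, d))` and `g` is the weak derivative of `f` on `(c, d)`. -/
structure HasWeakDeriv (c d : ℝ) (f g : ℝ → ℂ) : Prop where
  memLp : MemLp f 2 (vol c d)
  memLp_deriv : MemLp g 2 (vol c d)
  integral_eq : ∀ φ : ℝ → ℝ, ContDiff ℝ ∞ φ → HasCompactSupport φ → tsupport φ ⊆ Ioo c d →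
    ∫ x in Ioo c d, deriv φ x • f x = - ∫ x in Ioo c d, φ x • g x

/-- `h` is the second weak derivative of `f` on `(c, d)`, with `f`, `f'` and `h` in `L²`. -/
def HasWeakDeriv₂ (c d : ℝ) (f h : ℝ → ℂ) : Prop :=
  ∃ g : ℝ → ℂ, HasWeakDeriv c d f g ∧ HasWeakDeriv c d g h

/-- The Sobolev space `H¹((c, d))`. -/
def MemH1 (c d : ℝ) (f : ℝ → ℂ) : Prop := ∃ g : ℝ → ℂ, HasWeakDeriv c d f g

/-- The Sobolev space `H²((c, d))`. -/
def MemH2 (c d : ℝ) (f : ℝ → ℂ) : Prop := ∃ h : ℝ → ℂ, HasWeakDeriv₂ c d f h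

/-- The limit of `f` along `l`, null sets being disregarded. For a function of class `H¹` on an
interval this is the limit (at an interior point: the value) of its continuous representative. -/
def HasTrace (l : Filter ℝ) (f : ℝ → ℂ) (y : ℂ) : Prop :=
  Tendsto f (l ⊓ ae (volume : Measure ℝ)) (𝓝 y)

/-- The Sobolev space `H¹₀((c, d))`: functions of class `H¹` that vanish at both end points. -/
def MemH10 (c d : ℝ) (f : ℝ → ℂ) : Prop :=
  MemH1 c d f ∧ HasTrace (𝓝[>] c) f 0 ∧ HasTrace (𝓝[<] d) f 0

/-! ### Elementary facts, needed to see that the damped wave operator is a linear operator -/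

lemma vol_mono {c d c' d' : ℝ} (hc : c ≤ c') (hd : d' ≤ d) : vol c' d' ≤ vol c d :=
  Measure.restrict_mono (Ioo_subset_Ioo hc hd) le_rfl

lemma integrable_smul {c d : ℝ} {f : ℝ → ℂ} (hf : MemLp f 2 (vol c d)) {φ : ℝ → ℝ}
    (hφ : Continuous φ) (hs : HasCompactSupport φ) :
    Integrable (fun x => φ x • f x) (vol c d) := by
  have h1 : Integrable f (vol c d) := hf.integrable (by norm_num)
  obtain ⟨C, hC⟩ := hφ.bounded_above_of_compact_support hs
  exact h1.bdd_smul C hφ.aestronglyMeasurable (Eventually.of_forall hC)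

namespace HasWeakDeriv

variable {c d : ℝ} {f g f' g' : ℝ → ℂ}

lemma add (h : HasWeakDeriv c d f g) (h' : HasWeakDeriv c d f' g') :
    HasWeakDeriv c d (f + f') (g + g') := by
  refine ⟨h.memLp.add h'.memLp, h.memLp_deriv.add h'.memLp_deriv, fun φ hφ hs ht => ?_⟩
  have hc := hφ.continuous_deriv (by simp)
  simp only [Pi.add_apply, smul_add]
  rw [integral_add (integrable_smul h.memLp hc hs.deriv) (integrable_smul h'.memLp hc hs.deriv),
    integral_add (integrable_smul h.memLp_deriv hφ.continuous hs)
      (integrable_smul h'.memLp_deriv hφ.continuous hs),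
    h.integral_eq φ hφ hs ht, h'.integral_eq φ hφ hs ht, neg_add]

lemma smul (z : ℂ) (h : HasWeakDeriv c d f g) : HasWeakDeriv c d (z • f) (z • g) := by
  refine ⟨h.memLp.const_smul z, h.memLp_deriv.const_smul z, fun φ hφ hs ht => ?_⟩
  simp only [Pi.smul_apply, smul_comm _ z]
  rw [integral_smul, integral_smul, h.integral_eq φ hφ hs ht, smul_neg]

lemma zero (c d : ℝ) : HasWeakDeriv c d 0 0 :=
  ⟨MemLp.zero, MemLp.zero, fun φ _ _ _ => by simp⟩

lemma congr (h : HasWeakDeriv c d f g) (hf : f =ᵐ[vol c d] f') (hg : g =ᵐ[vol c d] g') :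
    HasWeakDeriv c d f' g' := by
  refine ⟨h.memLp.ae_eq hf, h.memLp_deriv.ae_eq hg, fun φ hφ hs ht => ?_⟩
  have e1 : ∫ x in Ioo c d, deriv φ x • f' x = ∫ x in Ioo c d, deriv φ x • f x :=
    integral_congr_ae (by filter_upwards [hf] with x hx; rw [hx])
  have e2 : ∫ x in Ioo c d, φ x • g' x = ∫ x in Ioo c d, φ x • g x :=
    integral_congr_ae (by filter_upwards [hg] with x hx; rw [hx])
  rw [e1, e2, h.integral_eq φ hφ hs ht]

lemma unique (h : HasWeakDeriv c d f g) (h' : HasWeakDeriv c d f g') : g =ᵐ[vol c d] g' := by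
  have hi : Integrable (g - g') (vol c d) :=
    (h.memLp_deriv.sub h'.memLp_deriv).integrable (by norm_num)
  have key := isOpen_Ioo.ae_eq_zero_of_integral_contDiff_smul_eq_zero (U := Ioo c d)
    (f := g - g') (μ := volume) (IntegrableOn.locallyIntegrableOn hi) (fun φ hφ hs ht => by
      have hz : ∀ x, x ∉ Ioo c d → φ x • (g - g') x = 0 := fun x hx => by
        rw [image_eq_zero_of_notMem_tsupport (fun hx' => hx (ht hx')), zero_smul]
      rw [← setIntegral_eq_integral_of_forall_compl_eq_zero hz]
      simp only [Pi.sub_apply, smul_sub]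
      rw [integral_sub (integrable_smul h.memLp_deriv hφ.continuous hs)
        (integrable_smul h'.memLp_deriv hφ.continuous hs)]
      have e := h.integral_eq φ hφ hs ht
      rw [h'.integral_eq φ hφ hs ht, neg_inj] at e
      rw [e, sub_self])
  rw [Filter.EventuallyEq, ae_restrict_iff' measurableSet_Ioo]
  filter_upwards [key] with x hx hxm
  exact sub_eq_zero.mp (hx hxm)

end HasWeakDeriv

namespace HasWeakDeriv₂

variable {c d : ℝ} {f g f' g' : ℝ → ℂ}

lemma add (h : HasWeakDeriv₂ c d f g) (h' : HasWeakDeriv₂ c d f' g') :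
    HasWeakDeriv₂ c d (f + f') (g + g') := by
  obtain ⟨u, h1, h2⟩ := h
  obtain ⟨u', h1', h2'⟩ := h'
  exact ⟨u + u', h1.add h1', h2.add h2'⟩

lemma smul (z : ℂ) (h : HasWeakDeriv₂ c d f g) : HasWeakDeriv₂ c d (z • f) (z • g) := by
  obtain ⟨u, h1, h2⟩ := h
  exact ⟨z • u, h1.smul z, h2.smul z⟩

lemma zero (c d : ℝ) : HasWeakDeriv₂ c d 0 0 :=
  ⟨0, HasWeakDeriv.zero c d, HasWeakDeriv.zero c d⟩

lemma congr (h : HasWeakDeriv₂ c d f g) (hf : f =ᵐ[vol c d] f') (hg : g =ᵐ[vol c d] g') :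
    HasWeakDeriv₂ c d f' g' := by
  obtain ⟨u, h1, h2⟩ := h
  exact ⟨u, h1.congr hf .rfl, h2.congr .rfl hg⟩

lemma unique (h : HasWeakDeriv₂ c d f g) (h' : HasWeakDeriv₂ c d f g') : g =ᵐ[vol c d] g' := by
  obtain ⟨u, h1, h2⟩ := h
  obtain ⟨u', h1', h2'⟩ := h'
  exact h2.unique (h2'.congr (h1'.unique h1) .rfl)

lemma memLp (h : HasWeakDeriv₂ c d f g) : MemLp g 2 (vol c d) := by
  obtain ⟨u, _, h2⟩ := h
  exact h2.memLp_deriv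

end HasWeakDeriv₂

section trace

variable {l : Filter ℝ} {f f' : ℝ → ℂ} {y y' : ℂ}

lemma HasTrace.add (h : HasTrace l f y) (h' : HasTrace l f' y') :
    HasTrace l (f + f') (y + y') := Tendsto.add h h'

lemma HasTrace.smul (z : ℂ) (h : HasTrace l f y) : HasTrace l (z • f) (z * y) :=
  Tendsto.const_mul z h

lemma HasTrace.congr {c d : ℝ} (h : HasTrace l f y) (hf : f =ᵐ[vol c d] f')
    (hl : Ioo c d ∈ l) : HasTrace l f' y := by
  refine Tendsto.congr' ?_ h
  rw [Filter.EventuallyEq, ae_restrict_iff' measurableSet_Ioo] at hf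
  filter_upwards [mem_inf_of_left hl, mem_inf_of_right hf] with x hx hx'
  exact hx' hx

end trace

namespace MemH1

variable {c d : ℝ} {f f' : ℝ → ℂ}

lemma add (h : MemH1 c d f) (h' : MemH1 c d f') : MemH1 c d (f + f') :=
  ⟨_, h.choose_spec.add h'.choose_spec⟩

lemma smul (z : ℂ) (h : MemH1 c d f) : MemH1 c d (z • f) := ⟨_, h.choose_spec.smul z⟩

lemma congr (h : MemH1 c d f) (hf : f =ᵐ[vol c d] f') : MemH1 c d f' :=
  ⟨_, h.choose_spec.congr hf .rfl⟩

end MemH1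

namespace MemH2

variable {c d : ℝ} {f f' : ℝ → ℂ}

lemma add (h : MemH2 c d f) (h' : MemH2 c d f') : MemH2 c d (f + f') :=
  ⟨_, h.choose_spec.add h'.choose_spec⟩

lemma smul (z : ℂ) (h : MemH2 c d f) : MemH2 c d (z • f) := ⟨_, h.choose_spec.smul z⟩

lemma congr (h : MemH2 c d f) (hf : f =ᵐ[vol c d] f') : MemH2 c d f' :=
  ⟨_, h.choose_spec.congr hf .rfl⟩

end MemH2

namespace MemH10

variable {c d : ℝ} {f f' : ℝ → ℂ}

lemma add (h : MemH10 c d f) (h' : MemH10 c d f') : MemH10 c d (f + f') :=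
  ⟨h.1.add h'.1, by simpa using h.2.1.add h'.2.1, by simpa using h.2.2.add h'.2.2⟩

lemma smul (z : ℂ) (h : MemH10 c d f) : MemH10 c d (z • f) :=
  ⟨h.1.smul z, by simpa using h.2.1.smul z, by simpa using h.2.2.smul z⟩

lemma congr (hcd : c < d) (h : MemH10 c d f) (hf : f =ᵐ[vol c d] f') : MemH10 c d f' :=
  ⟨h.1.congr hf, h.2.1.congr hf (Ioo_mem_nhdsGT hcd), h.2.2.congr hf (Ioo_mem_nhdsLT hcd)⟩

end MemH10

/-! ## The damped wave operator -/

/-- The space `L²((0, L))` of complex-valued functions. -/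
abbrev L2 (L : ℝ) := Lp ℂ 2 (vol 0 L)

/-- The space `H¹((0, L))`, as a subspace of `L²((0, L))`. -/
def H1 (L : ℝ) : Submodule ℂ (L2 L) where
  carrier := {f | MemH1 0 L f}
  zero_mem' := MemH1.congr ⟨_, HasWeakDeriv.zero 0 L⟩ (Lp.coeFn_zero ℂ 2 (vol 0 L)).symm
  add_mem' {f g} hf hg := (hf.add hg).congr (Lp.coeFn_add f g).symm
  smul_mem' z f hf := (hf.smul z).congr (Lp.coeFn_smul z f).symm

/-- The space `L²((0, L)) ⊕ H¹((0, L))` of pairs `(v, w)`. (Eigenvalues and their multiplicities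
depend on its vector space structure only.) -/
abbrev StateSpace (L : ℝ) := L2 L × H1 L

/-- The domain of the damped wave operator: `v ∈ H¹₀((0, L))`,
`w ∈ H¹₀((0, L)) ∩ H²((0, a)) ∩ H²((a, L))` and `w'(a⁺) - w'(a⁻) = α v(a)`. -/
structure InDomain (L a : ℝ) (α : ℂ) (v w : ℝ → ℂ) : Prop where
  v_mem : MemH10 0 L v
  w_mem : MemH10 0 L w
  w_left : MemH2 0 a w
  w_right : MemH2 a L w
  jump : ∃ (w' : ℝ → ℂ) (y₁ y₂ y : ℂ), HasWeakDeriv 0 L w w' ∧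
    HasTrace (𝓝[<] a) w' y₁ ∧ HasTrace (𝓝[>] a) w' y₂ ∧ HasTrace (𝓝 a) v y ∧ y₂ - y₁ = α * y

section Domain

variable {L a : ℝ} {α : ℂ}

lemma InDomain.add {v w v' w' : ℝ → ℂ} (h : InDomain L a α v w) (h' : InDomain L a α v' w') :
    InDomain L a α (v + v') (w + w') := by
  obtain ⟨u, y₁, y₂, y, hu, h1, h2, h3, h4⟩ := h.jump
  obtain ⟨u', y₁', y₂', y', hu', h1', h2', h3', h4'⟩ := h'.jump
  exact ⟨h.v_mem.add h'.v_mem, h.w_mem.add h'.w_mem, h.w_left.add h'.w_left,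
    h.w_right.add h'.w_right, u + u', y₁ + y₁', y₂ + y₂', y + y', hu.add hu', h1.add h1',
    h2.add h2', h3.add h3', by linear_combination h4 + h4'⟩

lemma InDomain.smul (z : ℂ) {v w : ℝ → ℂ} (h : InDomain L a α v w) :
    InDomain L a α (z • v) (z • w) := by
  obtain ⟨u, y₁, y₂, y, hu, h1, h2, h3, h4⟩ := h.jump
  exact ⟨h.v_mem.smul z, h.w_mem.smul z, h.w_left.smul z,
    h.w_right.smul z, z • u, z * y₁, z * y₂, z * y, hu.smul z, h1.smul z,
    h2.smul z, h3.smul z, by linear_combination z * h4⟩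

lemma InDomain.congr (ha : a ∈ Ioo 0 L) {v w v' w' : ℝ → ℂ} (h : InDomain L a α v w)
    (hv : v =ᵐ[vol 0 L] v') (hw : w =ᵐ[vol 0 L] w') : InDomain L a α v' w' := by
  have h0 : 0 < L := ha.1.trans ha.2
  obtain ⟨u, y₁, y₂, y, hu, h1, h2, h3, h4⟩ := h.jump
  exact ⟨h.v_mem.congr h0 hv, h.w_mem.congr h0 hw,
    h.w_left.congr (ae_mono (vol_mono le_rfl ha.2.le) hw),
    h.w_right.congr (ae_mono (vol_mono ha.1.le le_rfl) hw),
    u, y₁, y₂, y, hu.congr hw .rfl, h1, h2, h3.congr hv (Ioo_mem_nhds ha.1 ha.2), h4⟩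

lemma InDomain.zero (L a : ℝ) (α : ℂ) : InDomain L a α 0 0 := by
  have t : ∀ l, HasTrace l 0 0 := fun l => tendsto_const_nhds
  have m : MemH10 0 L 0 := ⟨⟨_, HasWeakDeriv.zero 0 L⟩, t _, t _⟩
  exact ⟨m, m, ⟨_, HasWeakDeriv₂.zero 0 a⟩, ⟨_, HasWeakDeriv₂.zero a L⟩,
    0, 0, 0, 0, HasWeakDeriv.zero 0 L, t _, t _, t _, by simp⟩

/-- The domain of the damped wave operator as a subspace. -/
def domain (ha : a ∈ Ioo 0 L) (α : ℂ) : Submodule ℂ (StateSpace L) where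
  carrier := {U | InDomain L a α U.1 U.2}
  zero_mem' := (InDomain.zero L a α).congr ha (Lp.coeFn_zero ℂ 2 (vol 0 L)).symm
    (Lp.coeFn_zero ℂ 2 (vol 0 L)).symm
  add_mem' {U V} hU hV := (hU.add hV).congr ha (Lp.coeFn_add U.1 V.1).symm
    (Lp.coeFn_add (U.2 : L2 L) (V.2 : L2 L)).symm
  smul_mem' z U hU := (hU.smul z).congr ha (Lp.coeFn_smul z U.1).symm
    (Lp.coeFn_smul z (U.2 : L2 L)).symm

/-- `p` is the second derivative of `w` on `(0, a) ∪ (a, L)`. -/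
def IsSecondDeriv (L a : ℝ) (w p : ℝ → ℂ) : Prop :=
  HasWeakDeriv₂ 0 a w p ∧ HasWeakDeriv₂ a L w p

lemma ae_of_ae_of_ae {P : ℝ → Prop} (h1 : ∀ᵐ x ∂vol 0 a, P x) (h2 : ∀ᵐ x ∂vol a L, P x) :
    ∀ᵐ x ∂vol 0 L, P x := by
  rw [ae_restrict_iff' measurableSet_Ioo] at *
  filter_upwards [h1, h2, Measure.ae_ne volume a] with x hx1 hx2 hx3 hx
  rcases lt_or_gt_of_ne hx3 with h | h
  · exact hx1 ⟨hx.1, h⟩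
  · exact hx2 ⟨h, hx.2⟩

lemma IsSecondDeriv.unique {w p q : ℝ → ℂ} (hp : IsSecondDeriv L a w p)
    (hq : IsSecondDeriv L a w q) : p =ᵐ[vol 0 L] q :=
  ae_of_ae_of_ae (hp.1.unique hq.1) (hp.2.unique hq.2)

lemma IsSecondDeriv.congr (ha : a ∈ Ioo 0 L) {w p w' p' : ℝ → ℂ} (hp : IsSecondDeriv L a w p)
    (hw : w =ᵐ[vol 0 L] w') (hpp : p =ᵐ[vol 0 L] p') : IsSecondDeriv L a w' p' :=
  ⟨hp.1.congr (ae_mono (vol_mono le_rfl ha.2.le) hw) (ae_mono (vol_mono le_rfl ha.2.le) hpp),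
    hp.2.congr (ae_mono (vol_mono ha.1.le le_rfl) hw) (ae_mono (vol_mono ha.1.le le_rfl) hpp)⟩

lemma exists_secondDeriv (ha : a ∈ Ioo 0 L) {v w : ℝ → ℂ} (h : InDomain L a α v w) :
    ∃ p : L2 L, IsSecondDeriv L a w p := by
  obtain ⟨p₁, h₁⟩ := h.w_left
  obtain ⟨p₂, h₂⟩ := h.w_right
  let p : ℝ → ℂ := (Ioo 0 a).indicator p₁ + (Ioo a L).indicator p₂
  have hp : MemLp p 2 (vol 0 L) := by
    refine MemLp.add ?_ ?_
    · rw [memLp_indicator_iff_restrict measurableSet_Ioo, Measure.restrict_restrict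
        measurableSet_Ioo, inter_eq_left.mpr (Ioo_subset_Ioo_right ha.2.le)]
      exact h₁.memLp
    · rw [memLp_indicator_iff_restrict measurableSet_Ioo, Measure.restrict_restrict
        measurableSet_Ioo, inter_eq_left.mpr (Ioo_subset_Ioo_left ha.1.le)]
      exact h₂.memLp
  have e1 : p₁ =ᵐ[vol 0 a] p := by
    refine (ae_restrict_iff' measurableSet_Ioo).mpr (Eventually.of_forall fun x hx => ?_)
    have : x ∉ Ioo a L := fun h => lt_asymm hx.2 h.1
    simp [p, hx, this]
  have e2 : p₂ =ᵐ[vol a L] p := by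
    refine (ae_restrict_iff' measurableSet_Ioo).mpr (Eventually.of_forall fun x hx => ?_)
    have : x ∉ Ioo 0 a := fun h => lt_asymm hx.1 h.2
    simp [p, hx, this]
  have hs : IsSecondDeriv L a w p := ⟨h₁.congr .rfl e1, h₂.congr .rfl e2⟩
  exact ⟨hp.toLp p, hs.congr ha .rfl hp.coeFn_toLp.symm⟩

/-- The second derivative `w''` (taken on `(0, a)` and on `(a, L)`) of `(v, w)` in the domain. -/
def secondDeriv (ha : a ∈ Ioo 0 L) (U : domain ha α) : L2 L :=
  (exists_secondDeriv ha U.2).choose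

lemma secondDeriv_spec (ha : a ∈ Ioo 0 L) (U : domain ha α) :
    IsSecondDeriv L a U.1.2 (secondDeriv ha U) := (exists_secondDeriv ha U.2).choose_spec

/-- The damped wave operator `(v, w) ↦ (w'', v)`. -/
def waveOperator (ha : a ∈ Ioo 0 L) (α : ℂ) : StateSpace L →ₗ.[ℂ] StateSpace L where
  domain := domain ha α
  toFun :=
    { toFun := fun U => (secondDeriv ha U, ⟨U.1.1, U.2.v_mem.1⟩)
      map_add' := fun U V => by
        refine Prod.ext (Lp.ext ?_) rfl
        refine IsSecondDeriv.unique (secondDeriv_spec ha (U + V)) ?_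
        have hU := secondDeriv_spec ha U
        have hV := secondDeriv_spec ha V
        exact IsSecondDeriv.congr ha ⟨hU.1.add hV.1, hU.2.add hV.2⟩
          (Lp.coeFn_add (U.1.2 : L2 L) (V.1.2 : L2 L)).symm (Lp.coeFn_add _ _).symm
      map_smul' := fun z U => by
        refine Prod.ext (Lp.ext ?_) rfl
        refine IsSecondDeriv.unique (secondDeriv_spec ha (z • U)) ?_
        have hU := secondDeriv_spec ha U
        exact IsSecondDeriv.congr ha ⟨hU.1.smul z, hU.2.smul z⟩
          (Lp.coeFn_smul z (U.1.2 : L2 L)).symm (Lp.coeFn_smul z _).symm }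

end Domain

/-! ## Eigenvalues, spectral zeta function and spectral determinant -/

/-- `rootSpace T z k` is the kernel of `(T - z) ^ k`, with its natural domain. -/
def rootSpace {V : Type*} [AddCommGroup V] [Module ℂ V] (T : V →ₗ.[ℂ] V) (z : ℂ) :
    ℕ → Submodule ℂ V
  | 0 => ⊥
  | k + 1 => ((rootSpace T z k).comap (T.toFun - z • T.domain.subtype)).map T.domain.subtype

/-- The (algebraic) multiplicity of `z` as an eigenvalue of `T`: the dimension of the space of all
root vectors. It is positive exactly when `z` is an eigenvalue. -/
def algMultiplicity {V : Type*} [AddCommGroup V] [Module ℂ V] (T : V →ₗ.[ℂ] V) (z : ℂ) : ℕ∞ :=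
  Cardinal.toENat (Module.rank ℂ (⨆ k, rootSpace T z k : Submodule ℂ V))

/-- The sequence `ev` lists the eigenvalues of `T`, each one repeated according to its
multiplicity. -/
def IsEigenvalueSequence {V : Type*} [AddCommGroup V] [Module ℂ V] (T : V →ₗ.[ℂ] V)
    (ev : ℕ → ℂ) : Prop :=
  ∀ z : ℂ, {j | ev j = z}.encard = algMultiplicity T z

/-- The two choices of the branch cut of the logarithm: below the negative real axis, or below the
positive real axis. -/
inductive BranchCut
  | belowNegative
  | belowPositive

/-- An argument of the branch cut: the cut is the ray `exp (i (π + ε)) (0, ∞)` (whose argument is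
also `-π + ε`), respectively `exp (-i ε) (0, ∞)`. -/
def BranchCut.angle : BranchCut → ℝ → ℝ
  | belowNegative, ε => -Real.pi + ε
  | belowPositive, ε => -ε

/-- The angles between the real half-axis and the branch cut below it, the cut included:
`(π, π + ε]`, respectively `[-ε, 0)`. -/
def BranchCut.forbidden : BranchCut → ℝ → Set ℝ
  | belowNegative, ε => Ioc Real.pi (Real.pi + ε)
  | belowPositive, ε => Ico (-ε) 0

/-- `ε` may be used for the branch cut: no eigenvalue has an argument in `(π, π + ε]`,
respectively `[-ε, 0)`. -/
def BranchCut.Admissible (cut : BranchCut) (ε : ℝ) (ev : ℕ → ℂ) : Prop :=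
  ε ∈ Ioo 0 (Real.pi / 2) ∧
    ∀ j, ∀ r : ℝ, 0 < r → ∀ φ ∈ cut.forbidden ε, ev j ≠ r * Complex.exp (φ * Complex.I)

/-- The logarithm with branch cut the ray of argument `θ`: the imaginary part of its values
lies in `(θ, θ + 2π]`. -/
def logCut (θ : ℝ) (z : ℂ) : ℂ :=
  Real.log ‖z‖ + toIocMod Real.two_pi_pos θ z.arg * Complex.I

/-- `Z` is the meromorphic continuation to `ℂ` of the spectral zeta function
`ζ(s) = ∑ⱼ exp (-s log λⱼ)`, `Re s > 1`, and has no pole at `0`. -/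
structure IsZetaContinuation (θ : ℝ) (ev : ℕ → ℂ) (Z : ℂ → ℂ) : Prop where
  hasSum : ∀ s : ℂ, 1 < s.re → HasSum (fun j => Complex.exp (-s * logCut θ (ev j))) (Z s)
  meromorphic : Meromorphic Z
  analyticAt : AnalyticAt ℂ Z 0

/-- `D` is the spectral determinant `exp (-ζ'(0))` of the damped wave operator on `(0, L)` with
damping `α δ_a`, for the given branch cut. -/
def IsSpectralDet (L : ℝ) (α : ℂ) (cut : BranchCut) (a : ℝ) (D : ℂ) : Prop :=
  ∃ (ha : a ∈ Ioo 0 L) (ev : ℕ → ℂ) (ε : ℝ) (Z : ℂ → ℂ),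
    IsEigenvalueSequence (waveOperator ha α) ev ∧ cut.Admissible ε ev ∧
    IsZetaContinuation (cut.angle ε) ev Z ∧ D = Complex.exp (-deriv Z 0)

open Classical in
/-- The spectral determinant as a function of the position `a` of the damping (`0` where it is not
defined). -/
def spectralDet (L : ℝ) (α : ℂ) (cut : BranchCut) (a : ℝ) : ℂ :=
  if h : ∃ D, IsSpectralDet L α cut a D then h.choose else 0

end DampedWave

end

noncomputable section
namespace DampedWave

/-! ## Dividing an entire function by its zeros in a disc -/

section Landau

open Metric

variable {f g : ℂ → ℂ} {z₀ : ℂ} {R M m : ℝ} {T : Finset ℂ}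

/-! The determinant turns out to be constant in `a`, so continuity is immediate once it is known to
be well defined.

Solving the eigenvalue equation on both sides of `a` gives the characteristic function `sinh(zL) + α
sinh(za) sinh(z(L-a))`. For `α = 2` its `e^{-zL}` term cancels, leaving `e^{zL}/2` times `f(z) = 2 -
e^{-pz} - e^{-qz}`, with `p = 2a < q = 2(L-a)`; the case `α = -2` follows from `z ↦ -z`. All zeros
of `f` are simple and the only real one is `0`, which is not an eigenvalue. A generalized
eigenvector above a nonzero zero would force the derivative to vanish, so every eigenvalue has
algebraic multiplicity one (`algMultiplicity_waveOperator_eq_one`).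

For an exponential polynomial `A + B e^{-rz} + C e^{-qz}` the zeros lie in a vertical strip with
boundedly many in each unit window, and Liouville's theorem gives `-(log f)'' = ∑ (z - ρ)^{-2}`
(`hasSum_one_div_sq`). Since `∫₀^∞ x^{1-s} (x + μ)^{-2} dx = Γ(s) Γ(2-s) μ^{-s}`, the zeta function
of the negated nonzero zeros, times `Γ(s) Γ(2-s)`, is the Mellin transform at `2 - s` of `-(log f)''
- x^{-2}`. This kernel is bounded at `0` and equals `-x^{-2}` up to an exponentially small error at
infinity. Splitting off that tail continues zeta to `Re s < 2` with `ζ(0) = -1` and `ζ'(0) = log A -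
log ℓ`, where `ℓ = f'(0)` (`deriv_zetaLeft_zero`).

Here `ℓ = p + q = 2L`, whatever `a` is. For the cut below the negative axis the logarithm is
principal on the eigenvalues. For the cut below the positive axis it is `log(-λ) + πi`, which
replaces the eigenvalues by their negatives and multiplies zeta by `e^{-iπs}`. The negated
eigenvalues for one sign of `α` are the eigenvalues for the other sign, so `f` and its dual `1 +
e^{-(q-p)z} - 2 e^{-qz}` cover all four cases. -/

theorem exists_eq_prod_mul (hf : Differentiable ℂ f) (T : Finset ℂ) (hT : ∀ ρ ∈ T, f ρ = 0) :
    ∃ g : ℂ → ℂ, Differentiable ℂ g ∧ ∀ z, f z = (∏ ρ ∈ T, (z - ρ)) * g z := by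
  induction T using Finset.induction_on with
  | empty => exact ⟨f, hf, fun z => by simp⟩
  | insert ρ T hρ ih =>
    obtain ⟨g, hg, hfg⟩ := ih fun σ hσ => hT σ (Finset.mem_insert_of_mem hσ)
    have hgρ : g ρ = 0 := by
      have h := hfg ρ
      rw [hT ρ (Finset.mem_insert_self _ _)] at h
      refine (mul_eq_zero.mp h.symm).resolve_left (Finset.prod_ne_zero_iff.mpr fun σ hσ h0 => ?_)
      exact hρ (sub_eq_zero.mp h0 ▸ hσ)
    refine ⟨dslope g ρ, ?_, fun z => ?_⟩
    · exact differentiableOn_univ.mp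
        ((Complex.differentiableOn_dslope univ_mem).mpr hg.differentiableOn)
    · have := sub_smul_dslope g ρ z
      rw [hgρ, sub_zero, smul_eq_mul] at this
      rw [Finset.prod_insert hρ, hfg z, ← this]
      ring

/-- On the circle of radius `R` every factor `z - ρ` has modulus at least `2R/3`; the maximum
principle carries the resulting bound inside. -/
theorem norm_quotient_le (hg : Differentiable ℂ g) (hfg : ∀ z, f z = (∏ ρ ∈ T, (z - ρ)) * g z)
    (hR : 0 < R) (hM : ∀ z ∈ sphere z₀ R, ‖f z‖ ≤ M) (hT : ∀ ρ ∈ T, ‖ρ - z₀‖ ≤ R / 3) {z : ℂ}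
    (hz : z ∈ closedBall z₀ R) : (2 * R / 3) ^ T.card * ‖g z‖ ≤ M := by
  rw [← closure_ball z₀ hR.ne'] at hz
  have hd : DiffContOnCl ℂ g (ball z₀ R) := hg.diffContOnCl
  have key : ‖g z‖ ≤ M / (2 * R / 3) ^ T.card := by
    refine Complex.norm_le_of_forall_mem_frontier_norm_le isBounded_ball hd (fun w hw => ?_) hz
    rw [frontier_ball z₀ hR.ne'] at hw
    rw [le_div_iff₀ (by positivity)]
    have h1 : (2 * R / 3) ^ T.card ≤ ‖∏ ρ ∈ T, (w - ρ)‖ := by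
      rw [norm_prod, ← Finset.prod_const]
      refine Finset.prod_le_prod (fun _ _ => by positivity) fun ρ hρ => ?_
      have h2 : ‖w - z₀‖ = R := by rwa [mem_sphere_iff_norm] at hw
      have h3 : ‖w - z₀‖ ≤ ‖w - ρ‖ + ‖ρ - z₀‖ := by
        simpa using norm_add_le (w - ρ) (ρ - z₀)
      linarith [hT ρ hρ]
    calc ‖g w‖ * (2 * R / 3) ^ T.card ≤ ‖g w‖ * ‖∏ ρ ∈ T, (w - ρ)‖ := by gcongr
      _ = ‖f w‖ := by rw [hfg w, norm_mul, mul_comm]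
      _ ≤ M := hM w hw
  rwa [le_div_iff₀ (by positivity), mul_comm] at key

/-- At the centre every factor is at most `R/3`. Set against `2R/3` on the circle, each zero costs a
factor `2`. -/
theorem le_norm_quotient (hfg : ∀ z, f z = (∏ ρ ∈ T, (z - ρ)) * g z)
    (h₀ : m ≤ ‖f z₀‖) (hT : ∀ ρ ∈ T, ‖ρ - z₀‖ ≤ R / 3) : m ≤ (R / 3) ^ T.card * ‖g z₀‖ := by
  refine h₀.trans ?_
  rw [hfg, norm_mul]
  gcongr
  rw [norm_prod, ← Finset.prod_const]
  exact Finset.prod_le_prod (fun _ _ => norm_nonneg _) fun ρ hρ => by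
    rw [norm_sub_rev]; exact hT ρ hρ

/-- The number of zeros in a disc is bounded in terms of the growth on a larger disc. -/
theorem two_pow_card_mul_le (hf : Differentiable ℂ f) (hR : 0 < R)
    (hM : ∀ z ∈ sphere z₀ R, ‖f z‖ ≤ M) (h₀ : m ≤ ‖f z₀‖)
    (hT : ∀ ρ ∈ T, f ρ = 0 ∧ ‖ρ - z₀‖ ≤ R / 3) : 2 ^ T.card * m ≤ M := by
  obtain ⟨g, hg, hfg⟩ := exists_eq_prod_mul hf T fun ρ hρ => (hT ρ hρ).1
  have h1 := norm_quotient_le hg hfg hR hM (fun ρ hρ => (hT ρ hρ).2) (mem_closedBall_self hR.le)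
  have h2 := le_norm_quotient hfg h₀ fun ρ hρ => (hT ρ hρ).2
  calc 2 ^ T.card * m ≤ 2 ^ T.card * ((R / 3) ^ T.card * ‖g z₀‖) := by gcongr
    _ = (2 * R / 3) ^ T.card * ‖g z₀‖ := by rw [← mul_assoc, ← mul_pow]; ring_nf
    _ ≤ M := h1

/-- Once the zeros of `f` are divided out, the derivative of the logarithmic derivative is bounded
in terms of the growth of `f`. -/
theorem norm_deriv_logDeriv_quotient_le (hg : Differentiable ℂ g)
    (hfg : ∀ z, f z = (∏ ρ ∈ T, (z - ρ)) * g z) (hR : 0 < R) (hm : 0 < m)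
    (hM : ∀ z ∈ sphere z₀ R, ‖f z‖ ≤ M) (h₀ : m ≤ ‖f z₀‖) (hT : ∀ ρ ∈ T, ‖ρ - z₀‖ ≤ R / 3)
    (hg0 : ∀ z ∈ ball z₀ (R / 3), g z ≠ 0) {z : ℂ} (hz : z ∈ closedBall z₀ (R / 12)) :
    ‖deriv (logDeriv g) z‖ ≤ 2 * (Real.log (M / m) + 1) / (R / 24) / (R / 24) := by
  have hR3 : (0 : ℝ) < R / 3 := by positivity
  have hgz₀ : g z₀ ≠ 0 := hg0 _ (mem_ball_self hR3)
  have hMm : m ≤ M := by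
    have h1 := norm_quotient_le hg hfg hR hM hT (mem_closedBall_self hR.le)
    refine (le_norm_quotient hfg h₀ hT).trans (le_trans ?_ h1)
    gcongr
    linarith
  have hlog : 0 ≤ Real.log (M / m) := Real.log_nonneg ((one_le_div hm).mpr hMm)
  have hratio : ∀ w ∈ closedBall z₀ R, ‖g w / g z₀‖ ≤ M / m := fun w hw => by
    have h1 := norm_quotient_le hg hfg hR hM hT hw
    have h2 := le_norm_quotient hfg h₀ hT
    rw [norm_div, div_le_div_iff₀ (norm_pos_iff.mpr hgz₀) hm]
    have h3 : ‖g w‖ * ((R / 3) ^ T.card * ‖g z₀‖) ≤ M * ((R / 3) ^ T.card * ‖g z₀‖) / (R / 3) ^ T.card := by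
      rw [le_div_iff₀ (by positivity)]
      have : (R / 3) ^ T.card ≤ (2 * R / 3) ^ T.card := by gcongr; linarith
      calc ‖g w‖ * ((R / 3) ^ T.card * ‖g z₀‖) * (R / 3) ^ T.card
          = ((R / 3) ^ T.card * ‖g w‖) * ((R / 3) ^ T.card * ‖g z₀‖) := by ring
        _ ≤ ((2 * R / 3) ^ T.card * ‖g w‖) * ((R / 3) ^ T.card * ‖g z₀‖) := by gcongr
        _ ≤ M * ((R / 3) ^ T.card * ‖g z₀‖) := by gcongr
    calc ‖g w‖ * m ≤ ‖g w‖ * ((R / 3) ^ T.card * ‖g z₀‖) := by gcongr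
      _ ≤ _ := h3
      _ = M * ‖g z₀‖ := by field_simp
  have hld : DifferentiableOn ℂ (logDeriv g) (ball z₀ (R / 3)) := by
    intro w hw
    exact ((hg.deriv w).div (hg w) (hg0 w hw)).differentiableWithinAt
  -- A primitive of `g'/g` vanishing at the centre is a holomorphic logarithm of `g / g z₀`.
  obtain ⟨h, hh0, hh⟩ := hld.isExactOn_ball.with_val_at z₀ 0
  have hderiv : ∀ w ∈ ball z₀ (R / 3), deriv h w = logDeriv g w := fun w hw => (hh w hw).deriv
  have hexp : ∀ w ∈ ball z₀ (R / 3), Complex.exp (h w) = g w / g z₀ := by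
    have hq : ∀ w ∈ ball z₀ (R / 3), HasDerivAt (fun w => Complex.exp (-h w) * g w) 0 w := by
      intro w hw
      have h1 : HasDerivAt (fun w => Complex.exp (-h w) * g w) _ w :=
        ((hh w hw).neg.cexp).mul (hg w).hasDerivAt
      convert h1 using 1
      rw [logDeriv_apply, Pi.neg_apply]
      field_simp [hg0 w hw]
      simp
    intro w hw
    have hc := (convex_ball z₀ (R / 3)).is_const_of_fderivWithin_eq_zero (𝕜 := ℂ)
      (f := fun w => Complex.exp (-h w) * g w)
      (fun x hx => (hq x hx).differentiableAt.differentiableWithinAt) (fun x hx => by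
        rw [fderivWithin_of_isOpen isOpen_ball hx, (hq x hx).hasFDerivAt.fderiv]; ext; simp)
      hw (mem_ball_self hR3)
    simp only [hh0, neg_zero, Complex.exp_zero, one_mul] at hc
    rw [eq_div_iff hgz₀, ← hc, ← mul_assoc, ← Complex.exp_add]
    simp
  -- Borel–Carathéodory from radius `R/3` to `R/6`, which costs a factor `2`. The `+ 1` keeps the
  -- bound on the real part positive when `M = m`.
  have hbc : ∀ w ∈ closedBall z₀ (R / 6), ‖h w‖ ≤ 2 * (Real.log (M / m) + 1) := by
    intro w hw
    have hw' : ‖w - z₀‖ ≤ R / 6 := by rwa [mem_closedBall_iff_norm] at hw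
    have hadd : ∀ u ∈ ball (0 : ℂ) (R / 3), z₀ + u ∈ ball z₀ (R / 3) := fun u hu => by
      simpa using hu
    have := Complex.borelCaratheodory_zero (f := fun u => h (z₀ + u)) (R := R / 3)
      (M := Real.log (M / m) + 1) (z := w - z₀) (by linarith) ?_ ?_ hR3 ?_ (by simpa using hh0)
    · simp only [add_sub_cancel] at this
      refine this.trans ?_
      rw [div_le_iff₀ (by linarith)]
      have : 0 ≤ 2 * (Real.log (M / m) + 1) := by linarith
      exact mul_le_mul_of_nonneg_left (by linarith) this
    · intro u hu
      exact (((hh _ (hadd u hu)).differentiableAt).comp u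
        (by fun_prop : DifferentiableAt ℂ (fun u => z₀ + u) u)).differentiableWithinAt
    · intro u hu
      have h1 := hratio (z₀ + u) (ball_subset_closedBall (ball_subset_ball (by linarith) (hadd u hu)))
      rw [← hexp _ (hadd u hu), Complex.norm_exp] at h1
      have := (Real.le_log_iff_exp_le (div_pos (hm.trans_le hMm) hm)).mpr h1
      simp only [mem_ofPred_eq]
      linarith
    · simpa [mem_ball_iff_norm] using by linarith
  have hR24 : 0 < R / 24 := by positivity
  -- Two Cauchy estimates on circles of radius `R/24` follow, shrinking the disc from `R/6` to `R/8`
  -- and then to `R/12`.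
  have hb1 : ∀ w ∈ closedBall z₀ (R / 8), ‖logDeriv g w‖ ≤ 2 * (Real.log (M / m) + 1) / (R / 24) := by
    intro w hw
    have hsub : closedBall w (R / 24) ⊆ closedBall z₀ (R / 6) := by
      intro u hu
      rw [mem_closedBall] at hw hu ⊢
      linarith [dist_triangle u w z₀]
    rw [← hderiv w (closedBall_subset_ball (by linarith) hw)]
    refine Complex.norm_deriv_le_of_forall_mem_sphere_norm_le hR24 ?_
      fun u hu => hbc u (hsub (sphere_subset_closedBall hu))
    have hh' : DifferentiableOn ℂ h (ball z₀ (R / 3)) := fun u hu =>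
      (hh u hu).differentiableAt.differentiableWithinAt
    exact hh'.diffContOnCl_ball (hsub.trans (closedBall_subset_ball (by linarith)))
  have hsub2 : closedBall z (R / 24) ⊆ closedBall z₀ (R / 8) := by
    intro u hu
    rw [mem_closedBall] at hu hz ⊢
    linarith [dist_triangle u z z₀]
  refine Complex.norm_deriv_le_of_forall_mem_sphere_norm_le hR24 ?_
    fun u hu => hb1 u (hsub2 (sphere_subset_closedBall hu))
  exact hld.diffContOnCl_ball (hsub2.trans (closedBall_subset_ball (by linarith)))

end Landau


/-! ## Sums over sets with boundedly many points in each horizontal window -/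

/-- At most `N` points of `X` have an imaginary part in `[k, k + 1)`, for each integer `k`. -/
def WindowBound (X : Set ℂ) (N : ℕ) : Prop :=
  ∀ k : ℤ, ∀ T : Finset ℂ, (∀ ρ ∈ T, ρ ∈ X ∧ ⌊ρ.im⌋ = k) → T.card ≤ N

theorem WindowBound.mono {X Y : Set ℂ} {N : ℕ} (h : WindowBound X N) (hY : Y ⊆ X) :
    WindowBound Y N := fun k T hT => h k T fun ρ hρ => ⟨hY (hT ρ hρ).1, (hT ρ hρ).2⟩

/-- Grouping a finite partial sum by windows, each value `φ k` is used at most `N` times. -/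
theorem WindowBound.summable {X : Set ℂ} {N : ℕ} (h : WindowBound X N) {φ : ℤ → ℝ}
    (hφ0 : ∀ k, 0 ≤ φ k) (hφ : Summable φ) {u : X → ℝ} (hu0 : ∀ ρ, 0 ≤ u ρ)
    (hu : ∀ ρ : X, u ρ ≤ φ ⌊(ρ : ℂ).im⌋) : Summable u ∧ ∑' ρ, u ρ ≤ N * ∑' k, φ k := by
  classical
  have key : ∀ S : Finset X, ∑ ρ ∈ S, u ρ ≤ N * ∑' k, φ k := fun S => by
    calc ∑ ρ ∈ S, u ρ ≤ ∑ ρ ∈ S, φ ⌊(ρ : ℂ).im⌋ := Finset.sum_le_sum fun ρ _ => hu ρ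
      _ = ∑ k ∈ S.image fun ρ : X => ⌊(ρ : ℂ).im⌋,
            (S.filter fun ρ : X => ⌊(ρ : ℂ).im⌋ = k).card • φ k :=
          Finset.sum_comp φ fun ρ : X => ⌊(ρ : ℂ).im⌋
      _ ≤ ∑ k ∈ S.image fun ρ : X => ⌊(ρ : ℂ).im⌋, N * φ k := by
          refine Finset.sum_le_sum fun k _ => ?_
          rw [nsmul_eq_mul]
          refine mul_le_mul_of_nonneg_right ?_ (hφ0 k)
          have := h k ((S.filter fun ρ : X => ⌊(ρ : ℂ).im⌋ = k).map (Function.Embedding.subtype _))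
            (by
              intro ρ hρ
              simp only [Finset.mem_map, Finset.mem_filter, Function.Embedding.subtype_apply] at hρ
              obtain ⟨σ, ⟨_, hσ⟩, rfl⟩ := hρ
              exact ⟨σ.2, hσ⟩)
          rw [Finset.card_map] at this
          exact_mod_cast this
      _ = N * ∑ k ∈ S.image fun ρ : X => ⌊(ρ : ℂ).im⌋, φ k := by rw [Finset.mul_sum]
      _ ≤ N * ∑' k, φ k := by
          gcongr
          exact hφ.sum_le_tsum _ fun k _ => hφ0 k
  have hs := summable_of_sum_le hu0 key
  exact ⟨hs, hs.tsum_le_of_sum_le key⟩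

/-- The offset `1/2` keeps every denominator nonzero, and translation invariance makes bounds built
on this series independent of the height `m`. -/
theorem summable_int_shift {s : ℝ} (hs : 1 < s) (c : ℝ) (m : ℤ) :
    Summable (fun k : ℤ => c * (1 / |((k - m : ℤ) : ℝ) + 1 / 2| ^ s)) ∧
      ∑' k : ℤ, c * (1 / |((k - m : ℤ) : ℝ) + 1 / 2| ^ s) =
        ∑' k : ℤ, c * (1 / |(k : ℝ) + 1 / 2| ^ s) := by
  have h := ((Real.summable_one_div_int_add_rpow (1 / 2) s).mpr hs).mul_left c
  exact ⟨(Equiv.subRight m).summable_iff.mpr h, (Equiv.subRight m).tsum_eq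
    fun k : ℤ => c * (1 / |(k : ℝ) + 1 / 2| ^ s)⟩

/-- The hypotheses give `‖z - ρ‖ ≥ 1`, so the rounding errors of the two floors and the offset `1/2`
are absorbed by the factor `4`, squared to `16`. -/
theorem one_div_sq_le_window {w z ρ : ℂ} (hρ : 2 ≤ ‖w - ρ‖) (hz : z ∈ Metric.ball w 1) :
    ‖1 / (z - ρ) ^ 2‖ ≤ 16 * (1 / |((⌊ρ.im⌋ - ⌊w.im⌋ : ℤ) : ℝ) + 1 / 2| ^ (2 : ℝ)) := by
  rw [mem_ball_iff_norm] at hz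
  have h1 : ‖w - ρ‖ ≤ ‖z - ρ‖ + ‖z - w‖ := by
    rw [norm_sub_rev z w, add_comm]; simpa using norm_add_le (w - z) (z - ρ)
  have h2 : |w.im - ρ.im| ≤ ‖w - ρ‖ := Complex.abs_im_le_norm (w - ρ)
  have hpos : (0 : ℝ) < |((⌊ρ.im⌋ - ⌊w.im⌋ : ℤ) : ℝ) + 1 / 2| := by
    rw [abs_pos]
    intro h0
    have : ((2 * (⌊ρ.im⌋ - ⌊w.im⌋) + 1 : ℤ) : ℝ) = 0 := by push_cast at h0 ⊢; linarith
    have : (2 * (⌊ρ.im⌋ - ⌊w.im⌋) + 1 : ℤ) = 0 := by exact_mod_cast this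
    omega
  have h3 : |((⌊ρ.im⌋ - ⌊w.im⌋ : ℤ) : ℝ) + 1 / 2| ≤ 4 * ‖z - ρ‖ := by
    have a1 := Int.floor_le ρ.im
    have a2 := Int.lt_floor_add_one ρ.im
    have a3 := Int.floor_le w.im
    have a4 := Int.lt_floor_add_one w.im
    rw [abs_le] at h2 ⊢
    push_cast
    constructor <;> linarith
  rw [norm_div, norm_one, norm_pow, Real.rpow_two, mul_one_div,
    div_le_div_iff₀ (pow_pos (by linarith) 2) (pow_pos hpos 2), one_mul]
  calc |((⌊ρ.im⌋ - ⌊w.im⌋ : ℤ) : ℝ) + 1 / 2| ^ 2 ≤ (4 * ‖z - ρ‖) ^ 2 := by gcongr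
    _ = 16 * ‖z - ρ‖ ^ 2 := by ring

/-- Sums of `1 / (z - ρ) ^ 2` over points away from `z`. -/
theorem WindowBound.sum_one_div_sq {X : Set ℂ} {N : ℕ} (h : WindowBound X N) {w : ℂ}
    (hX : ∀ ρ ∈ X, 2 ≤ ‖w - ρ‖) :
    DifferentiableOn ℂ (fun z : ℂ => ∑' ρ : X, 1 / (z - (ρ : ℂ)) ^ 2) (Metric.ball w 1) ∧
      ∀ z ∈ Metric.ball w 1, Summable (fun ρ : X => 1 / (z - ρ) ^ 2) ∧
        ‖∑' ρ : X, 1 / (z - ρ) ^ 2‖ ≤ N * ∑' k : ℤ, 16 * (1 / |(k : ℝ) + 1 / 2| ^ (2 : ℝ)) := by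
  obtain ⟨hs, ht⟩ := summable_int_shift one_lt_two 16 ⌊w.im⌋
  have hφ0 : ∀ k : ℤ, 0 ≤ 16 * (1 / |((k - ⌊w.im⌋ : ℤ) : ℝ) + 1 / 2| ^ (2 : ℝ)) :=
    fun k => by positivity
  have h1 := (h.summable hφ0 hs (u := fun ρ => 16 * (1 / |((⌊(ρ : ℂ).im⌋ - ⌊w.im⌋ : ℤ) : ℝ) + 1 / 2| ^ (2 : ℝ))) (fun ρ => hφ0 _)
    fun ρ => le_rfl)
  have hle : ∀ ρ : X, ∀ z ∈ Metric.ball w 1, ‖1 / (z - ρ) ^ 2‖ ≤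
      16 * (1 / |((⌊(ρ : ℂ).im⌋ - ⌊w.im⌋ : ℤ) : ℝ) + 1 / 2| ^ (2 : ℝ)) :=
    fun ρ z hz => one_div_sq_le_window (hX ρ ρ.2) hz
  refine ⟨Complex.differentiableOn_tsum_of_summable_norm h1.1 (fun ρ => ?_) Metric.isOpen_ball hle,
    fun z hz => ⟨.of_norm_bounded h1.1 fun ρ => hle ρ z hz, ?_⟩⟩
  · intro z hz
    have : z - ρ ≠ 0 := fun h0 => by
      have := hX ρ ρ.2
      rw [← sub_eq_zero.mp h0, norm_sub_rev] at this
      rw [mem_ball_iff_norm] at hz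
      linarith
    have : (z - ρ) ^ 2 ≠ 0 := pow_ne_zero 2 this
    fun_prop (disch := assumption)
  · rw [← ht]
    exact (tsum_of_norm_bounded h1.1.hasSum fun ρ => hle ρ z hz).trans h1.2

/-! ## Partial fractions -/

/-- Liouville's theorem for a function known only off isolated points. The diagonal `z ↦ φ z z` of
the local extensions is entire and bounded; `D` may take default values at its singularities, hence
the restriction to points of continuity. -/
theorem exists_const_of_bounded_analytic_extension {D : ℂ → ℂ} {C : ℝ}
    (h : ∀ w, ∃ φ : ℂ → ℂ, AnalyticAt ℂ φ w ∧ ‖φ w‖ ≤ C ∧ D =ᶠ[𝓝[≠] w] φ) :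
    ∃ c, ∀ z, ContinuousAt D z → D z = c := by
  choose φ hφ hC hD using h
  -- Near `w` the extensions centred at `z` and at `w` both agree with `D` on a punctured
  -- neighbourhood of `z`, so by continuity they have the same value at `z`.
  have hext : ∀ w, (fun z => φ z z) =ᶠ[𝓝 w] φ w := by
    intro w
    have h1 : ∀ᶠ z in 𝓝[≠] w, φ z z = φ w z := by
      filter_upwards [eventually_eventually_nhdsWithin.mpr (hD w), self_mem_nhdsWithin,
        (hφ w).eventually_continuousAt.filter_mono nhdsWithin_le_nhds] with z hz hzw hc
      have hzw : z ≠ w := hzw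
      have e : 𝓝[≠] z ≤ 𝓝[≠] w ⊔ 𝓝[≠] z := le_sup_right
      have h2 : D =ᶠ[𝓝[≠] z] φ w := by
        have : 𝓝[≠] z ≤ 𝓝[{w}ᶜ] z := by
          rw [(isOpen_compl_singleton.nhdsWithin_eq (a := z) (s := {w}ᶜ) hzw)]
          exact nhdsWithin_le_nhds
        exact hz.filter_mono this
      exact (((hφ z).continuousAt.eventuallyEq_nhds_iff_eventuallyEq_nhdsNE hc).mp
        ((hD z).symm.trans h2)).eq_of_nhds
    rw [← nhdsNE_sup_pure w]
    exact Filter.eventually_sup.mpr ⟨h1, by simp⟩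
  have hdiff : Differentiable ℂ fun z => φ z z := fun w =>
    (hφ w).differentiableAt.congr_of_eventuallyEq (hext w)
  have hb : Bornology.IsBounded (range fun z => φ z z) :=
    isBounded_iff_forall_norm_le.mpr ⟨C, by rintro _ ⟨z, rfl⟩; exact hC z⟩
  refine ⟨φ 0 0, fun z hz => ?_⟩
  rw [← hdiff.apply_eq_apply_of_bounded hb z 0]
  exact ((hz.eventuallyEq_nhds_iff_eventuallyEq_nhdsNE (hφ z).continuousAt).mp (hD z)).eq_of_nhds

section PartialFractions

variable {f : ℂ → ℂ}

theorem eventually_ne_zero_of_simple (hf : Differentiable ℂ f)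
    (hs : ∀ ρ, f ρ = 0 → deriv f ρ ≠ 0) (w : ℂ) : ∀ᶠ z in 𝓝[≠] w, f z ≠ 0 := by
  by_cases hw : f w = 0
  · exact (hf w).hasDerivAt.eventually_ne (hs w hw)
  · exact (hf.continuous.continuousAt.eventually_ne hw).filter_mono nhdsWithin_le_nhds

theorem finite_zeros_of_simple (hf : Differentiable ℂ f)
    (hs : ∀ ρ, f ρ = 0 → deriv f ρ ≠ 0) {K : Set ℂ} (hK : IsCompact K) :
    {z | z ∈ K ∧ f z = 0}.Finite := by
  by_contra hinf
  obtain ⟨x, -, hx⟩ := Set.Infinite.exists_accPt_of_subset_isCompact hinf hK fun z hz => hz.1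
  rw [accPt_iff_frequently_nhdsNE] at hx
  exact hx ((eventually_ne_zero_of_simple hf hs x).mono fun z hz h0 => hz h0.2)

theorem deriv_logDeriv_prod_mul {g : ℂ → ℂ} {T : Finset ℂ} (hg : Differentiable ℂ g)
    (hfg : ∀ z, f z = (∏ ρ ∈ T, (z - ρ)) * g z) {z : ℂ} (hz : f z ≠ 0) :
    deriv (logDeriv f) z = -∑ ρ ∈ T, 1 / (z - ρ) ^ 2 + deriv (logDeriv g) z := by
  have hfd : Differentiable ℂ f := by
    have : f = fun z => (∏ ρ ∈ T, (z - ρ)) * g z := funext hfg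
    rw [this]; fun_prop
  have key : ∀ᶠ u in 𝓝 z, logDeriv f u = ∑ ρ ∈ T, 1 / (u - ρ) + logDeriv g u := by
    filter_upwards [hfd.continuous.continuousAt.eventually_ne hz] with u hu
    have hu' := hu
    rw [hfg, mul_ne_zero_iff, Finset.prod_ne_zero_iff] at hu'
    have e : f = fun z => (∏ ρ ∈ T, (z - ρ)) * g z := funext hfg
    rw [e, logDeriv_mul u (Finset.prod_ne_zero_iff.mpr hu'.1) hu'.2 (by fun_prop) (hg u),
      show (fun z => ∏ ρ ∈ T, (z - ρ)) = fun z => ∏ ρ ∈ T, (fun z => z - ρ) z from rfl,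
      logDeriv_prod hu'.1 (fun ρ _ => by fun_prop)]
    congr 1
    refine Finset.sum_congr rfl fun ρ _ => ?_
    simp [logDeriv_apply]
  have hz' := hz
  rw [hfg, mul_ne_zero_iff, Finset.prod_ne_zero_iff] at hz'
  rw [Filter.EventuallyEq.deriv_eq key]
  have h1 : ∀ ρ ∈ T, HasDerivAt (fun u : ℂ => 1 / (u - ρ)) (-(1 / (z - ρ) ^ 2)) z := fun ρ hρ => by
    have h := ((hasDerivAt_id z).sub_const ρ).fun_inv (hz'.1 ρ hρ)
    simpa [neg_div] using h
  have h2 : DifferentiableAt ℂ (logDeriv g) z := (hg.deriv z).div (hg z) hz'.2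
  have h3 := (HasDerivAt.fun_sum h1).add h2.hasDerivAt
  rw [← Finset.sum_neg_distrib]
  exact h3.deriv

variable {σ R M m C : ℝ}

/-- A zero in window `k` is within `2σ + 1 ≤ R/3` of `σ + ik`, so the disc count gives `card ≤ 2 ^
card ≤ M / m`. -/
theorem windowBound_zeros (hf : Differentiable ℂ f)
    (hstrip : ∀ ρ, f ρ = 0 → |ρ.re| ≤ σ) (hσ : 0 ≤ σ) (hR : 24 * σ + 48 ≤ R) (hm : 0 < m)
    (hM : ∀ y : ℝ, ∀ z ∈ Metric.sphere (⟨σ, y⟩ : ℂ) R, ‖f z‖ ≤ M) (h₀ : ∀ y : ℝ, m ≤ ‖f ⟨σ, y⟩‖) :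
    WindowBound {z | f z = 0} ⌊M / m⌋₊ := by
  intro k T hT
  have h1 := two_pow_card_mul_le (T := T) hf (by linarith : 0 < R) (hM k) (h₀ k) fun ρ hρ => by
    obtain ⟨h0, hk⟩ := hT ρ hρ
    refine ⟨h0, ?_⟩
    have a1 := Int.floor_le ρ.im
    have a2 := Int.lt_floor_add_one ρ.im
    rw [hk] at a1 a2
    have a3 := hstrip ρ h0
    refine (Complex.norm_le_abs_re_add_abs_im _).trans ?_
    rw [abs_le] at a3
    have b1 : |(ρ - ⟨σ, k⟩ : ℂ).re| ≤ 2 * σ := by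
      rw [abs_le]; simp only [Complex.sub_re]; constructor <;> linarith
    have b2 : |(ρ - ⟨σ, k⟩ : ℂ).im| ≤ 1 := by
      rw [abs_le]; simp only [Complex.sub_im]; constructor <;> linarith
    linarith
  refine Nat.le_floor ?_
  rw [le_div_iff₀ hm]
  refine le_trans ?_ h1
  gcongr
  exact_mod_cast T.card.lt_two_pow_self.le

/-- Near each point, the derivative of the logarithmic derivative is the sum of the principal parts
at finitely many zeros and of a function with a uniform bound. -/
theorem exists_local_principal_part (hf : Differentiable ℂ f)
    (hs : ∀ ρ, f ρ = 0 → deriv f ρ ≠ 0)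
    (hstrip : ∀ ρ, f ρ = 0 → |ρ.re| ≤ σ) (hσ : 0 ≤ σ) (hR : 24 * σ + 48 ≤ R) (hm : 0 < m)
    (hM : ∀ y : ℝ, ∀ z ∈ Metric.sphere (⟨σ, y⟩ : ℂ) R, ‖f z‖ ≤ M) (h₀ : ∀ y : ℝ, m ≤ ‖f ⟨σ, y⟩‖)
    (hC : ∀ z : ℂ, σ + 2 ≤ |z.re| → ‖deriv (logDeriv f) z‖ ≤ C) :
    ∃ C' : ℝ, ∀ w, ∃ (T : Finset ℂ) (ψ : ℂ → ℂ), (∀ ρ ∈ T, f ρ = 0) ∧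
      (∀ ρ, f ρ = 0 → ρ ∉ T → 2 ≤ ‖w - ρ‖) ∧ AnalyticAt ℂ ψ w ∧ ‖ψ w‖ ≤ C' ∧
      ∀ z, f z ≠ 0 → deriv (logDeriv f) z = -∑ ρ ∈ T, 1 / (z - ρ) ^ 2 + ψ z := by
  refine ⟨max C (2 * (Real.log (M / m) + 1) / (R / 24) / (R / 24)), fun w => ?_⟩
  have hR0 : 0 < R := by linarith
  -- Outside the widened strip no zero is within distance `2`, and the assumed bound `C` applies
  -- without removing any.
  rcases le_or_gt (σ + 2) |w.re| with hw | hw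
  · have hdist : ∀ ρ, f ρ = 0 → 2 ≤ ‖w - ρ‖ := fun ρ hρ => by
      have h1 := hstrip ρ hρ
      have h2 := Complex.abs_re_le_norm (w - ρ)
      have h3 := abs_sub_abs_le_abs_sub w.re ρ.re
      rw [Complex.sub_re] at h2
      linarith
    have hfw : f w ≠ 0 := fun h0 => by
      have := hdist w h0
      norm_num at this
    refine ⟨∅, deriv (logDeriv f), by simp, fun ρ hρ _ => hdist ρ hρ, ?_,
      (hC w hw).trans (le_max_left _ _), by simp⟩
    have ha : AnalyticAt ℂ f w := hf.analyticAt w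
    exact (ha.deriv.div ha hfw).deriv
  · set z₀ : ℂ := ⟨σ, w.im⟩ with hz₀
    have hfin := finite_zeros_of_simple hf hs (isCompact_closedBall z₀ (R / 3))
    set T := hfin.toFinset with hTdef
    have hT : ∀ ρ, ρ ∈ T ↔ ‖ρ - z₀‖ ≤ R / 3 ∧ f ρ = 0 := fun ρ => by
      rw [hTdef, hfin.mem_toFinset, mem_ofPred_eq, mem_closedBall_iff_norm]
    obtain ⟨g, hg, hfg⟩ := exists_eq_prod_mul hf T fun ρ hρ => ((hT ρ).mp hρ).2
    have hg0 : ∀ z ∈ Metric.ball z₀ (R / 3), g z ≠ 0 := by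
      intro z hz h0
      have hfz : f z = 0 := by rw [hfg, h0, mul_zero]
      have hderiv : deriv f z = (∏ ρ ∈ T, (z - ρ)) * deriv g z := by
        have e : f = fun z => (∏ ρ ∈ T, (z - ρ)) * g z := funext hfg
        rw [e, deriv_fun_mul (by fun_prop) (hg z), h0, mul_zero, zero_add]
      refine hs z hfz ?_
      rw [hderiv, Finset.prod_eq_zero ((hT z).mpr ⟨?_, hfz⟩) (sub_self z), zero_mul]
      exact (mem_ball_iff_norm.mp hz).le
    -- The requirement `R ≥ 24σ + 48` gives `2σ + 2 ≤ R/12`, placing `w` where the quotient estimate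
    -- is valid, and leaves zeros outside the disc of radius `R/3` at distance at least `2` from
    -- `w`.
    have hwz : ‖w - z₀‖ ≤ 2 * σ + 2 := by
      refine (Complex.norm_le_abs_re_add_abs_im _).trans ?_
      rw [abs_lt] at hw
      have b1 : |(w - z₀).re| ≤ 2 * σ + 2 := by
        rw [abs_le]; simp only [hz₀, Complex.sub_re]; constructor <;> linarith
      have b2 : |(w - z₀).im| = 0 := by simp [hz₀]
      linarith
    have hwb : w ∈ Metric.ball z₀ (R / 3) := by rw [mem_ball_iff_norm]; linarith
    refine ⟨T, deriv (logDeriv g), fun ρ hρ => ((hT ρ).mp hρ).2, fun ρ hρ hρT => ?_, ?_,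
      (norm_deriv_logDeriv_quotient_le hg hfg hR0 hm (hM _) (h₀ _) (fun ρ hρ => ((hT ρ).mp hρ).1)
        hg0 ?_).trans (le_max_right _ _), fun z hz => deriv_logDeriv_prod_mul hg hfg hz⟩
    · have h1 : R / 3 < ‖ρ - z₀‖ := by
        by_contra! h
        exact hρT ((hT ρ).mpr ⟨h, hρ⟩)
      have h2 : ‖ρ - z₀‖ ≤ ‖w - ρ‖ + ‖w - z₀‖ := by
        rw [norm_sub_rev w ρ]; simpa using norm_add_le (ρ - w) (w - z₀)
      linarith
    · have ha : AnalyticAt ℂ g w := hg.analyticAt w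
      exact (ha.deriv.div ha (hg0 w hwb)).deriv
    · rw [mem_closedBall_iff_norm]; linarith

/-- The partial fraction expansion of the second logarithmic derivative of an entire function with
simple zeros in a vertical strip that is bounded, with bounded inverse, on vertical lines. -/
theorem hasSum_one_div_sq (hf : Differentiable ℂ f)
    (hs : ∀ ρ, f ρ = 0 → deriv f ρ ≠ 0)
    (hstrip : ∀ ρ, f ρ = 0 → |ρ.re| ≤ σ) (hσ : 0 ≤ σ) (hR : 24 * σ + 48 ≤ R) (hm : 0 < m)
    (hM : ∀ y : ℝ, ∀ z ∈ Metric.sphere (⟨σ, y⟩ : ℂ) R, ‖f z‖ ≤ M) (h₀ : ∀ y : ℝ, m ≤ ‖f ⟨σ, y⟩‖)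
    (hC : ∀ z : ℂ, σ + 2 ≤ |z.re| → ‖deriv (logDeriv f) z‖ ≤ C)
    (hlim : Tendsto (fun x : ℝ => deriv (logDeriv f) x) atTop (𝓝 0)) {z : ℂ} (hz : f z ≠ 0) :
    HasSum (fun ρ : {z | f z = 0} => 1 / (z - ρ) ^ 2) (-deriv (logDeriv f) z) := by
  have hwin := windowBound_zeros hf hstrip hσ hR hm hM h₀
  obtain ⟨C', hloc⟩ := exists_local_principal_part hf hs hstrip hσ hR hm hM h₀ hC
  set X : Set ℂ := {z | f z = 0} with hX
  set K := (⌊M / m⌋₊ : ℝ) * ∑' k : ℤ, 16 * (1 / |(k : ℝ) + 1 / 2| ^ (2 : ℝ)) with hK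
  -- The finitely many principal parts near `w` cancel in the difference; what remains is the
  -- quotient term plus the sum over the distant zeros, both uniformly bounded.
  have main : ∀ w, ∃ φ : ℂ → ℂ, AnalyticAt ℂ φ w ∧ ‖φ w‖ ≤ C' + K ∧
      ∀ z ∈ Metric.ball w 1, f z ≠ 0 →
        HasSum (fun ρ : X => 1 / (z - ρ) ^ 2) (φ z - deriv (logDeriv f) z) := by
    intro w
    obtain ⟨T, ψ, hT0, hTw, hψ, hψC, hT⟩ := hloc w
    have hY := (hwin.mono (Y := X \ T) sdiff_subset).sum_one_div_sq (w := w)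
      fun ρ hρ => hTw ρ hρ.1 hρ.2
    refine ⟨fun z => ψ z + ∑' ρ : (X \ T : Set ℂ), 1 / (z - ρ) ^ 2, ?_, ?_, fun z hzw hz => ?_⟩
    · exact hψ.add (hY.1.analyticAt (Metric.isOpen_ball.mem_nhds (Metric.mem_ball_self one_pos)))
    · exact (norm_add_le _ _).trans (add_le_add hψC (hY.2 w (Metric.mem_ball_self one_pos)).2)
    · have h1 := T.hasSum fun ρ => 1 / (z - ρ) ^ 2
      have h2 := (hY.2 z hzw).1.hasSum
      have h3 := HasSum.add_disjoint (f := fun ρ => 1 / (z - ρ) ^ 2) (s := (T : Set ℂ))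
        (t := X \ T) disjoint_sdiff_right h1 h2
      have e : (T : Set ℂ) ∪ X \ T = X := union_sdiff_cancel fun ρ hρ => hT0 ρ hρ
      rw [e] at h3
      have e2 : ψ z + ∑' ρ : (X \ T : Set ℂ), 1 / (z - (ρ : ℂ)) ^ 2 - deriv (logDeriv f) z =
          ∑ ρ ∈ T, 1 / (z - ρ) ^ 2 + ∑' ρ : (X \ T : Set ℂ), 1 / (z - (ρ : ℂ)) ^ 2 := by
        rw [hT z hz]; ring
      rw [e2]
      exact h3
  set D : ℂ → ℂ := fun z => deriv (logDeriv f) z + ∑' ρ : X, 1 / (z - ρ) ^ 2 with hD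
  have hDφ : ∀ w, ∃ φ : ℂ → ℂ, AnalyticAt ℂ φ w ∧ ‖φ w‖ ≤ C' + K ∧
      ∀ z ∈ Metric.ball w 1, f z ≠ 0 → D z = φ z := fun w => by
    obtain ⟨φ, h1, h2, h3⟩ := main w
    exact ⟨φ, h1, h2, fun z hz hfz => by simp only [hD, (h3 z hz hfz).tsum_eq]; ring⟩
  obtain ⟨c, hc⟩ := exists_const_of_bounded_analytic_extension (D := D) (C := C' + K) fun w => by
    obtain ⟨φ, h1, h2, h3⟩ := hDφ w
    refine ⟨φ, h1, h2, ?_⟩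
    filter_upwards [eventually_ne_zero_of_simple hf hs w,
      mem_nhdsWithin_of_mem_nhds (Metric.ball_mem_nhds w one_pos)] with z hz hzw
    exact h3 z hzw hz
  have hDc : ∀ z, f z ≠ 0 → D z = c := fun z hz => hc z <| by
    obtain ⟨φ, h1, -, h3⟩ := hDφ z
    refine h1.continuousAt.congr ?_
    filter_upwards [hf.continuous.continuousAt.eventually_ne hz,
      Metric.ball_mem_nhds z one_pos] with u hu huz
    exact (h3 u huz hu).symm
  have hsum : ∀ z, f z ≠ 0 → Summable fun ρ : X => 1 / (z - ρ) ^ 2 := fun z hz => by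
    obtain ⟨φ, -, -, h3⟩ := main z
    exact (h3 z (Metric.mem_ball_self one_pos) hz).summable
  have hne : ∀ x : ℝ, σ < x → f x ≠ 0 := fun x hx h0 => by
    have := hstrip x h0
    rw [Complex.ofReal_re] at this
    linarith [le_abs_self x]
  -- The constant is found by letting `z` tend to infinity along the positive reals; the terms at `σ
  -- + 1` dominate the series.
  have hc0 : c = 0 := by
    have h1 : Tendsto (fun x : ℝ => ∑' ρ : X, 1 / ((x : ℂ) - ρ) ^ 2) atTop
        (𝓝 (∑' ρ : X, (0 : ℂ))) := by
      refine tendsto_tsum_of_dominated_convergence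
        (hsum ((σ + 1 : ℝ) : ℂ) (hne _ (by linarith))).norm (fun ρ => ?_) ?_
      · have h2 : Tendsto (fun x : ℝ => (x : ℂ) - ρ) atTop (Bornology.cobounded ℂ) := by
          rw [← tendsto_norm_atTop_iff_cobounded]
          refine tendsto_atTop_mono (f := fun x : ℝ => x - (ρ : ℂ).re) (fun x => ?_)
            (tendsto_atTop_add_const_right _ _ tendsto_id)
          refine le_trans ?_ (Complex.re_le_norm _)
          simp
        have h3 := (tendsto_inv₀_cobounded.comp h2).pow 2
        simpa [Function.comp_def] using h3
      · filter_upwards [eventually_ge_atTop (σ + 1)] with x hx ρ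
        have hρ := (abs_le.mp (hstrip ρ ρ.2)).2
        rw [norm_div, norm_div, norm_pow, norm_pow]
        have hpos : 0 < ‖((σ + 1 : ℝ) : ℂ) - ρ‖ := by
          refine lt_of_lt_of_le ?_ (Complex.re_le_norm _)
          simp only [Complex.sub_re, Complex.ofReal_re]
          linarith
        gcongr
        rw [Complex.norm_eq_sqrt_sq_add_sq, Complex.norm_eq_sqrt_sq_add_sq]
        refine Real.sqrt_le_sqrt ?_
        simp only [Complex.sub_re, Complex.sub_im, Complex.ofReal_re, Complex.ofReal_im]
        gcongr
        linarith
    have h2 : Tendsto (fun x : ℝ => D x) atTop (𝓝 0) := by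
      simpa [hD] using hlim.add h1
    refine tendsto_nhds_unique (tendsto_const_nhds.congr' ?_) h2
    filter_upwards [eventually_gt_atTop σ] with x hx
    exact (hDc x (hne x hx)).symm
  have h1 := (hsum z hz).hasSum
  have h2 := hDc z hz
  rw [hc0] at h2
  rwa [eq_neg_of_add_eq_zero_right h2] at h1

end PartialFractions


/-! ## Exponential polynomials -/

/-- The exponential polynomial `A + B e^{-rz} + C e^{-qz}`. -/
def expPoly (A B C r q : ℝ) (z : ℂ) : ℂ :=
  A + B * Complex.exp (-(r * z)) + C * Complex.exp (-(q * z))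

section ExpPoly

variable {A B C r q : ℝ}

theorem hasDerivAt_expPoly (A B C r q : ℝ) (z : ℂ) :
    HasDerivAt (expPoly A B C r q) (expPoly 0 (-(r * B)) (-(q * C)) r q z) z := by
  have h : ∀ t : ℝ, HasDerivAt (fun z : ℂ => Complex.exp (-(t * z)))
      (Complex.exp (-(t * z)) * -(t * 1)) z := fun t =>
    ((hasDerivAt_id z).const_mul (t : ℂ)).neg.cexp
  have h1 := (((h r).const_mul (B : ℂ)).const_add (A : ℂ)).add ((h q).const_mul (C : ℂ))
  refine h1.congr_deriv ?_
  simp only [expPoly]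
  push_cast
  ring

theorem differentiable_expPoly : Differentiable ℂ (expPoly A B C r q) :=
  fun z => (hasDerivAt_expPoly A B C r q z).differentiableAt

theorem deriv_expPoly : deriv (expPoly A B C r q) = expPoly 0 (-(r * B)) (-(q * C)) r q :=
  funext fun z => (hasDerivAt_expPoly A B C r q z).deriv

theorem deriv_deriv_expPoly :
    deriv (deriv (expPoly A B C r q)) = expPoly 0 (r ^ 2 * B) (q ^ 2 * C) r q := by
  rw [deriv_expPoly, deriv_expPoly]
  congr 1 <;> ring

theorem norm_expPoly_le (A B C r q : ℝ) (z : ℂ) :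
    ‖expPoly A B C r q z‖ ≤ |A| + |B| * Real.exp (-(r * z.re)) + |C| * Real.exp (-(q * z.re)) := by
  refine (norm_add₃_le).trans ?_
  simp [Complex.norm_exp]

theorem norm_expPoly_zero_le {r q : ℝ} (hrq : r ≤ q) (B C : ℝ) {z : ℂ} (hz : 0 ≤ z.re) :
    ‖expPoly 0 B C r q z‖ ≤ (|B| + |C|) * Real.exp (-(r * z.re)) := by
  refine (norm_expPoly_le 0 B C r q z).trans ?_
  have : Real.exp (-(q * z.re)) ≤ Real.exp (-(r * z.re)) :=
    Real.exp_le_exp.mpr (by nlinarith)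
  rw [abs_zero, zero_add, add_mul]
  gcongr

theorem deriv_logDeriv_eq {f : ℂ → ℂ} (hf : Differentiable ℂ f) {z : ℂ} (hz : f z ≠ 0) :
    deriv (logDeriv f) z = (deriv (deriv f) z * f z - deriv f z ^ 2) / f z ^ 2 := by
  have h := (hf.deriv z).hasDerivAt.div (hf z).hasDerivAt hz
  rw [show logDeriv f = deriv f / f from rfl, h.deriv, sq (deriv f z)]

theorem tendsto_exp_neg_mul_atTop (hr : 0 < r) :
    Tendsto (fun x : ℝ => Real.exp (-(r * x))) atTop (𝓝 0) :=
  Real.tendsto_exp_neg_atTop_nhds_zero.comp (tendsto_id.const_mul_atTop hr)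

/-- Far to the right the constant term dominates, while the first two derivatives have no constant
term and decay like `e^{-r Re z}`. -/
theorem exists_expPoly_right_bounds (hA : A ≠ 0) (hr : 0 < r) (hrq : r ≤ q) :
    ∃ σ K : ℝ, 0 ≤ σ ∧ 0 ≤ K ∧ ∀ z : ℂ, σ ≤ z.re → |A| / 2 ≤ ‖expPoly A B C r q z‖ ∧
      ‖deriv (logDeriv (expPoly A B C r q)) z‖ ≤ K * Real.exp (-(r * z.re)) := by
  have hA' : 0 < |A| := abs_pos.mpr hA
  have hlim : Tendsto (fun x : ℝ => (|B| + |C|) * Real.exp (-(r * x))) atTop (𝓝 0) := by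
    simpa using (tendsto_exp_neg_mul_atTop hr).const_mul (|B| + |C|)
  obtain ⟨σ, hσ⟩ := ((hlim.eventually_lt_const (half_pos hA')).and
    (eventually_ge_atTop 0)).exists_forall_of_atTop
  set K0 := |A| + (|B| + |C|)
  set K1 := |(-(r * B))| + |(-(q * C))|
  set K2 := |r ^ 2 * B| + |q ^ 2 * C|
  refine ⟨σ, (K2 * K0 + K1 ^ 2) / (|A| / 2) ^ 2, (hσ σ le_rfl).2, by positivity, fun z hz => ?_⟩
  obtain ⟨h1, h2⟩ := hσ z.re hz
  have hsplit : expPoly A B C r q z = A + expPoly 0 B C r q z := by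
    simp only [expPoly]; push_cast; ring
  have h3 := norm_expPoly_zero_le hrq B C h2
  have hexp : Real.exp (-(r * z.re)) ≤ 1 := Real.exp_le_one_iff.mpr (by nlinarith)
  have hlow : |A| / 2 ≤ ‖expPoly A B C r q z‖ := by
    have h4 := norm_sub_norm_le (A : ℂ) (-expPoly 0 B C r q z)
    rw [norm_neg, sub_neg_eq_add, ← hsplit, Complex.norm_real, Real.norm_eq_abs] at h4
    linarith
  have hup : ‖expPoly A B C r q z‖ ≤ K0 := by
    rw [hsplit]
    refine (norm_add_le _ _).trans ?_
    rw [Complex.norm_real, Real.norm_eq_abs]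
    refine add_le_add le_rfl (h3.trans ?_)
    exact mul_le_of_le_one_right (by positivity) hexp
  refine ⟨hlow, ?_⟩
  have hne : expPoly A B C r q z ≠ 0 := norm_pos_iff.mp (by linarith)
  rw [deriv_logDeriv_eq differentiable_expPoly hne, deriv_deriv_expPoly, deriv_expPoly, norm_div,
    norm_pow, div_mul_eq_mul_div]
  have h5 := norm_expPoly_zero_le hrq (-(r * B)) (-(q * C)) h2
  have h6 := norm_expPoly_zero_le hrq (r ^ 2 * B) (q ^ 2 * C) h2
  have hE := (Real.exp_pos (-(r * z.re))).le
  have hnum : ‖expPoly 0 (r ^ 2 * B) (q ^ 2 * C) r q z * expPoly A B C r q z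
      - expPoly 0 (-(r * B)) (-(q * C)) r q z ^ 2‖ ≤ (K2 * K0 + K1 ^ 2) * Real.exp (-(r * z.re)) := by
    refine (norm_sub_le _ _).trans ?_
    rw [norm_mul, norm_pow]
    calc _ ≤ (K2 * Real.exp (-(r * z.re))) * K0 + (K1 * Real.exp (-(r * z.re))) ^ 2 := by gcongr
      _ = K2 * K0 * Real.exp (-(r * z.re)) +
          K1 ^ 2 * Real.exp (-(r * z.re)) * Real.exp (-(r * z.re)) := by ring
      _ ≤ K2 * K0 * Real.exp (-(r * z.re)) + K1 ^ 2 * Real.exp (-(r * z.re)) * 1 := by gcongr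
      _ = _ := by ring
  gcongr

/-- Reversing the coefficients turns behaviour far to the left into behaviour far to the right, with
`C` now the dominant constant term. -/
theorem expPoly_eq_dual (A B C r q : ℝ) (z : ℂ) :
    expPoly A B C r q z = Complex.exp (-(q * z)) * expPoly C B A (q - r) q (-z) := by
  simp only [expPoly, mul_add, mul_left_comm (Complex.exp _), ← Complex.exp_add]
  push_cast
  ring_nf
  simp

/-- The exponential factor adds the constant `-q` to the logarithmic derivative, which
differentiation kills; the two signs from `z ↦ -z` cancel. -/
theorem deriv_logDeriv_expPoly_dual {z : ℂ} (hz : expPoly C B A (q - r) q (-z) ≠ 0) :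
    deriv (logDeriv (expPoly A B C r q)) z =
      deriv (logDeriv (expPoly C B A (q - r) q)) (-z) := by
  set g := expPoly C B A (q - r) q with hg
  have hgd : Differentiable ℂ g := differentiable_expPoly
  have hc : ContinuousAt (fun u : ℂ => g (-u)) z :=
    (hgd.continuous.comp continuous_neg).continuousAt
  have key : logDeriv (expPoly A B C r q) =ᶠ[𝓝 z] fun u => -q - logDeriv g (-u) := by
    filter_upwards [hc.eventually_ne hz] with u hu
    have e : expPoly A B C r q = fun z => Complex.exp (-(q * z)) * g (-z) :=
      funext (expPoly_eq_dual A B C r q)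
    have hgu : DifferentiableAt ℂ (fun z => g (-z)) u := (hgd (-u)).comp u (by fun_prop)
    rw [e, logDeriv_mul (f := fun z => Complex.exp (-(q * z))) u (Complex.exp_ne_zero _) hu (by fun_prop) hgu]
    have d1 : HasDerivAt (fun z : ℂ => Complex.exp (-(q * z)))
        (Complex.exp (-(q * u)) * -(q * 1)) u := ((hasDerivAt_id u).const_mul (q : ℂ)).neg.cexp
    have d2 : HasDerivAt (fun z => g (-z)) (-deriv g (-u)) u := by
      simpa [Function.comp_def] using (hgd (-u)).hasDerivAt.scomp u (hasDerivAt_neg u)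
    rw [logDeriv_apply, logDeriv_apply, logDeriv_apply, d1.deriv, d2.deriv,
      mul_div_cancel_left₀ _ (Complex.exp_ne_zero _)]
    ring
  rw [key.deriv_eq]
  have h1 : DifferentiableAt ℂ (logDeriv g) (-z) := (hgd.deriv (-z)).div (hgd (-z)) hz
  have h2 : HasDerivAt (fun u => logDeriv g (-u)) (-deriv (logDeriv g) (-z)) z := by
    simpa [Function.comp_def] using h1.hasDerivAt.scomp z (hasDerivAt_neg z)
  simpa using (h2.const_sub (-q : ℂ)).deriv

/-- The zeros of an exponential polynomial lie in a vertical strip, with boundedly many in each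
window, and the partial fraction expansion of its second logarithmic derivative. -/
theorem exists_expPoly_partialFractions (hA : A ≠ 0) (hC : C ≠ 0) (hr : 0 < r) (hrq : r < q)
    (hs : ∀ ρ, expPoly A B C r q ρ = 0 → deriv (expPoly A B C r q) ρ ≠ 0) :
    ∃ (σ : ℝ) (N : ℕ), (∀ ρ, expPoly A B C r q ρ = 0 → |ρ.re| ≤ σ) ∧
      WindowBound {z | expPoly A B C r q z = 0} N ∧
      ∀ z, expPoly A B C r q z ≠ 0 → HasSum
        (fun ρ : {z | expPoly A B C r q z = 0} => 1 / (z - ρ) ^ 2)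
        (-deriv (logDeriv (expPoly A B C r q)) z) := by
  obtain ⟨σ₁, K₁, hσ₁, hK₁, h1⟩ := exists_expPoly_right_bounds (B := B) (C := C) hA hr hrq.le
  obtain ⟨σ₂, K₂, hσ₂, hK₂, h2⟩ := exists_expPoly_right_bounds (A := C) (B := B) (C := A) (q := q)
    hC (sub_pos.mpr hrq) (sub_le_self q hr.le)
  set f := expPoly A B C r q with hf
  set σ := max σ₁ σ₂ with hσ
  have hA' : 0 < |A| / 2 := half_pos (abs_pos.mpr hA)
  have hC' : 0 < |C| / 2 := half_pos (abs_pos.mpr hC)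
  have hdual : ∀ z : ℂ, z.re ≤ -σ → expPoly C B A (q - r) q (-z) ≠ 0 := fun z hz =>
    norm_pos_iff.mp (hC'.trans_le (h2 (-z) (by
      rw [Complex.neg_re]; linarith [le_max_right σ₁ σ₂])).1)
  have hright : ∀ z : ℂ, σ ≤ z.re → f z ≠ 0 := fun z hz =>
    norm_pos_iff.mp (hA'.trans_le (h1 z ((le_max_left _ _).trans hz)).1)
  have hleft : ∀ z : ℂ, z.re ≤ -σ → f z ≠ 0 := fun z hz => by
    rw [hf, expPoly_eq_dual]
    exact mul_ne_zero (Complex.exp_ne_zero _) (hdual z hz)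
  have hstrip : ∀ ρ, f ρ = 0 → |ρ.re| ≤ σ := fun ρ hρ => by
    by_contra! h
    rcases lt_abs.mp h with h | h
    · exact hright ρ h.le hρ
    · exact hleft ρ (by linarith) hρ
  have hσ0 : 0 ≤ σ := hσ₁.trans (le_max_left _ _)
  set R := 24 * σ + 48 with hR
  have hM : ∀ y : ℝ, ∀ z ∈ Metric.sphere (⟨σ, y⟩ : ℂ) R,
      ‖f z‖ ≤ |A| + |B| * Real.exp (r * R) + |C| * Real.exp (q * R) := fun y z hz => by
    refine (norm_expPoly_le A B C r q z).trans ?_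
    rw [mem_sphere_iff_norm] at hz
    have := (abs_le.mp ((Complex.abs_re_le_norm _).trans hz.le)).1
    rw [Complex.sub_re] at this
    simp only at this
    have hz' : -z.re ≤ R := by linarith
    have e1 : -(r * z.re) ≤ r * R := by nlinarith
    have e2 : -(q * z.re) ≤ q * R := by nlinarith
    gcongr
  have hexp1 : ∀ t x : ℝ, 0 < t → 0 ≤ x → Real.exp (-(t * x)) ≤ 1 := fun t x ht hx =>
    Real.exp_le_one_iff.mpr (by nlinarith)
  have hout : ∀ z : ℂ, σ + 2 ≤ |z.re| → ‖deriv (logDeriv f) z‖ ≤ max K₁ K₂ := fun z hz => by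
    rcases le_abs.mp hz with h | h
    · refine ((h1 z (by linarith [le_max_left σ₁ σ₂])).2.trans ?_).trans (le_max_left _ _)
      exact mul_le_of_le_one_right hK₁ (hexp1 _ _ hr (by linarith))
    · rw [hf, deriv_logDeriv_expPoly_dual (hdual z (by linarith))]
      refine ((h2 (-z) (by rw [Complex.neg_re]; linarith [le_max_right σ₁ σ₂])).2.trans ?_).trans
        (le_max_right _ _)
      exact mul_le_of_le_one_right hK₂ (hexp1 _ _ (sub_pos.mpr hrq)
        (by rw [Complex.neg_re]; linarith))
  have hlim : Tendsto (fun x : ℝ => deriv (logDeriv f) x) atTop (𝓝 0) := by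
    refine squeeze_zero_norm' (a := fun x : ℝ => K₁ * Real.exp (-(r * x))) ?_ ?_
    · filter_upwards [eventually_ge_atTop σ] with x hx
      exact (h1 x ((le_max_left _ _).trans hx)).2
    · simpa using (tendsto_exp_neg_mul_atTop hr).const_mul K₁
  have h₀ : ∀ y : ℝ, |A| / 2 ≤ ‖f ⟨σ, y⟩‖ := fun y => (h1 _ (le_max_left _ _)).1
  exact ⟨σ, _, hstrip, windowBound_zeros differentiable_expPoly hstrip hσ0 le_rfl hA' hM h₀,
    fun z hz => hasSum_one_div_sq differentiable_expPoly hs hstrip hσ0 le_rfl hA' hM h₀ hout hlim hz⟩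

end ExpPoly


/-! ## The Mellin transform of `x ↦ 1 / (x + μ) ^ 2` -/

theorem norm_ofReal_cpow {x : ℝ} (hx : 0 < x) (s : ℂ) : ‖(x : ℂ) ^ s‖ = x ^ s.re :=
  Complex.norm_cpow_eq_rpow_re_of_pos hx s

/-- The point `μ₀` has positive distance from the negative reals. Uniformity in `μ` near `μ₀` is
what differentiation under the integral needs. -/
theorem one_add_le_mul_norm_add {μ₀ : ℂ} (hμ₀ : μ₀ ∈ Complex.slitPlane) :
    ∃ δ c : ℝ, 0 < δ ∧ 0 < c ∧ ∀ μ ∈ Metric.ball μ₀ δ, ∀ x : ℝ, 0 ≤ x → c * (1 + x) ≤ ‖x + μ‖ := by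
  obtain ⟨δ, hδ, hb⟩ := Metric.isOpen_iff.mp Complex.isOpen_slitPlane μ₀ hμ₀
  refine ⟨δ / 2, (2 * ((1 + ‖μ₀‖) / δ + 1))⁻¹, by positivity, by positivity, fun μ hμ x hx => ?_⟩
  have h1 : δ ≤ ‖x + μ₀‖ := by
    by_contra! h
    have : (-x : ℂ) ∈ Complex.slitPlane := hb (by
      rwa [mem_ball_iff_norm, ← norm_neg, neg_sub, sub_neg_eq_add, add_comm])
    rw [← Complex.ofReal_neg, Complex.ofReal_mem_slitPlane] at this
    linarith
  have h2 : x ≤ ‖(x : ℂ) + μ₀‖ + ‖μ₀‖ := by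
    have := norm_sub_le ((x : ℂ) + μ₀) μ₀
    rwa [add_sub_cancel_right, Complex.norm_real, Real.norm_of_nonneg hx] at this
  have h3 : ‖(x : ℂ) + μ₀‖ ≤ 2 * ‖x + μ‖ := by
    rw [mem_ball_iff_norm] at hμ
    have := norm_sub_le ((x : ℂ) + μ) (μ - μ₀)
    rw [show (x : ℂ) + μ - (μ - μ₀) = x + μ₀ by ring] at this
    linarith
  have h4 : 1 + x ≤ ((1 + ‖μ₀‖) / δ + 1) * ‖(x : ℂ) + μ₀‖ := by
    have : (1 + ‖μ₀‖) ≤ (1 + ‖μ₀‖) / δ * ‖(x : ℂ) + μ₀‖ := by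
      rw [div_mul_eq_mul_div, le_div_iff₀ hδ]
      gcongr
    linarith
  rw [inv_mul_le_iff₀ (by positivity)]
  calc 1 + x ≤ ((1 + ‖μ₀‖) / δ + 1) * ‖(x : ℂ) + μ₀‖ := h4
    _ ≤ ((1 + ‖μ₀‖) / δ + 1) * (2 * ‖x + μ‖) := by gcongr
    _ = _ := by ring

/-- Near `0` the exponent `1 - σ` exceeds `-1`; at infinity the integrand is at most `x ^ (-1 - σ)`.
-/
theorem integrableOn_rpow_div_one_add_sq {σ : ℝ} (h0 : 0 < σ) (h2 : σ < 2) :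
    IntegrableOn (fun x : ℝ => x ^ (1 - σ) / (1 + x) ^ 2) (Ioi 0) := by
  rw [← Ioc_union_Ioi_eq_Ioi zero_le_one]
  refine IntegrableOn.union ?_ ?_
  · have h := (intervalIntegral.intervalIntegrable_rpow' (a := 0) (b := 1) (r := 1 - σ) (by linarith))
    rw [intervalIntegrable_iff_integrableOn_Ioc_of_le zero_le_one] at h
    refine h.mono' ?_ ?_
    · exact (by fun_prop : Measurable fun x : ℝ => x ^ (1 - σ) / (1 + x) ^ 2).aestronglyMeasurable
    · filter_upwards [ae_restrict_mem measurableSet_Ioc] with x hx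
      have hx0 : 0 < x := hx.1
      rw [Real.norm_of_nonneg (by positivity)]
      exact div_le_self (by positivity) (by nlinarith)
  · have h := integrableOn_Ioi_rpow_of_lt (a := -1 - σ) (c := 1) (by linarith) one_pos
    refine h.mono' ?_ ?_
    · exact (by fun_prop : Measurable fun x : ℝ => x ^ (1 - σ) / (1 + x) ^ 2).aestronglyMeasurable
    · filter_upwards [ae_restrict_mem measurableSet_Ioi] with x hx
      have hx0 : (0 : ℝ) < x := one_pos.trans hx
      rw [Real.norm_of_nonneg (by positivity), div_le_iff₀ (by positivity),
        show (1 - σ) = (-1 - σ) + 2 by ring, Real.rpow_add hx0, Real.rpow_two]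
      gcongr
      linarith

variable {s : ℂ}

theorem measurable_cpow_div_add_sq (s μ : ℂ) (n : ℕ) :
    Measurable fun x : ℝ => (x : ℂ) ^ (1 - s) / (x + μ) ^ n := by fun_prop

theorem norm_cpow_div_add_pow_le {μ : ℂ} {c : ℝ} (hc : 0 < c) {n : ℕ} (hn : 2 ≤ n) {x : ℝ} (hx : 0 < x)
    (h : c * (1 + x) ≤ ‖x + μ‖) :
    ‖(x : ℂ) ^ (1 - s) / (x + μ) ^ n‖ ≤ (c ^ n)⁻¹ * (x ^ (1 - s.re) / (1 + x) ^ 2) := by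
  rw [norm_div, norm_pow, norm_ofReal_cpow hx, Complex.sub_re, Complex.one_re,
    inv_mul_eq_div, div_div]
  gcongr
  calc (1 + x) ^ 2 * c ^ n ≤ (1 + x) ^ n * c ^ n := by
        gcongr
        linarith
    _ = (c * (1 + x)) ^ n := by rw [mul_pow, mul_comm]
    _ ≤ ‖x + μ‖ ^ n := by gcongr

theorem integrableOn_cpow_div_add_sq (h0 : 0 < s.re) (h2 : s.re < 2) {μ : ℂ}
    (hμ : μ ∈ Complex.slitPlane) :
    IntegrableOn (fun x : ℝ => (x : ℂ) ^ (1 - s) / (x + μ) ^ 2) (Ioi 0) := by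
  obtain ⟨δ, c, hδ, hc, h⟩ := one_add_le_mul_norm_add hμ
  refine ((integrableOn_rpow_div_one_add_sq h0 h2).const_mul (c ^ 2)⁻¹).mono'
    (measurable_cpow_div_add_sq s μ 2).aestronglyMeasurable ?_
  filter_upwards [ae_restrict_mem measurableSet_Ioi] with x hx
  exact norm_cpow_div_add_pow_le hc le_rfl hx (h μ (Metric.mem_ball_self hδ) x (le_of_lt hx))

theorem differentiableOn_integral_cpow_div_add_sq (h0 : 0 < s.re) (h2 : s.re < 2) :
    DifferentiableOn ℂ (fun μ : ℂ => ∫ x in Ioi (0 : ℝ), (x : ℂ) ^ (1 - s) / (x + μ) ^ 2)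
      Complex.slitPlane := by
  intro μ₀ hμ₀
  obtain ⟨δ, c, hδ, hc, h⟩ := one_add_le_mul_norm_add hμ₀
  refine DifferentiableAt.differentiableWithinAt ?_
  have := hasDerivAt_integral_of_dominated_loc_of_deriv_le (μ := volume.restrict (Ioi (0 : ℝ)))
    (F := fun (μ : ℂ) (x : ℝ) => (x : ℂ) ^ (1 - s) / (x + μ) ^ 2)
    (F' := fun (μ : ℂ) (x : ℝ) => -2 * ((x : ℂ) ^ (1 - s) / (x + μ) ^ 3))
    (bound := fun x => 2 * ((c ^ 3)⁻¹ * (x ^ (1 - s.re) / (1 + x) ^ 2)))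
    (x₀ := μ₀) (Metric.ball_mem_nhds μ₀ hδ)
    (Eventually.of_forall fun μ => (measurable_cpow_div_add_sq s μ 2).aestronglyMeasurable)
    (integrableOn_cpow_div_add_sq h0 h2 hμ₀)
    ((measurable_cpow_div_add_sq s μ₀ 3).const_mul (-2)).aestronglyMeasurable ?_ ?_ ?_
  · exact this.2.differentiableAt
  · filter_upwards [ae_restrict_mem measurableSet_Ioi] with x hx μ hμ
    rw [norm_mul, norm_neg, Complex.norm_ofNat]
    gcongr
    exact norm_cpow_div_add_pow_le hc (by norm_num) hx (h μ hμ x (le_of_lt hx))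
  · exact (((integrableOn_rpow_div_one_add_sq h0 h2).const_mul _).const_mul _)
  · filter_upwards [ae_restrict_mem measurableSet_Ioi] with x hx μ hμ
    have hx0 : (0 : ℝ) < x := hx
    have hne : (x : ℂ) + μ ≠ 0 := norm_pos_iff.mp
      (lt_of_lt_of_le (by positivity) (h μ hμ x hx0.le))
    have h1 := (((hasDerivAt_id μ).const_add (x : ℂ)).fun_pow 2).fun_inv (pow_ne_zero 2 hne)
    have h2 := h1.const_mul ((x : ℂ) ^ (1 - s))
    simp only [div_eq_mul_inv]
    refine h2.congr_deriv ?_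
    simp only [id]
    push_cast
    field_simp

theorem integral_mul_exp_neg_mul {w : ℝ} (hw : 0 < w) :
    ∫ t in Ioi (0 : ℝ), (t : ℂ) * Complex.exp (-(w * t)) = 1 / w ^ 2 := by
  have h := Complex.integral_cpow_mul_exp_neg_mul_Ioi (a := 2) (by simp) hw
  rw [show (2 : ℂ) - 1 = 1 by norm_num] at h
  simp only [Complex.cpow_one] at h
  rw [h, Complex.Gamma_ofNat_eq_factorial]
  simp

/-- The integrand of the double integral for `Γ(s) Γ(2 - s) μ ^ (-s)`. -/
theorem integrable_gamma_gamma {μ : ℝ} (hμ : 0 < μ) (h0 : 0 < s.re) (h2 : s.re < 2) :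
    Integrable (Function.uncurry fun (t x : ℝ) =>
      (x : ℂ) ^ (1 - s) * (t * Complex.exp (-((x + μ) * t))))
      ((volume.restrict (Ioi (0 : ℝ))).prod (volume.restrict (Ioi (0 : ℝ)))) := by
  have hmeas : Measurable (Function.uncurry fun (t x : ℝ) =>
      (x : ℂ) ^ (1 - s) * (t * Complex.exp (-((x + μ) * t)))) := by
    unfold Function.uncurry
    fun_prop
  have hnorm : ∀ t x : ℝ, 0 < t → 0 < x → ‖(x : ℂ) ^ (1 - s) * (t * Complex.exp (-((x + μ) * t)))‖ =
      t * Real.exp (-(μ * t)) * (x ^ (2 - s.re - 1) * Real.exp (-(t * x))) := fun t x ht hx => by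
    rw [norm_mul, norm_mul, norm_ofReal_cpow hx, Complex.norm_real, Real.norm_of_nonneg ht.le,
      Complex.norm_exp]
    have : (-((x + μ) * t) : ℂ).re = -(μ * t) + -(t * x) := by simp; ring
    rw [this, Real.exp_add, Complex.sub_re, Complex.one_re]
    ring_nf
  rw [integrable_prod_iff hmeas.aestronglyMeasurable]
  constructor
  · filter_upwards [ae_restrict_mem measurableSet_Ioi] with t ht
    have ht : 0 < t := ht
    have h := integrableOn_rpow_mul_exp_neg_mul_rpow (s := 2 - s.re - 1) (p := 1) (b := t)
      (by linarith) one_pos ht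
    refine (h.const_mul (t * Real.exp (-(μ * t)))).mono'
      (hmeas.comp (measurable_const.prodMk measurable_id)).aestronglyMeasurable ?_
    filter_upwards [ae_restrict_mem measurableSet_Ioi] with x hx
    simp only [Function.uncurry, hnorm t x ht hx, Real.rpow_one, neg_mul, le_refl]
  · have h := integrableOn_rpow_mul_exp_neg_mul_rpow (s := s.re - 1) (p := 1) (b := μ)
      (by linarith) one_pos hμ
    refine (h.mul_const (Real.Gamma (2 - s.re))).congr ?_
    filter_upwards [ae_restrict_mem measurableSet_Ioi] with t ht
    have ht : 0 < t := ht
    have e : ∫ x in Ioi (0 : ℝ), ‖Function.uncurry (fun (t x : ℝ) =>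
        (x : ℂ) ^ (1 - s) * (t * Complex.exp (-((x + μ) * t)))) (t, x)‖ =
        ∫ x in Ioi (0 : ℝ), t * Real.exp (-(μ * t)) * (x ^ (2 - s.re - 1) * Real.exp (-(t * x))) :=
      setIntegral_congr_fun measurableSet_Ioi fun x hx => hnorm t x ht hx
    rw [e, integral_const_mul, Real.integral_rpow_mul_exp_neg_mul_Ioi (by linarith) ht]
    simp only [Real.rpow_one, one_div, neg_mul]
    rw [Real.inv_rpow ht.le, ← Real.rpow_neg ht.le,
      show s.re - 1 = 1 + -(2 - s.re) by ring, Real.rpow_add ht, Real.rpow_one]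
    ring

/-- Write `1/(x + μ)²` as `∫ t e^{-(x+μ)t} dt` and exchange: the `x`-integral gives `Γ(2-s) t^{s-2}`
and the `t`-integral then gives `Γ(s) μ^{-s}`. -/
theorem integral_cpow_div_add_sq_of_pos {μ : ℝ} (hμ : 0 < μ) (h0 : 0 < s.re) (h2 : s.re < 2) :
    ∫ x in Ioi (0 : ℝ), (x : ℂ) ^ (1 - s) / (x + μ) ^ 2 =
      Complex.Gamma s * Complex.Gamma (2 - s) * μ ^ (-s) := by
  have hswap := integral_integral_swap (integrable_gamma_gamma hμ h0 h2)
  have e1 : ∫ x in Ioi (0 : ℝ), (x : ℂ) ^ (1 - s) / (x + μ) ^ 2 =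
      ∫ x in Ioi (0 : ℝ), ∫ t in Ioi (0 : ℝ), (x : ℂ) ^ (1 - s) * (t * Complex.exp (-((x + μ) * t))) := by
    refine setIntegral_congr_fun measurableSet_Ioi fun x hx => ?_
    have hx : 0 < x := hx
    have h := integral_mul_exp_neg_mul (add_pos hx hμ)
    push_cast at h
    rw [integral_const_mul, h, mul_one_div]
  have e2 : ∫ t in Ioi (0 : ℝ), ∫ x in Ioi (0 : ℝ),
      (x : ℂ) ^ (1 - s) * (t * Complex.exp (-((x + μ) * t))) =
      ∫ t in Ioi (0 : ℝ), Complex.Gamma (2 - s) * ((t : ℂ) ^ (s - 1) * Complex.exp (-(μ * t))) := by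
    refine setIntegral_congr_fun measurableSet_Ioi fun t ht => ?_
    have ht : 0 < t := ht
    have ht' : (t : ℂ) ≠ 0 := Complex.ofReal_ne_zero.mpr ht.ne'
    have e3 : ∀ x : ℝ, (x : ℂ) ^ (1 - s) * (t * Complex.exp (-((x + μ) * t))) =
        t * Complex.exp (-(μ * t)) * ((x : ℂ) ^ (2 - s - 1) * Complex.exp (-(t * x))) := fun x => by
      rw [show -(((x : ℂ) + μ) * t) = -(μ * t) + -(t * x) by ring, Complex.exp_add]
      ring_nf
    simp only [e3]
    rw [integral_const_mul, Complex.integral_cpow_mul_exp_neg_mul_Ioi (by simpa using h2) (by simpa)]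
    have harg : (t : ℂ).arg ≠ Real.pi := by
      rw [Complex.arg_ofReal_of_nonneg ht.le]; exact Real.pi_pos.ne
    rw [one_div, Complex.inv_cpow _ _ harg, ← Complex.cpow_neg,
      show s - 1 = 1 + -(2 - s) by ring, Complex.cpow_add _ _ ht', Complex.cpow_one]
    ring
  rw [e1, ← hswap, e2, integral_const_mul, Complex.integral_cpow_mul_exp_neg_mul_Ioi h0 hμ]
  have harg : (μ : ℂ).arg ≠ Real.pi := by
    rw [Complex.arg_ofReal_of_nonneg hμ.le]; exact Real.pi_pos.ne
  rw [one_div, Complex.inv_cpow _ _ harg, ← Complex.cpow_neg]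
  ring

/-- Both sides are analytic in `μ` on the connected slit plane and agree on the positive reals,
which accumulate at `1`. -/
theorem integral_cpow_div_add_sq {μ : ℂ} (hμ : μ ∈ Complex.slitPlane) (h0 : 0 < s.re)
    (h2 : s.re < 2) : ∫ x in Ioi (0 : ℝ), (x : ℂ) ^ (1 - s) / (x + μ) ^ 2 =
      Complex.Gamma s * Complex.Gamma (2 - s) * μ ^ (-s) := by
  have h1 : AnalyticOnNhd ℂ (fun μ : ℂ => ∫ x in Ioi (0 : ℝ), (x : ℂ) ^ (1 - s) / (x + μ) ^ 2)
      Complex.slitPlane :=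
    (differentiableOn_integral_cpow_div_add_sq h0 h2).analyticOnNhd Complex.isOpen_slitPlane
  have h3 : AnalyticOnNhd ℂ (fun μ : ℂ => Complex.Gamma s * Complex.Gamma (2 - s) * μ ^ (-s))
      Complex.slitPlane := by
    refine DifferentiableOn.analyticOnNhd (fun μ hμ => ?_) Complex.isOpen_slitPlane
    exact ((differentiableAt_id.cpow_const hμ).const_mul _).differentiableWithinAt
  refine h1.eqOn_of_preconnected_of_frequently_eq h3
    (Complex.starConvex_one_slitPlane.isPathConnected
      Complex.one_mem_slitPlane).isConnected.isPreconnected (z₀ := 1) Complex.one_mem_slitPlane ?_ hμ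
  have ht : Tendsto (fun x : ℝ => (x : ℂ)) (𝓝[≠] 1) (𝓝[≠] 1) := by
    refine tendsto_nhdsWithin_of_tendsto_nhds_of_eventually_within _ ?_ ?_
    · exact (Complex.continuous_ofReal.tendsto' 1 1 Complex.ofReal_one).mono_left nhdsWithin_le_nhds
    · filter_upwards [self_mem_nhdsWithin] with x hx
      exact fun h => hx (Complex.ofReal_eq_one.mp h)
  refine ht.frequently (Eventually.frequently ?_)
  filter_upwards [mem_nhdsWithin_of_mem_nhds (lt_mem_nhds one_pos)] with x hx
  exact integral_cpow_div_add_sq_of_pos hx h0 h2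

theorem integral_rpow_div_add_sq {σ m : ℝ} (hm : 0 < m) (h0 : 0 < σ) (h2 : σ < 2) :
    ∫ x in Ioi (0 : ℝ), x ^ (1 - σ) / (x + m) ^ 2 = Real.Gamma σ * Real.Gamma (2 - σ) * m ^ (-σ) := by
  have h := integral_cpow_div_add_sq (s := σ) (μ := m) (Complex.ofReal_mem_slitPlane.mpr hm)
    (by simpa) (by simpa)
  have e : ∫ x in Ioi (0 : ℝ), (x : ℂ) ^ (1 - (σ : ℂ)) / (x + m) ^ 2 =
      ∫ x in Ioi (0 : ℝ), ((x ^ (1 - σ) / (x + m) ^ 2 : ℝ) : ℂ) :=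
    setIntegral_congr_fun measurableSet_Ioi fun x hx => by
      have hx : 0 < x := hx
      push_cast [Complex.ofReal_cpow hx.le]
      rfl
  rw [e, integral_complex_ofReal] at h
  have e2 : Complex.Gamma σ * Complex.Gamma (2 - σ) * (m : ℂ) ^ (-(σ : ℂ)) =
      ((Real.Gamma σ * Real.Gamma (2 - σ) * m ^ (-σ) : ℝ) : ℂ) := by
    push_cast [Complex.ofReal_cpow hm.le, ← Complex.Gamma_ofReal]
    rfl
  rw [e2] at h
  exact_mod_cast h


/-! ## Zeta sums over sets in a sector -/

/-- The points of `M` lie in a double sector around the imaginary axis, away from the real axis,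
with boundedly many points in each horizontal window. -/
structure SectorSet (M : Set ℂ) (κ δ : ℝ) (N : ℕ) : Prop where
  window : WindowBound M N
  delta_pos : 0 < δ
  gap : ∀ μ ∈ M, δ ≤ |μ.im|
  sector : ∀ μ ∈ M, |μ.re| ≤ κ * |μ.im|
  kappa_nonneg : 0 ≤ κ

namespace SectorSet

variable {M : Set ℂ} {κ δ : ℝ} {N : ℕ} {s : ℂ}

theorem norm_pos (h : SectorSet M κ δ N) {μ : ℂ} (hμ : μ ∈ M) : 0 < ‖μ‖ :=
  h.delta_pos.trans_le ((h.gap μ hμ).trans (Complex.abs_im_le_norm μ))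

theorem mem_slitPlane (h : SectorSet M κ δ N) {μ : ℂ} (hμ : μ ∈ M) : μ ∈ Complex.slitPlane :=
  Or.inr (abs_pos.mp (h.delta_pos.trans_le (h.gap μ hμ)))

/-- In the sector `‖μ‖ ≤ (κ + 1)|Im μ| ≤ (κ + 1)‖x + μ‖`, and `x ≤ ‖x + μ‖ + ‖μ‖`. This lets `‖μ‖`
replace `μ` in majorants, uniformly in `x ≥ 0`. -/
theorem add_norm_le (h : SectorSet M κ δ N) {μ : ℂ} (hμ : μ ∈ M) {x : ℝ} (hx : 0 ≤ x) :
    x + ‖μ‖ ≤ (2 * κ + 3) * ‖x + μ‖ := by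
  have h1 : |μ.im| ≤ ‖(x : ℂ) + μ‖ := by simpa using Complex.abs_im_le_norm ((x : ℂ) + μ)
  have h2 : ‖μ‖ ≤ (κ + 1) * ‖(x : ℂ) + μ‖ := by
    refine (Complex.norm_le_abs_re_add_abs_im μ).trans ?_
    have := mul_le_mul_of_nonneg_left h1 h.kappa_nonneg
    linarith [h.sector μ hμ]
  have h3 : x ≤ ‖(x : ℂ) + μ‖ + ‖μ‖ := by
    have := norm_sub_le ((x : ℂ) + μ) μ
    rwa [add_sub_cancel_right, Complex.norm_real, Real.norm_of_nonneg hx] at this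
  linarith

/-- The norm controls the window index: the rounding error, at most `1`, is bounded by `‖μ‖ / δ`
because of the gap. -/
theorem summable_rpow (h : SectorSet M κ δ N) {σ : ℝ} (hσ : 1 < σ) :
    Summable fun μ : M => ‖(μ : ℂ)‖ ^ (-σ) := by
  obtain ⟨hs, -⟩ := summable_int_shift hσ ((1 + 1 / δ) ^ σ) 0
  have hδ := h.delta_pos
  refine (h.window.summable (φ := fun k => (1 + 1 / δ) ^ σ * (1 / |((k - 0 : ℤ) : ℝ) + 1 / 2| ^ σ))
    (fun k => by positivity) hs (fun μ => by positivity) fun μ => ?_).1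
  have hμ := h.norm_pos μ.2
  have him := Complex.abs_im_le_norm (μ : ℂ)
  have hgap := h.gap μ μ.2
  have hpos : (0 : ℝ) < |((⌊(μ : ℂ).im⌋ - 0 : ℤ) : ℝ) + 1 / 2| := by
    rw [abs_pos]
    intro h0
    have : ((2 * (⌊(μ : ℂ).im⌋) + 1 : ℤ) : ℝ) = 0 := by push_cast at h0 ⊢; linarith
    have : (2 * (⌊(μ : ℂ).im⌋) + 1 : ℤ) = 0 := by exact_mod_cast this
    omega
  have hle : |((⌊(μ : ℂ).im⌋ - 0 : ℤ) : ℝ) + 1 / 2| ≤ (1 + 1 / δ) * ‖(μ : ℂ)‖ := by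
    have a1 := Int.floor_le (μ : ℂ).im
    have a2 := Int.lt_floor_add_one (μ : ℂ).im
    have a3 : |((⌊(μ : ℂ).im⌋ - 0 : ℤ) : ℝ) + 1 / 2| ≤ |(μ : ℂ).im| + 1 := by
      rw [sub_zero]
      have := abs_sub_abs_le_abs_sub ((⌊(μ : ℂ).im⌋ : ℝ) + 1 / 2) (μ : ℂ).im
      have h2 : |((⌊(μ : ℂ).im⌋ : ℝ) + 1 / 2) - (μ : ℂ).im| ≤ 1 := by
        rw [abs_le]; constructor <;> linarith
      linarith
    have a4 : 1 ≤ 1 / δ * ‖(μ : ℂ)‖ := by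
      rw [one_div_mul_eq_div, one_le_div hδ]
      linarith
    linarith
  rw [Real.rpow_neg hμ.le, mul_one_div, ← one_div, div_le_div_iff₀ (by positivity) (by positivity),
    one_mul, ← Real.mul_rpow (by positivity) hμ.le]
  exact Real.rpow_le_rpow hpos.le hle (by linarith)

theorem countable (h : SectorSet M κ δ N) : Countable M := by
  have := (h.summable_rpow one_lt_two).countable_support
  have e : Function.support (fun μ : M => ‖(μ : ℂ)‖ ^ (-2 : ℝ)) = univ :=
    eq_univ_of_forall fun μ => (Real.rpow_pos_of_pos (h.norm_pos μ.2) _).ne'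
  rw [e] at this
  exact countable_univ_iff.mp this

/-- The Mellin transform of a sum `∑ 1 / (x + μ) ^ 2`. -/
theorem hasSum_mellin (h : SectorSet M κ δ N) {K : ℝ → ℂ}
    (hK : ∀ x : ℝ, 0 < x → HasSum (fun μ : M => 1 / ((x : ℂ) + μ) ^ 2) (K x))
    (h1 : 1 < s.re) (h2 : s.re < 2) :
    HasSum (fun μ : M => Complex.Gamma s * Complex.Gamma (2 - s) * (μ : ℂ) ^ (-s))
      (mellin K (2 - s)) := by
  have := h.countable
  have h0 : 0 < s.re := one_pos.trans h1
  have hκ := h.kappa_nonneg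
  have hint : ∀ μ : M, IntegrableOn (fun x : ℝ => (x : ℂ) ^ (1 - s) / (x + μ) ^ 2) (Ioi 0) :=
    fun μ => integrableOn_cpow_div_add_sq h0 h2 (h.mem_slitPlane μ.2)
  -- Up to the sector constant, the integral of the norm is the explicit Mellin integral with `‖μ‖`
  -- in place of `μ`; these are summable because `Re s > 1`, which justifies exchanging sum and
  -- integral.
  have hbound : ∀ μ : M, ∫ x in Ioi (0 : ℝ), ‖(x : ℂ) ^ (1 - s) / (x + μ) ^ 2‖ ≤
      (2 * κ + 3) ^ 2 * (Real.Gamma s.re * Real.Gamma (2 - s.re)) * ‖(μ : ℂ)‖ ^ (-s.re) := fun μ => by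
    have hμ := h.norm_pos μ.2
    rw [mul_assoc, ← integral_rpow_div_add_sq hμ h0 h2, ← integral_const_mul]
    refine integral_mono_of_nonneg (Eventually.of_forall fun _ => norm_nonneg _) ?_ ?_
    · have := integrableOn_cpow_div_add_sq (s := s.re) (μ := (‖(μ : ℂ)‖ : ℝ)) (by simpa) (by simpa)
        (Complex.ofReal_mem_slitPlane.mpr hμ)
      refine (this.norm.congr ?_).const_mul _
      filter_upwards [ae_restrict_mem measurableSet_Ioi] with x hx
      have hx : 0 < x := hx
      rw [norm_div, norm_ofReal_cpow hx, norm_pow, ← Complex.ofReal_add, Complex.norm_real,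
        Real.norm_of_nonneg (by positivity)]
      simp
    · filter_upwards [ae_restrict_mem measurableSet_Ioi] with x hx
      have hx : 0 < x := hx
      rw [norm_div, norm_ofReal_cpow hx, norm_pow, Complex.sub_re, Complex.one_re, mul_div_assoc',
        div_le_div_iff₀ (pow_pos ?_ 2) (by positivity)]
      · have h3 := h.add_norm_le μ.2 hx.le
        calc x ^ (1 - s.re) * (x + ‖(μ : ℂ)‖) ^ 2
            ≤ x ^ (1 - s.re) * ((2 * κ + 3) * ‖(x : ℂ) + μ‖) ^ 2 := by gcongr
          _ = _ := by ring
      · have h3 := h.add_norm_le μ.2 hx.le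
        by_contra! h4
        nlinarith [norm_nonneg ((x : ℂ) + μ)]
  have key := hasSum_integral_of_summable_integral_norm hint
    (.of_nonneg_of_le (fun μ => integral_nonneg fun _ => norm_nonneg _) hbound
      ((h.summable_rpow h1).mul_left _))
  have e1 : ∫ x in Ioi (0 : ℝ), ∑' μ : M, (x : ℂ) ^ (1 - s) / (x + μ) ^ 2 = mellin K (2 - s) := by
    rw [mellin]
    refine setIntegral_congr_fun measurableSet_Ioi fun x hx => ?_
    rw [show 2 - s - 1 = 1 - s by ring, smul_eq_mul, ← (hK x hx).tsum_eq, ← tsum_mul_left]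
    simp only [mul_one_div]
  rw [e1] at key
  exact key.congr_fun fun μ => (integral_cpow_div_add_sq (h.mem_slitPlane μ.2) h0 h2).symm

/-- Two powers appear because `‖μ‖` may lie on either side of `1`; the exponential bounds the factor
coming from `arg μ`. The bound is uniform for `s` in a rectangle. -/
theorem norm_cpow_neg_le {μ : ℂ} (hμ : 0 < ‖μ‖) {σ₁ σ₂ b : ℝ} (h1 : σ₁ ≤ s.re) (h2 : s.re ≤ σ₂)
    (hb : |s.im| ≤ b) :
    ‖μ ^ (-s)‖ ≤ Real.exp (Real.pi * b) * (‖μ‖ ^ (-σ₁) + ‖μ‖ ^ (-σ₂)) := by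
  have harg : -(μ.arg * (-s).im) ≤ Real.pi * b := by
    rw [Complex.neg_im]
    calc -(μ.arg * -s.im) ≤ |μ.arg * s.im| := by rw [mul_neg, neg_neg]; exact le_abs_self _
      _ = |μ.arg| * |s.im| := abs_mul _ _
      _ ≤ Real.pi * b := by
        gcongr
        exact Complex.abs_arg_le_pi μ
  rw [Complex.norm_cpow_of_ne_zero (norm_pos_iff.mp hμ), div_eq_mul_inv, ← Real.exp_neg, mul_comm,
    Complex.neg_re]
  have hle : ‖μ‖ ^ (-s.re) ≤ ‖μ‖ ^ (-σ₁) + ‖μ‖ ^ (-σ₂) := by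
    have p1 := Real.rpow_nonneg hμ.le (-σ₁)
    have p2 := Real.rpow_nonneg hμ.le (-σ₂)
    rcases le_total 1 ‖μ‖ with h | h
    · have := Real.rpow_le_rpow_of_exponent_le h (neg_le_neg h1)
      linarith
    · have := Real.rpow_le_rpow_of_exponent_ge hμ h (neg_le_neg h2)
      linarith
  gcongr

/-- The zeta sum is analytic in the half-plane of absolute convergence. -/
theorem hasSum_cpow_and_differentiableAt (h : SectorSet M κ δ N) (hs : 1 < s.re) :
    Summable (fun μ : M => (μ : ℂ) ^ (-s)) ∧
      AnalyticAt ℂ (fun s => ∑' μ : M, (μ : ℂ) ^ (-s)) s := by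
  set η := (s.re - 1) / 2 with hη
  have hη0 : 0 < η := by rw [hη]; linarith
  have hsum : Summable fun μ : M => Real.exp (Real.pi * (|s.im| + η)) *
      (‖(μ : ℂ)‖ ^ (-(s.re - η)) + ‖(μ : ℂ)‖ ^ (-(s.re + η))) :=
    ((h.summable_rpow (by rw [hη]; linarith)).add (h.summable_rpow (by linarith))).mul_left _
  have hle : ∀ μ : M, ∀ w ∈ Metric.ball s η, ‖(μ : ℂ) ^ (-w)‖ ≤ Real.exp (Real.pi * (|s.im| + η)) *
      (‖(μ : ℂ)‖ ^ (-(s.re - η)) + ‖(μ : ℂ)‖ ^ (-(s.re + η))) := fun μ w hw => by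
    rw [mem_ball_iff_norm] at hw
    have a1 := abs_le.mp ((Complex.abs_re_le_norm (w - s)).trans hw.le)
    have a2 := (Complex.abs_im_le_norm (w - s)).trans hw.le
    rw [Complex.sub_re] at a1
    rw [Complex.sub_im] at a2
    have a3 := abs_sub_abs_le_abs_sub w.im s.im
    exact norm_cpow_neg_le (h.norm_pos μ.2) (by linarith) (by linarith) (by linarith)
  refine ⟨.of_norm_bounded hsum fun μ => hle μ s (Metric.mem_ball_self hη0), ?_⟩
  refine (Complex.differentiableOn_tsum_of_summable_norm hsum (fun μ => ?_) Metric.isOpen_ball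
    hle).analyticAt (Metric.isOpen_ball.mem_nhds (Metric.mem_ball_self hη0))
  intro w _
  exact (differentiableAt_id.neg.const_cpow
    (Or.inl (norm_pos_iff.mp (h.norm_pos μ.2)))).differentiableWithinAt

end SectorSet


/-! ## The zeta function of an exponential polynomial -/

/-- The exponential polynomial `A + B e^{-rx} + C e^{-qx}` on the real line. -/
def realExpPoly (A B C r q x : ℝ) : ℝ := A + B * Real.exp (-(r * x)) + C * Real.exp (-(q * x))

theorem expPoly_ofReal (A B C r q x : ℝ) :
    expPoly A B C r q x = (realExpPoly A B C r q x : ℝ) := by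
  simp only [expPoly, realExpPoly]
  push_cast
  ring

theorem hasDerivAt_realExpPoly (A B C r q x : ℝ) :
    HasDerivAt (realExpPoly A B C r q) (realExpPoly 0 (-(r * B)) (-(q * C)) r q x) x := by
  have h : ∀ t : ℝ, HasDerivAt (fun x : ℝ => Real.exp (-(t * x)))
      (Real.exp (-(t * x)) * -(t * 1)) x := fun t =>
    ((hasDerivAt_id x).const_mul t).neg.exp
  refine ((((h r).const_mul B).const_add A).add ((h q).const_mul C)).congr_deriv ?_
  simp only [realExpPoly]
  ring

theorem continuous_realExpPoly (A B C r q : ℝ) : Continuous (realExpPoly A B C r q) :=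
  continuous_iff_continuousAt.mpr fun x => (hasDerivAt_realExpPoly A B C r q x).continuousAt

theorem tendsto_realExpPoly_atTop {r q : ℝ} (A B C : ℝ) (hr : 0 < r) (hq : 0 < q) :
    Tendsto (realExpPoly A B C r q) atTop (𝓝 A) := by
  have h := (((tendsto_exp_neg_mul_atTop hr).const_mul B).const_add A).add
    ((tendsto_exp_neg_mul_atTop hq).const_mul C)
  simp only [mul_zero, add_zero] at h
  exact h

theorem tendsto_mul_realExpPoly_atTop {r q : ℝ} (B C : ℝ) (hr : 0 < r) (hq : 0 < q) :
    Tendsto (fun x => x * realExpPoly 0 B C r q x) atTop (𝓝 0) := by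
  have h : ∀ t : ℝ, 0 < t → Tendsto (fun x : ℝ => x * Real.exp (-(t * x))) atTop (𝓝 0) := by
    intro t ht
    have h1 := (Real.tendsto_pow_mul_exp_neg_atTop_nhds_zero 1).comp
      (tendsto_id.const_mul_atTop ht : Tendsto (fun x => t * id x) atTop atTop)
    have h2 := h1.const_mul t⁻¹
    rw [mul_zero] at h2
    refine h2.congr fun x => ?_
    simp only [Function.comp_apply, id, pow_one]
    field_simp
  have h3 := ((h r hr).const_mul B).add ((h q hq).const_mul C)
  simp only [mul_zero, add_zero] at h3
  refine h3.congr fun x => ?_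
  simp only [realExpPoly]
  ring

theorem star_expPoly (A B C r q : ℝ) (z : ℂ) :
    expPoly A B C r q ((starRingEnd ℂ) z) = (starRingEnd ℂ) (expPoly A B C r q z) := by
  simp [expPoly, ← Complex.exp_conj]

/-- The hypotheses on the exponential polynomial `A + B e^{-rz} + C e^{-qz}`: it is positive on the
positive half-axis, its zeros are simple, and its only real zero is `0`, with derivative `ℓ`. -/
structure WavePoly (A B C r q ℓ : ℝ) : Prop where
  A_pos : 0 < A
  C_ne : C ≠ 0
  r_pos : 0 < r
  r_lt : r < q
  sum_eq : A + B + C = 0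
  slope : -(r * B) + -(q * C) = ℓ
  slope_pos : 0 < ℓ
  pos : ∀ x : ℝ, 0 < x → 0 < realExpPoly A B C r q x
  simple : ∀ ρ, expPoly A B C r q ρ = 0 → deriv (expPoly A B C r q) ρ ≠ 0
  nonreal : ∀ ρ, expPoly A B C r q ρ = 0 → ρ ≠ 0 → ρ.im ≠ 0

/-- The negatives of the nonzero zeros of an exponential polynomial. -/
def negZeros (A B C r q : ℝ) : Set ℂ := {μ | expPoly A B C r q (-μ) = 0 ∧ μ ≠ 0}

namespace WavePoly

variable {A B C r q ℓ : ℝ}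

theorem q_pos (h : WavePoly A B C r q ℓ) : 0 < q := h.r_pos.trans h.r_lt

theorem realExpPoly_zero (h : WavePoly A B C r q ℓ) : realExpPoly A B C r q 0 = 0 := by
  simpa [realExpPoly] using h.sum_eq

/-- Only finitely many zeros of the strip `|Re| ≤ σ` come near the real axis, and the nonzero ones
are not real, so a gap `δ` exists; then `|Re μ| ≤ σ ≤ (σ/δ)|Im μ|`. -/
theorem exists_sectorSet (h : WavePoly A B C r q ℓ) :
    ∃ κ δ N, SectorSet (negZeros A B C r q) κ δ N := by
  obtain ⟨σ, N, hstrip, hwin, -⟩ :=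
    exists_expPoly_partialFractions h.A_pos.ne' h.C_ne h.r_pos h.r_lt h.simple
  have hstrip' : ∀ μ ∈ negZeros A B C r q, |μ.re| ≤ σ := fun μ hμ => by
    simpa using hstrip _ hμ.1
  have hσ : 0 ≤ σ := (abs_nonneg _).trans (hstrip 0 (by
    have := expPoly_ofReal A B C r q 0
    rwa [h.realExpPoly_zero, Complex.ofReal_zero] at this))
  have hfin : {μ | μ ∈ negZeros A B C r q ∧ |μ.im| < 1}.Finite := by
    have h1 := finite_zeros_of_simple differentiable_expPoly h.simple
      (isCompact_closedBall (0 : ℂ) (σ + 1))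
    refine (h1.image (fun z => -z)).subset fun μ hμ => ⟨-μ, ⟨?_, hμ.1.1⟩, neg_neg μ⟩
    rw [mem_closedBall_zero_iff, norm_neg]
    exact (Complex.norm_le_abs_re_add_abs_im μ).trans
      (add_le_add (hstrip' μ hμ.1) hμ.2.le)
  have him : ∀ μ ∈ negZeros A B C r q, 0 < |μ.im| := fun μ hμ =>
    abs_pos.mpr (by simpa using h.nonreal (-μ) hμ.1 (neg_ne_zero.mpr hμ.2))
  obtain ⟨δ, hδ, hδ1, hgap⟩ : ∃ δ : ℝ, 0 < δ ∧ δ ≤ 1 ∧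
      ∀ μ ∈ {μ | μ ∈ negZeros A B C r q ∧ |μ.im| < 1}, δ ≤ |μ.im| := by
    rcases Set.eq_empty_or_nonempty {μ | μ ∈ negZeros A B C r q ∧ |μ.im| < 1} with he | hne
    · exact ⟨1, one_pos, le_rfl, by rw [he]; simp⟩
    · obtain ⟨μ, hμ, hmin⟩ := Set.exists_min_image _ (fun μ : ℂ => |μ.im|) hfin hne
      exact ⟨|μ.im|, him μ hμ.1, hμ.2.le, hmin⟩
  have hgap' : ∀ μ ∈ negZeros A B C r q, δ ≤ |μ.im| := fun μ hμ => by
    by_cases h1 : |μ.im| < 1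
    · exact hgap μ ⟨hμ, h1⟩
    · exact hδ1.trans (not_lt.mp h1)
  refine ⟨σ / δ, δ, N, ?_, hδ, hgap', fun μ hμ => ?_, by positivity⟩
  · intro k T hT
    classical
    -- Since the coefficients are real, `μ ↦ -conj μ` sends negated zeros to zeros without changing
    -- the imaginary part, so the window bound carries over.
    have hinj : Function.Injective fun z : ℂ => -(starRingEnd ℂ) z := fun a b hab =>
      (starRingEnd ℂ).injective (neg_injective hab)
    have h1 := hwin k (T.image fun z => -(starRingEnd ℂ) z) fun ρ hρ => by
      rw [Finset.mem_image] at hρ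
      obtain ⟨μ, hμ, rfl⟩ := hρ
      refine ⟨?_, by simpa using (hT μ hμ).2⟩
      rw [mem_ofPred_eq, ← map_neg, star_expPoly, (hT μ hμ).1.1, map_zero]
    rwa [Finset.card_image_of_injective _ hinj] at h1
  · calc |μ.re| ≤ σ / δ * δ := by rw [div_mul_cancel₀ _ hδ.ne']; exact hstrip' μ hμ
      _ ≤ σ / δ * |μ.im| := by
        gcongr
        exact hgap' μ hμ

/-- Minus the second derivative of `log (f x) - log x`, `f` the exponential polynomial. -/
def kernel (A B C r q x : ℝ) : ℝ :=
  -((realExpPoly 0 (r ^ 2 * B) (q ^ 2 * C) r q x * realExpPoly A B C r q x -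
    realExpPoly 0 (-(r * B)) (-(q * C)) r q x ^ 2) / realExpPoly A B C r q x ^ 2) - 1 / x ^ 2

theorem kernel_eq (h : WavePoly A B C r q ℓ) {x : ℝ} (hx : 0 < x) :
    (kernel A B C r q x : ℂ) = -deriv (logDeriv (expPoly A B C r q)) x - 1 / (x : ℂ) ^ 2 := by
  have hne : expPoly A B C r q x ≠ 0 := by
    rw [expPoly_ofReal]
    exact_mod_cast (h.pos x hx).ne'
  rw [deriv_logDeriv_eq differentiable_expPoly hne, deriv_deriv_expPoly, deriv_expPoly,
    expPoly_ofReal, expPoly_ofReal, expPoly_ofReal, kernel]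
  push_cast
  rfl

/-- This is the partial fraction expansion at `x`, with the term `1/x²` of the zero at the origin
removed and `ρ` replaced by `-μ`. -/
theorem hasSum_kernel (h : WavePoly A B C r q ℓ) {x : ℝ} (hx : 0 < x) :
    HasSum (fun μ : negZeros A B C r q => 1 / ((x : ℂ) + μ) ^ 2) (kernel A B C r q x : ℂ) := by
  obtain ⟨σ, N, -, -, hpf⟩ :=
    exists_expPoly_partialFractions h.A_pos.ne' h.C_ne h.r_pos h.r_lt h.simple
  have hne : expPoly A B C r q x ≠ 0 := by
    rw [expPoly_ofReal]
    exact_mod_cast (h.pos x hx).ne'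
  have h0 : expPoly A B C r q 0 = 0 := by
    have := expPoly_ofReal A B C r q 0
    rwa [h.realExpPoly_zero, Complex.ofReal_zero] at this
  have h1 : HasSum ({z | expPoly A B C r q z = 0}.indicator fun ρ => 1 / ((x : ℂ) - ρ) ^ 2)
      (-deriv (logDeriv (expPoly A B C r q)) x) :=
    hasSum_subtype_iff_indicator.mp (hpf x hne)
  have h2 := h1.sub (hasSum_ite_eq (0 : ℂ) (1 / (x : ℂ) ^ 2))
  rw [← h.kernel_eq hx, ← (Equiv.neg ℂ).hasSum_iff] at h2
  have h3 : HasSum ((negZeros A B C r q).indicator fun μ => 1 / ((x : ℂ) + μ) ^ 2)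
      (kernel A B C r q x : ℂ) := by
    refine h2.congr_fun fun μ => ?_
    by_cases hμ : μ = 0
    · subst hμ
      simp [negZeros, indicator, h0]
    · by_cases hμz : expPoly A B C r q (-μ) = 0
      · simp [negZeros, indicator, hμ, hμz]
      · simp [negZeros, indicator, hμ, hμz]
  exact hasSum_subtype_iff_indicator.mpr h3

/-- The kernel without its slowly decaying part. -/
def fastKernel (A B C r q x : ℝ) : ℝ :=
  kernel A B C r q x + (Ioi 1).indicator (fun x => 1 / x ^ 2) x

theorem continuousOn_kernel (h : WavePoly A B C r q ℓ) :
    ContinuousOn (kernel A B C r q) (Ioi 0) := by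
  unfold kernel
  have c1 := continuous_realExpPoly A B C r q
  have c2 := continuous_realExpPoly 0 (-(r * B)) (-(q * C)) r q
  have c3 := continuous_realExpPoly 0 (r ^ 2 * B) (q ^ 2 * C) r q
  refine ContinuousOn.sub (ContinuousOn.neg (ContinuousOn.div (by fun_prop) (by fun_prop)
    fun x hx => pow_ne_zero 2 (h.pos x hx).ne')) (ContinuousOn.div (by fun_prop) (by fun_prop)
    fun x hx => pow_ne_zero 2 (ne_of_gt hx))

theorem locallyIntegrableOn_fastKernel (h : WavePoly A B C r q ℓ) :
    LocallyIntegrableOn (fun x => (fastKernel A B C r q x : ℂ)) (Ioi 0) := by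
  have h1 : LocallyIntegrableOn (kernel A B C r q) (Ioi 0) :=
    h.continuousOn_kernel.locallyIntegrableOn measurableSet_Ioi
  have h2 : LocallyIntegrableOn ((Ioi (1 : ℝ)).indicator fun x : ℝ => 1 / x ^ 2) (Ioi 0) := by
    have h3 : LocallyIntegrableOn (fun x : ℝ => 1 / x ^ 2) (Ioi 0) :=
      ContinuousOn.locallyIntegrableOn (ContinuousOn.div (by fun_prop) (by fun_prop)
        fun x hx => pow_ne_zero 2 (ne_of_gt hx)) measurableSet_Ioi
    refine h3.mono ?_ (Eventually.of_forall fun x => norm_indicator_le_norm_self _ _)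
    exact ((by fun_prop : Measurable fun x : ℝ => 1 / x ^ 2).indicator
      measurableSet_Ioi).aestronglyMeasurable
  intro x hx
  obtain ⟨t, ht, hi⟩ := (h1.add h2) x hx
  exact ⟨t, ht, hi.ofReal⟩

/-- Beyond `1` the two `1/x²` terms cancel, leaving `-(log f)''`, which is exponentially small. -/
theorem fastKernel_isBigO_atTop (h : WavePoly A B C r q ℓ) :
    (fun x => (fastKernel A B C r q x : ℂ)) =O[atTop] fun x => Real.exp (-r * x) := by
  obtain ⟨σ, K, -, -, hb⟩ := exists_expPoly_right_bounds (B := B) (C := C) h.A_pos.ne' h.r_pos h.r_lt.le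
  refine Asymptotics.IsBigO.of_bound K ?_
  filter_upwards [eventually_ge_atTop σ, eventually_gt_atTop 1] with x hx hx1
  have e : (fastKernel A B C r q x : ℂ) = -deriv (logDeriv (expPoly A B C r q)) x := by
    rw [fastKernel, indicator_of_mem (show x ∈ Ioi 1 from hx1), Complex.ofReal_add,
      h.kernel_eq (one_pos.trans hx1)]
    push_cast
    ring
  rw [e, norm_neg, Real.norm_of_nonneg (Real.exp_pos _).le, neg_mul]
  exact (hb x hx).2

/-- Near `0` this is the kernel itself, bounded termwise by the convergent series `∑ (2κ + 3)²
‖μ‖⁻²`. The exponent `-0` is the form expected by the Mellin transform lemmas. -/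
theorem fastKernel_isBigO_zero (h : WavePoly A B C r q ℓ) :
    (fun x => (fastKernel A B C r q x : ℂ)) =O[𝓝[>] 0] fun x => x ^ (-0 : ℝ) := by
  obtain ⟨κ, δ, N, hM⟩ := h.exists_sectorSet
  have hs := (hM.summable_rpow one_lt_two).mul_left ((2 * κ + 3) ^ 2)
  refine Asymptotics.IsBigO.of_bound
    (∑' μ : negZeros A B C r q, (2 * κ + 3) ^ 2 * ‖(μ : ℂ)‖ ^ (-2 : ℝ)) ?_
  filter_upwards [self_mem_nhdsWithin, mem_nhdsWithin_of_mem_nhds (gt_mem_nhds one_pos)] with x hx hx1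
  have hx : 0 < x := hx
  have e : fastKernel A B C r q x = kernel A B C r q x := by
    rw [fastKernel, indicator_of_notMem (by simpa using le_of_lt hx1), add_zero]
  rw [e, neg_zero, Real.rpow_zero, norm_one, mul_one, ← (h.hasSum_kernel hx).tsum_eq]
  refine tsum_of_norm_bounded hs.hasSum fun μ => ?_
  have hμ := hM.norm_pos μ.2
  have h1 := hM.add_norm_le μ.2 hx.le
  have h2 : 0 < ‖(x : ℂ) + μ‖ := by
    by_contra! h4
    nlinarith [norm_nonneg ((x : ℂ) + μ), hM.kappa_nonneg]
  have hκ := hM.kappa_nonneg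
  rw [norm_div, norm_one, norm_pow, Real.rpow_neg hμ.le, Real.rpow_two, ← div_eq_mul_inv,
    div_le_div_iff₀ (by positivity) (by positivity), one_mul, ← mul_pow]
  gcongr
  linarith

/-- The Mellin transform of the rapidly decaying part of the kernel. -/
def fastMellin (A B C r q : ℝ) (s : ℂ) : ℂ := mellin (fun x => (fastKernel A B C r q x : ℂ)) (2 - s)

theorem mellinConvergent_fastKernel (h : WavePoly A B C r q ℓ) {s : ℂ} (hs : s.re < 2) :
    MellinConvergent (fun x => (fastKernel A B C r q x : ℂ)) (2 - s) :=
  mellinConvergent_of_isBigO_rpow_exp h.r_pos h.locallyIntegrableOn_fastKernel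
    h.fastKernel_isBigO_atTop h.fastKernel_isBigO_zero (by simpa using hs)

theorem differentiableAt_fastMellin (h : WavePoly A B C r q ℓ) {s : ℂ} (hs : s.re < 2) :
    DifferentiableAt ℂ (fastMellin A B C r q) s := by
  have h1 := mellin_differentiableAt_of_isBigO_rpow_exp (s := 2 - s) h.r_pos
    h.locallyIntegrableOn_fastKernel h.fastKernel_isBigO_atTop h.fastKernel_isBigO_zero
    (by simpa using hs)
  exact h1.comp s (by fun_prop : DifferentiableAt ℂ (fun s : ℂ => 2 - s) s)

/-- The tail `1/x²` on `(1, ∞)` has transform `∫₁^∞ x^{-1-s} dx = 1/s`, the explicit pole that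
permits continuation to the left. -/
theorem mellin_kernel (h : WavePoly A B C r q ℓ) {s : ℂ} (h0 : 0 < s.re) (h2 : s.re < 2) :
    mellin (fun x => (kernel A B C r q x : ℂ)) (2 - s) = fastMellin A B C r q s - 1 / s := by
  have e : ∀ x : ℝ, (x : ℂ) ^ (2 - s - 1) • ((Ioi (1 : ℝ)).indicator (fun x : ℝ => 1 / (x : ℂ) ^ 2) x) =
      (Ioi (1 : ℝ)).indicator (fun x : ℝ => (x : ℂ) ^ (-1 - s)) x := fun x => by
    by_cases hx : x ∈ Ioi (1 : ℝ)
    · rw [indicator_of_mem hx, indicator_of_mem hx]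
      have hx0 : (x : ℂ) ≠ 0 := Complex.ofReal_ne_zero.mpr (one_pos.trans hx).ne'
      rw [show 2 - s - 1 = (-1 - s) + 2 by ring, Complex.cpow_add _ _ hx0, smul_eq_mul,
        Complex.cpow_ofNat]
      field_simp
    · rw [indicator_of_notMem hx, indicator_of_notMem hx, smul_zero]
  have hre : (-1 - s).re < -1 := by simpa using h0
  have hind : HasMellin (fun x : ℝ => (Ioi (1 : ℝ)).indicator (fun x : ℝ => 1 / (x : ℂ) ^ 2) x)
      (2 - s) (1 / s) := by
    have hi := integrableOn_Ioi_cpow_of_lt hre one_pos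
    constructor
    · simp only [MellinConvergent, e]
      exact (hi.integrable_indicator measurableSet_Ioi).integrableOn
    · rw [mellin]
      simp only [e]
      rw [setIntegral_indicator measurableSet_Ioi, Ioi_inter_Ioi,
        max_eq_right (zero_le_one' ℝ), integral_Ioi_cpow_of_lt hre one_pos]
      rw [Complex.ofReal_one, Complex.one_cpow, show -1 - s + 1 = -s by ring, neg_div_neg_eq]
  have hsub := (hasMellin_sub (h.mellinConvergent_fastKernel h2) hind.1).2
  rw [hind.2] at hsub
  rw [fastMellin, ← hsub]
  congr 1
  funext x
  by_cases hx : x ∈ Ioi (1 : ℝ)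
  · simp [fastKernel, indicator_of_mem hx]
  · simp [fastKernel, indicator_of_notMem hx]

theorem tendsto_realExpPoly_div (h : WavePoly A B C r q ℓ) :
    Tendsto (fun x => realExpPoly A B C r q x / x) (𝓝[>] 0) (𝓝 ℓ) := by
  have h1 := (hasDerivAt_realExpPoly A B C r q 0).tendsto_slope_zero_right
  have e : realExpPoly 0 (-(r * B)) (-(q * C)) r q 0 = ℓ := by
    simpa [realExpPoly] using h.slope
  rw [e] at h1
  refine h1.congr fun x => ?_
  rw [zero_add, h.realExpPoly_zero, sub_zero, smul_eq_mul, inv_mul_eq_div]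

/-- An antiderivative of `-x (log f)''` is `Ψ = -x f'/f + log f`. At infinity it tends to `log A`;
at `0`, after subtracting `log x`, to `-1 + log ℓ` since `f(x)/x → ℓ`. The contributions `Ψ 1`
cancel. -/
theorem integral_mul_fastKernel (h : WavePoly A B C r q ℓ) :
    ∫ x in Ioi 0, x * fastKernel A B C r q x = Real.log A + 1 - Real.log ℓ := by
  set f := realExpPoly A B C r q with hf
  set f₁ := realExpPoly 0 (-(r * B)) (-(q * C)) r q with hf₁
  have hd1 : ∀ x, HasDerivAt f (f₁ x) x := hasDerivAt_realExpPoly A B C r q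
  have hd2 : ∀ x, HasDerivAt f₁ (realExpPoly 0 (r ^ 2 * B) (q ^ 2 * C) r q x) x := fun x => by
    have := hasDerivAt_realExpPoly 0 (-(r * B)) (-(q * C)) r q x
    convert this using 2 <;> ring
  have hint : IntegrableOn (fun x => x * fastKernel A B C r q x) (Ioi 0) := by
    have h1 := (h.mellinConvergent_fastKernel (s := 0) (by simp))
    rw [MellinConvergent] at h1
    have h2 := h1.re
    refine h2.congr ?_
    filter_upwards with x
    rw [show (2 : ℂ) - 0 - 1 = 1 by norm_num, Complex.cpow_one, smul_eq_mul, ← Complex.ofReal_mul]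
    simp
  set Ψ : ℝ → ℝ := fun x => -(x * (f₁ x / f x)) + Real.log (f x) with hΨ
  have hΨd : ∀ x, 0 < x → HasDerivAt Ψ (x * (kernel A B C r q x + 1 / x ^ 2)) x := fun x hx => by
    have hfx : f x ≠ 0 := (h.pos x hx).ne'
    have h1 := (((hasDerivAt_id x).fun_mul ((hd2 x).fun_div (hd1 x) hfx)).fun_neg).fun_add
      ((hd1 x).log hfx)
    refine h1.congr_deriv ?_
    simp only [kernel, id]
    rw [← hf, ← hf₁]
    field_simp
    ring
  have hlow : ∫ x in (0 : ℝ)..1, x * fastKernel A B C r q x = Ψ 1 - (-1 + Real.log ℓ) := by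
    refine intervalIntegral.integral_eq_sub_of_hasDerivAt_of_tendsto
      (f := fun x => Ψ x - Real.log x) one_pos (fun x hx => ?_) ?_ ?_ ?_
    · have e : fastKernel A B C r q x = kernel A B C r q x := by
        rw [fastKernel, indicator_of_notMem (by simpa using le_of_lt hx.2), add_zero]
      have hx0 : x ≠ 0 := hx.1.ne'
      refine ((hΨd x hx.1).fun_sub (Real.hasDerivAt_log hx0)).congr_deriv ?_
      rw [e]
      field_simp
      ring
    · rw [intervalIntegrable_iff_integrableOn_Ioc_of_le zero_le_one]
      exact hint.mono_set Ioc_subset_Ioi_self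
    · have h1 := h.tendsto_realExpPoly_div
      have h2 : Tendsto f₁ (𝓝[>] 0) (𝓝 ℓ) := by
        have e : f₁ 0 = ℓ := by simpa [hf₁, realExpPoly] using h.slope
        rw [← e]
        exact (continuous_realExpPoly _ _ _ _ _).continuousAt.tendsto.mono_left nhdsWithin_le_nhds
      have h3 := ((h2.div h1 h.slope_pos.ne').neg).add (h1.log h.slope_pos.ne')
      rw [div_self h.slope_pos.ne'] at h3
      refine h3.congr' ?_
      filter_upwards [self_mem_nhdsWithin] with x hx
      have hx : 0 < x := hx
      have hfx := h.pos x hx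
      rw [Real.log_div hfx.ne' hx.ne', hΨ]
      simp only [Pi.div_apply]
      rw [← hf] at hfx ⊢
      field_simp
      ring
    · have h1 : ContinuousAt (fun x => Ψ x - Real.log x) 1 :=
        (hΨd 1 one_pos).continuousAt.sub (Real.continuousAt_log one_ne_zero)
      have h2 := h1.tendsto.mono_left (nhdsWithin_le_nhds (s := Iio 1))
      simpa using h2
  have hhigh : ∫ x in Ioi (1 : ℝ), x * fastKernel A B C r q x = Real.log A - Ψ 1 := by
    refine integral_Ioi_of_hasDerivAt_of_tendsto
      (hΨd 1 one_pos).continuousAt.continuousWithinAt (fun x hx => ?_)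
      (hint.mono_set (Ioi_subset_Ioi zero_le_one)) ?_
    · refine (hΨd x (one_pos.trans hx)).congr_deriv ?_
      rw [fastKernel, indicator_of_mem hx]
    · have h1 := tendsto_realExpPoly_atTop A B C h.r_pos h.q_pos
      have h2 := tendsto_mul_realExpPoly_atTop (-(r * B)) (-(q * C)) h.r_pos h.q_pos
      have h3 := ((h2.div h1 h.A_pos.ne').neg).add (h1.log h.A_pos.ne')
      simp only [zero_div, neg_zero, zero_add] at h3
      refine h3.congr fun x => ?_
      simp only [hΨ, mul_div_assoc, Pi.div_apply]
      rfl
  rw [← Ioc_union_Ioi_eq_Ioi zero_le_one, setIntegral_union Ioc_disjoint_Ioi_same measurableSet_Ioi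
    (hint.mono_set Ioc_subset_Ioi_self) (hint.mono_set (Ioi_subset_Ioi zero_le_one)),
    ← intervalIntegral.integral_of_le zero_le_one, hlow, hhigh]
  ring

theorem fastMellin_zero (h : WavePoly A B C r q ℓ) :
    fastMellin A B C r q 0 = (Real.log A + 1 - Real.log ℓ : ℝ) := by
  rw [← h.integral_mul_fastKernel, fastMellin, mellin, ← integral_complex_ofReal]
  refine setIntegral_congr_fun measurableSet_Ioi fun x _ => ?_
  rw [show (2 : ℂ) - 0 - 1 = 1 by norm_num, Complex.cpow_one, smul_eq_mul, ← Complex.ofReal_mul]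

/-- The continuation of the zeta function to `Re s < 2`. -/
def zetaLeft (A B C r q : ℝ) (s : ℂ) : ℂ :=
  (Complex.Gamma (s + 1))⁻¹ * (Complex.Gamma (2 - s))⁻¹ * (s * fastMellin A B C r q s - 1)

theorem differentiableAt_zetaLeft (h : WavePoly A B C r q ℓ) {s : ℂ} (hs : s.re < 2) :
    DifferentiableAt ℂ (zetaLeft A B C r q) s := by
  have h1 : DifferentiableAt ℂ (fun s : ℂ => (Complex.Gamma (s + 1))⁻¹) s :=
    DifferentiableAt.comp (g := fun s : ℂ => (Complex.Gamma s)⁻¹) s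
      (Complex.differentiable_one_div_Gamma (s + 1))
      (by fun_prop : DifferentiableAt ℂ (fun s : ℂ => s + 1) s)
  have h2 : DifferentiableAt ℂ (fun s : ℂ => (Complex.Gamma (2 - s))⁻¹) s :=
    DifferentiableAt.comp (g := fun s : ℂ => (Complex.Gamma s)⁻¹) s
      (Complex.differentiable_one_div_Gamma (2 - s))
      (by fun_prop : DifferentiableAt ℂ (fun s : ℂ => 2 - s) s)
  exact (h1.mul h2).mul ((differentiableAt_id.mul (h.differentiableAt_fastMellin hs)).sub_const 1)

theorem analyticAt_zetaLeft (h : WavePoly A B C r q ℓ) {s : ℂ} (hs : s.re < 2) :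
    AnalyticAt ℂ (zetaLeft A B C r q) s :=
  DifferentiableOn.analyticAt (s := {s | s.re < 2})
    (fun _ hw => (h.differentiableAt_zetaLeft hw).differentiableWithinAt)
    ((isOpen_lt Complex.continuous_re continuous_const).mem_nhds hs)

theorem zetaLeft_zero : zetaLeft A B C r q 0 = -1 := by
  simp [zetaLeft, Complex.Gamma_ofNat_eq_factorial]

/-- The factors contribute `γ` and `1 - γ`, so Euler's constant cancels. -/
theorem hasDerivAt_gammaFactor :
    HasDerivAt (fun s : ℂ => (Complex.Gamma (s + 1))⁻¹ * (Complex.Gamma (2 - s))⁻¹) 1 0 := by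
  have h1 := Complex.hasDerivAt_Gamma_one
  have h2 := Complex.hasDerivAt_Gamma_nat 1
  have h3 : HasDerivAt (fun s : ℂ => Complex.Gamma (s + 1)) (-Real.eulerMascheroniConstant) 0 := by
    have := HasDerivAt.comp_add_const (f := Complex.Gamma) (0 : ℂ) 1 (by simpa using h1)
    exact this
  have h4 : HasDerivAt (fun s : ℂ => Complex.Gamma (2 - s)) (-(1 - Real.eulerMascheroniConstant)) 0 := by
    refine HasDerivAt.comp_const_sub (f := Complex.Gamma) (2 : ℂ) 0 ?_
    rw [sub_zero]
    simp only [Nat.factorial_one, Nat.cast_one, one_mul, harmonic_succ, harmonic_zero] at h2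
    norm_num at h2
    exact h2.congr_deriv (by ring)
  have h5 := (h3.fun_inv (by simp)).fun_mul (h4.fun_inv (by simp [Complex.Gamma_ofNat_eq_factorial]))
  refine h5.congr_deriv ?_
  simp [Complex.Gamma_ofNat_eq_factorial]

/-- By the product rule the value is `1 · (-1) + fastMellin 0`, and the `-1` cancels the `+ 1` in
`fastMellin_zero`. -/
theorem deriv_zetaLeft_zero (h : WavePoly A B C r q ℓ) :
    deriv (zetaLeft A B C r q) 0 = (Real.log A - Real.log ℓ : ℝ) := by
  have h1 := (h.differentiableAt_fastMellin (s := 0) (by simp)).hasDerivAt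
  have h2 := hasDerivAt_gammaFactor.fun_mul (((hasDerivAt_id (0 : ℂ)).fun_mul h1).sub_const 1)
  have h3 : HasDerivAt (zetaLeft A B C r q) _ 0 := h2
  rw [h3.deriv, h.fastMellin_zero]
  simp only [id, zero_add, sub_zero, Complex.Gamma_one, Complex.Gamma_ofNat_eq_factorial]
  push_cast
  norm_num
  ring

/-- The zeta function of the set of negatives of the nonzero zeros. -/
theorem exists_zeta (h : WavePoly A B C r q ℓ) :
    ∃ Z : ℂ → ℂ, (∀ s : ℂ, 1 < s.re → HasSum
        (fun μ : negZeros A B C r q => Complex.exp (-s * Complex.log μ)) (Z s)) ∧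
      Meromorphic Z ∧ AnalyticAt ℂ Z 0 ∧ Z 0 = -1 ∧ deriv Z 0 = (Real.log A - Real.log ℓ : ℝ) := by
  obtain ⟨κ, δ, N, hM⟩ := h.exists_sectorSet
  have hexp : ∀ s : ℂ, ∀ μ : negZeros A B C r q,
      Complex.exp (-s * Complex.log μ) = (μ : ℂ) ^ (-s) := fun s μ => by
    rw [Complex.cpow_def_of_ne_zero μ.2.2, mul_comm]
  -- In the strip `1 < Re s < 2` both descriptions hold: divide the Mellin identity by the gamma
  -- factors and absorb `1/s` through `Γ(s + 1) = s Γ(s)`.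
  have hoverlap : ∀ s : ℂ, 1 < s.re → s.re < 2 →
      ∑' μ : negZeros A B C r q, (μ : ℂ) ^ (-s) = zetaLeft A B C r q s := fun s h1 h2 => by
    have h3 := hM.hasSum_mellin (fun x hx => h.hasSum_kernel hx) h1 h2
    rw [h.mellin_kernel (one_pos.trans h1) h2] at h3
    have hs0 : s ≠ 0 := fun h0 => by rw [h0] at h1; norm_num at h1
    have g1 : Complex.Gamma s ≠ 0 := Complex.Gamma_ne_zero_of_re_pos (one_pos.trans h1)
    have g2 : Complex.Gamma (2 - s) ≠ 0 := Complex.Gamma_ne_zero_of_re_pos (by simpa using h2)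
    have h4 := h3.tsum_eq
    rw [tsum_mul_left] at h4
    rw [zetaLeft, Complex.Gamma_add_one s hs0]
    field_simp at h4 ⊢
    linear_combination h4
  classical
  set Z : ℂ → ℂ := fun s => if 1 < s.re then ∑' μ : negZeros A B C r q, (μ : ℂ) ^ (-s)
    else zetaLeft A B C r q s with hZ
  have hZr : ∀ s : ℂ, 1 < s.re → Z s = ∑' μ : negZeros A B C r q, (μ : ℂ) ^ (-s) := fun s hs => by
    simp only [hZ, if_pos hs]
  have hZl : ∀ s : ℂ, s.re < 2 → Z s = zetaLeft A B C r q s := fun s hs => by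
    by_cases h1 : 1 < s.re
    · rw [hZr s h1, hoverlap s h1 hs]
    · simp only [hZ, if_neg h1]
  have hZl' : ∀ s : ℂ, s.re < 2 → Z =ᶠ[𝓝 s] zetaLeft A B C r q := fun s hs => by
    filter_upwards [(isOpen_lt Complex.continuous_re continuous_const).mem_nhds hs] with w hw
    exact hZl w hw
  refine ⟨Z, fun s hs => ?_, fun s => ?_, ?_, ?_, ?_⟩
  · simp only [hexp]
    rw [hZr s hs]
    exact (hM.hasSum_cpow_and_differentiableAt hs).1.hasSum
  · rcases lt_or_ge s.re 2 with hs | hs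
    · exact ((h.analyticAt_zetaLeft hs).congr (hZl' s hs).symm).meromorphicAt
    · have hs : 1 < s.re := by linarith
      refine ((hM.hasSum_cpow_and_differentiableAt hs).2.congr ?_).meromorphicAt
      filter_upwards [(isOpen_lt continuous_const Complex.continuous_re).mem_nhds hs] with w hw
      exact (hZr w hw).symm
  · exact (h.analyticAt_zetaLeft (by simp)).congr (hZl' 0 (by simp)).symm
  · rw [hZl 0 (by simp), zetaLeft_zero]
  · rw [(hZl' 0 (by simp)).deriv_eq, h.deriv_zetaLeft_zero]

/-- There are infinitely many zeros. -/
theorem infinite_negZeros (h : WavePoly A B C r q ℓ) : (negZeros A B C r q).Infinite := by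
  intro hfin
  have := hfin.fintype
  have hsum : ∀ x : ℝ, 0 < x → (kernel A B C r q x : ℂ) =
      ∑ μ : negZeros A B C r q, 1 / ((x : ℂ) + μ) ^ 2 := fun x hx =>
    (h.hasSum_kernel hx).unique (hasSum_fintype _)
  -- If there were finitely many, `x²` times the kernel would tend to their number, whereas the
  -- kernel is `-1/x²` up to an exponentially small error.
  have hone : ∀ μ : ℂ, Tendsto (fun x : ℝ => (x : ℂ) ^ 2 * (1 / ((x : ℂ) + μ) ^ 2)) atTop (𝓝 1) := by
    intro μ
    have h1 : Tendsto (fun x : ℝ => 1 + μ * (x : ℂ)⁻¹) atTop (𝓝 1) := by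
      have h2 : Tendsto (fun x : ℝ => ((x⁻¹ : ℝ) : ℂ)) atTop (𝓝 0) :=
        (Complex.continuous_ofReal.tendsto' 0 0 Complex.ofReal_zero).comp tendsto_inv_atTop_zero
      simpa using (h2.const_mul μ).const_add 1
    have h3 := (h1.inv₀ one_ne_zero).pow 2
    rw [inv_one, one_pow] at h3
    refine h3.congr' ?_
    filter_upwards [eventually_gt_atTop 0] with x hx
    have hx' : (x : ℂ) ≠ 0 := Complex.ofReal_ne_zero.mpr hx.ne'
    rw [inv_pow, mul_one_div, show (x : ℂ) + μ = x * (1 + μ * (x : ℂ)⁻¹) by field_simp, mul_pow]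
    rw [← div_div, div_self (pow_ne_zero 2 hx'), one_div]
  have hl1 : Tendsto (fun x : ℝ => (x : ℂ) ^ 2 * (kernel A B C r q x : ℂ)) atTop
      (𝓝 (∑ _μ : negZeros A B C r q, 1)) := by
    have h1 := tendsto_finsetSum (Finset.univ : Finset (negZeros A B C r q))
      fun (μ : negZeros A B C r q) _ => hone (μ : ℂ)
    refine h1.congr' ?_
    filter_upwards [eventually_gt_atTop 0] with x hx
    rw [hsum x hx, Finset.mul_sum]
  have hl2 : Tendsto (fun x : ℝ => (x : ℂ) ^ 2 * (kernel A B C r q x : ℂ)) atTop (𝓝 (-1)) := by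
    have h1 := h.fastKernel_isBigO_atTop
    have h2 : (fun x : ℝ => Real.exp (-r * x)) =o[atTop] fun x => x ^ (-2 : ℝ) :=
      isLittleO_exp_neg_mul_rpow_atTop h.r_pos _
    have h3 := (Complex.isLittleO_ofReal_right.mpr (h1.trans_isLittleO h2)).tendsto_div_nhds_zero
    have h4 := h3.sub_const 1
    rw [zero_sub] at h4
    refine h4.congr' ?_
    filter_upwards [eventually_gt_atTop 1] with x hx
    have hx' : (x : ℂ) ≠ 0 := Complex.ofReal_ne_zero.mpr (one_pos.trans hx).ne'
    rw [fastKernel, indicator_of_mem (show x ∈ Ioi 1 from hx), Real.rpow_neg (by linarith),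
      Real.rpow_two]
    push_cast
    field_simp
    ring
  have := tendsto_nhds_unique hl1 hl2
  rw [Finset.sum_const, nsmul_one] at this
  have h5 := congrArg Complex.re this
  simp only [Complex.natCast_re, Complex.neg_re, Complex.one_re] at h5
  linarith [(Nat.cast_nonneg (Finset.univ : Finset (negZeros A B C r q)).card : (0 : ℝ) ≤ _)]

end WavePoly


/-! ## Weak derivatives and classical derivatives -/

section Sobolev

variable {c d : ℝ} {f g h : ℝ → ℂ}

/-- The zero mean makes the primitive vanish to the right of the support of `θ`, so it is again a
test function. -/
theorem exists_contDiff_primitive {θ : ℝ → ℝ} (hθ : ContDiff ℝ ∞ θ) (hs : HasCompactSupport θ)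
    (ht : tsupport θ ⊆ Ioo c d) (h0 : ∫ x, θ x = 0) :
    ∃ Φ : ℝ → ℝ, ContDiff ℝ ∞ Φ ∧ HasCompactSupport Φ ∧ tsupport Φ ⊆ Ioo c d ∧ deriv Φ = θ := by
  rcases (tsupport θ).eq_empty_or_nonempty with he | hne
  · refine ⟨0, contDiff_const, HasCompactSupport.zero, by simp, ?_⟩
    rw [tsupport_eq_empty_iff] at he
    rw [he]
    funext x
    simp
  obtain ⟨c', hc', hmin⟩ := hs.isCompact.exists_isLeast hne
  obtain ⟨d', hd', hmax⟩ := hs.isCompact.exists_isGreatest hne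
  have hderiv : ∀ x, HasDerivAt (fun x => ∫ t in c..x, θ t) (θ x) x := fun x =>
    intervalIntegral.integral_hasDerivAt_right (hθ.continuous.intervalIntegrable _ _)
      (hθ.continuous.stronglyMeasurableAtFilter _ _) hθ.continuous.continuousAt
  have hd : deriv (fun x => ∫ t in c..x, θ t) = θ := funext fun x => (hderiv x).deriv
  have hzero : ∀ x, x ∉ Icc c' d' → ∫ t in c..x, θ t = 0 := by
    intro x hx
    rw [mem_Icc, not_and_or, not_le, not_le] at hx
    rcases hx with hx | hx
    · have : ∀ t ∈ uIoc c x, θ t = 0 := fun t ht' => image_eq_zero_of_notMem_tsupport fun h => by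
        have h1 := hmin h
        have h2 := (ht hc').1
        rw [uIoc, mem_Ioc] at ht'
        exact absurd (ht'.2.trans_lt (max_lt h2 hx)) (not_lt.mpr h1)
      rw [intervalIntegral.integral_congr_ae (g := fun _ => (0 : ℝ)) (Eventually.of_forall this),
        intervalIntegral.integral_zero]
    · rw [intervalIntegral.integral_eq_integral_of_support_subset, h0]
      intro t ht'
      have h1 := subset_tsupport θ ht'
      exact ⟨(ht h1).1, (hmax h1).trans hx.le⟩
  have hts : tsupport (fun x => ∫ t in c..x, θ t) ⊆ Icc c' d' :=
    closure_minimal (fun x hx => by_contra fun h => hx (hzero x h)) isClosed_Icc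
  refine ⟨fun x => ∫ t in c..x, θ t, ?_, HasCompactSupport.intro isCompact_Icc hzero,
    hts.trans (Icc_subset_Ioo (ht hc').1 (ht hd').2), hd⟩
  exact contDiff_infty_iff_deriv.mpr ⟨fun x => (hderiv x).differentiableAt, by rwa [hd]⟩

theorem setIntegral_Ioo_eq {φ : ℝ → ℝ} (ht : tsupport φ ⊆ Ioo c d) :
    ∫ x in Ioo c d, φ x = ∫ x, φ x :=
  setIntegral_eq_integral_of_forall_compl_eq_zero fun _ hx =>
    image_eq_zero_of_notMem_tsupport fun h => hx (ht h)

/-- The du Bois-Reymond argument: subtracting `(∫ φ) ψ` from a test function `φ`, with `ψ` a bump of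
integral `1`, leaves the derivative of a test function. The constant is `∫ ψ f`. -/
theorem HasWeakDeriv.exists_const (hcd : c < d) (hf : HasWeakDeriv c d f 0) :
    ∃ C : ℂ, f =ᵐ[vol c d] fun _ => C := by
  set b : ContDiffBump ((c + d) / 2) := ⟨(d - c) / 8, (d - c) / 4, by linarith, by linarith⟩ with hb
  set ψ : ℝ → ℝ := b.normed volume with hψ
  have hψs : ContDiff ℝ ∞ ψ := b.contDiff_normed
  have hψc : HasCompactSupport ψ := b.hasCompactSupport_normed
  have hψt : tsupport ψ ⊆ Ioo c d := by
    rw [hψ, b.tsupport_normed_eq, Real.closedBall_eq_Icc]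
    refine Icc_subset_Ioo ?_ ?_ <;> simp only [hb] <;> linarith
  have hψ1 : ∫ x, ψ x = 1 := b.integral_normed
  refine ⟨∫ x in Ioo c d, ψ x • f x, ?_⟩
  set C := ∫ x in Ioo c d, ψ x • f x with hC
  have hCL : MemLp (fun _ : ℝ => C) 2 (vol c d) := memLp_const C
  have hi : Integrable (fun x => f x - C) (vol c d) := (hf.memLp.sub hCL).integrable (by norm_num)
  have key := isOpen_Ioo.ae_eq_zero_of_integral_contDiff_smul_eq_zero (U := Ioo c d)
    (f := fun x => f x - C) (μ := volume) (IntegrableOn.locallyIntegrableOn hi) (fun φ hφ hs ht => by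
      have hz : ∀ x, x ∉ Ioo c d → φ x • (f x - C) = 0 := fun x hx => by
        rw [image_eq_zero_of_notMem_tsupport (fun hx' => hx (ht hx')), zero_smul]
      rw [← setIntegral_eq_integral_of_forall_compl_eq_zero hz]
      set I := ∫ x, φ x with hI
      have hθt : tsupport (fun x => φ x - I * ψ x) ⊆ Ioo c d := by
        refine (tsupport_sub φ fun x => I * ψ x).trans (union_subset ht ?_)
        exact (tsupport_mul_subset_right (f := fun _ => I) (g := ψ)).trans hψt
      have hθc : HasCompactSupport fun x => φ x - I * ψ x := by
        refine HasCompactSupport.intro (hs.isCompact.union hψc.isCompact) fun x hx => ?_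
        rw [mem_union, not_or] at hx
        rw [image_eq_zero_of_notMem_tsupport hx.1, image_eq_zero_of_notMem_tsupport hx.2]
        simp
      have hθ0 : ∫ x, (φ x - I * ψ x) = 0 := by
        rw [integral_sub (hφ.continuous.integrable_of_hasCompactSupport hs)
          ((hψs.continuous.integrable_of_hasCompactSupport hψc).const_mul I), integral_const_mul,
          hψ1, mul_one, sub_self]
      obtain ⟨Φ, hΦ, hΦs, hΦt, hΦd⟩ := exists_contDiff_primitive (hφ.sub (contDiff_const.mul hψs))
        hθc hθt hθ0
      have h1 := hf.integral_eq Φ hΦ hΦs hΦt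
      simp only [hΦd, Pi.zero_apply, smul_zero, integral_zero, neg_zero, sub_smul, mul_smul] at h1
      rw [integral_sub (integrable_smul hf.memLp hφ.continuous hs)
        ((integrable_smul hf.memLp hψs.continuous hψc).fun_smul I), integral_smul, ← hC] at h1
      simp only [smul_sub]
      rw [integral_sub (integrable_smul hf.memLp hφ.continuous hs)
        (integrable_smul hCL hφ.continuous hs), integral_smul_const, setIntegral_Ioo_eq ht]
      exact h1)
  rw [Filter.EventuallyEq, ae_restrict_iff' measurableSet_Ioo]
  filter_upwards [key] with x hx hxm
  exact sub_eq_zero.mp (hx hxm)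

theorem memLp_continuous_mul {e : ℝ → ℂ} (he : Continuous e) (hf : MemLp f 2 (vol c d)) :
    MemLp (fun x => e x * f x) 2 (vol c d) := by
  obtain ⟨C, hC⟩ := isCompact_Icc.exists_bound_of_continuousOn (s := Icc c d) he.continuousOn
  refine MemLp.of_le_mul (c := C) hf (he.aestronglyMeasurable.mul hf.aestronglyMeasurable) ?_
  filter_upwards [ae_restrict_mem measurableSet_Ioo] with x hx
  rw [norm_mul]
  gcongr
  exact hC x (Ioo_subset_Icc_self hx)

theorem memLp_continuous {e : ℝ → ℂ} (he : Continuous e) : MemLp e 2 (vol c d) := by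
  have := memLp_continuous_mul (c := c) (d := d) he (memLp_const (1 : ℂ))
  simpa using this

theorem HasWeakDeriv.integral_mul_eq (hf : HasWeakDeriv c d f g) {χ : ℝ → ℂ}
    (hχ : ContDiff ℝ ∞ χ) (hs : HasCompactSupport χ) (ht : tsupport χ ⊆ Ioo c d) :
    ∫ x in Ioo c d, deriv χ x * f x = -∫ x in Ioo c d, χ x * g x := by
  have hre : ContDiff ℝ ∞ fun x => (χ x).re := Complex.reCLM.contDiff.comp hχ
  have him : ContDiff ℝ ∞ fun x => (χ x).im := Complex.imCLM.contDiff.comp hχ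
  have hres : HasCompactSupport fun x => (χ x).re := hs.comp_left (g := Complex.re) rfl
  have hims : HasCompactSupport fun x => (χ x).im := hs.comp_left (g := Complex.im) rfl
  have hret : tsupport (fun x => (χ x).re) ⊆ Ioo c d :=
    (closure_mono (Function.support_comp_subset (g := Complex.re) rfl χ)).trans ht
  have himt : tsupport (fun x => (χ x).im) ⊆ Ioo c d :=
    (closure_mono (Function.support_comp_subset (g := Complex.im) rfl χ)).trans ht
  have hd : ∀ x, HasDerivAt χ (deriv χ x) x := fun x =>
    ((hχ.differentiable (by simp)) x).hasDerivAt
  have hdre : deriv (fun x => (χ x).re) = fun x => (deriv χ x).re := funext fun x =>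
    (Complex.reCLM.hasFDerivAt.comp_hasDerivAt x (hd x)).deriv
  have hdim : deriv (fun x => (χ x).im) = fun x => (deriv χ x).im := funext fun x =>
    (Complex.imCLM.hasFDerivAt.comp_hasDerivAt x (hd x)).deriv
  have e1 := hf.integral_eq _ hre hres hret
  have e2 := hf.integral_eq _ him hims himt
  have c1 := hre.continuous_deriv (by simp)
  have c2 := him.continuous_deriv (by simp)
  have i1 := integrable_smul hf.memLp c1 hres.deriv
  have i2 := integrable_smul hf.memLp c2 hims.deriv
  have i3 := integrable_smul hf.memLp_deriv hre.continuous hres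
  have i4 := integrable_smul hf.memLp_deriv him.continuous hims
  rw [hdre] at e1 i1
  rw [hdim] at e2 i2
  have hsplit : ∀ z w : ℂ, z * w = z.re • w + Complex.I * (z.im • w) := fun z w => by
    conv_lhs => rw [← Complex.re_add_im z]
    rw [Complex.real_smul, Complex.real_smul]
    ring
  simp only [hsplit (deriv χ _), hsplit (χ _)]
  rw [integral_add i1 (i2.const_mul _), integral_add i3 (i4.const_mul _), integral_const_mul,
    integral_const_mul, e1, e2]
  ring

theorem contDiff_cexp_mul (z : ℂ) : ContDiff ℝ ∞ fun x : ℝ => Complex.exp (z * x) :=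
  (contDiff_const.mul Complex.ofRealCLM.contDiff).cexp

/-- The product rule is obtained by testing against `φ e^{zx}`, which is complex-valued; it supplies
integrating factors for first-order equations. -/
theorem HasWeakDeriv.exp_mul (hf : HasWeakDeriv c d f g) (z : ℂ) :
    HasWeakDeriv c d (fun x => Complex.exp (z * x) * f x)
      (fun x => Complex.exp (z * x) * (g x + z * f x)) := by
  have he := contDiff_cexp_mul z
  have hgz : MemLp (fun x => g x + z * f x) 2 (vol c d) :=
    hf.memLp_deriv.add (hf.memLp.const_mul z)
  refine ⟨memLp_continuous_mul he.continuous hf.memLp, memLp_continuous_mul he.continuous hgz,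
    fun φ hφ hs ht => ?_⟩
  have hφc : ContDiff ℝ ∞ fun x => (φ x : ℂ) := Complex.ofRealCLM.contDiff.comp hφ
  have hχ : ContDiff ℝ ∞ fun x => (φ x : ℂ) * Complex.exp (z * x) := hφc.mul he
  have hz : ∀ x, x ∉ tsupport φ → (φ x : ℂ) * Complex.exp (z * x) = 0 := fun x hx => by
    rw [image_eq_zero_of_notMem_tsupport hx, Complex.ofReal_zero, zero_mul]
  have hsup : Function.support (fun x => (φ x : ℂ) * Complex.exp (z * x)) ⊆ tsupport φ :=
    fun x hx => by_contra fun h => hx (hz x h)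
  have hχt : tsupport (fun x => (φ x : ℂ) * Complex.exp (z * x)) ⊆ Ioo c d :=
    (closure_minimal hsup (isClosed_tsupport φ)).trans ht
  have key := hf.integral_mul_eq hχ (HasCompactSupport.intro hs.isCompact hz) hχt
  have hd : ∀ x : ℝ, deriv (fun x : ℝ => (φ x : ℂ) * Complex.exp (z * x)) x =
      deriv φ x * Complex.exp (z * x) + φ x * (Complex.exp (z * x) * z) := fun x => by
    have h1 : HasDerivAt (fun x => (φ x : ℂ)) (deriv φ x : ℝ) x :=
      ((hφ.differentiable (by simp)) x).hasDerivAt.ofReal_comp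
    have h2 : HasDerivAt (fun x : ℝ => Complex.exp (z * x)) (Complex.exp (z * x) * (z * 1)) x :=
      (((hasDerivAt_id (x : ℂ)).const_mul z).cexp).comp_ofReal
    rw [mul_one] at h2
    exact (h1.mul h2).deriv
  have i1 := integrable_smul (memLp_continuous_mul he.continuous hf.memLp)
    (hφ.continuous_deriv (by simp)) hs.deriv
  have i2 := integrable_smul (memLp_continuous_mul he.continuous (hf.memLp.const_mul z))
    hφ.continuous hs
  have i3 := integrable_smul (memLp_continuous_mul he.continuous hf.memLp_deriv) hφ.continuous hs
  have e1 : ∫ x in Ioo c d, deriv (fun x : ℝ => (φ x : ℂ) * Complex.exp (z * x)) x * f x =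
      ∫ x in Ioo c d, (deriv φ x • (Complex.exp (z * x) * f x) +
        φ x • (Complex.exp (z * x) * (z * f x))) := by
    congr 1
    funext x
    rw [hd, Complex.real_smul, Complex.real_smul]
    ring
  have e2 : ∫ x in Ioo c d, (φ x : ℂ) * Complex.exp (z * x) * g x =
      ∫ x in Ioo c d, φ x • (Complex.exp (z * x) * g x) := by
    congr 1
    funext x
    rw [Complex.real_smul]
    ring
  rw [e1, e2, integral_add i1 i2] at key
  simp only [mul_add, smul_add]
  rw [integral_add i3 i2, neg_add, ← key]
  ring

theorem intervalIntegral_deriv_smul_add {F G : ℝ → ℂ} (hF : ∀ x, HasDerivAt F (G x) x)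
    (hG : Continuous G) {φ : ℝ → ℝ} (hφ : ContDiff ℝ ∞ φ) (c d : ℝ) :
    ∫ x in c..d, (deriv φ x • F x + φ x • G x) = φ d • F d - φ c • F c := by
  have hFc : Continuous F := continuous_iff_continuousAt.mpr fun x => (hF x).continuousAt
  have hc := hφ.continuous_deriv (by simp)
  refine intervalIntegral.integral_eq_sub_of_hasDerivAt (f := fun x => φ x • F x) (fun x _ => ?_)
    (Continuous.intervalIntegrable (by fun_prop) _ _)
  have h1 := ((hφ.differentiable (by simp)) x).hasDerivAt.fun_smul (hF x)
  exact h1.congr_deriv (add_comm _ _)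

/-- The function that is `F₁` on the left of `a` and `F₂` on the right. -/
def glue (a : ℝ) (F₁ F₂ : ℝ → ℂ) (x : ℝ) : ℂ := if x < a then F₁ x else F₂ x

theorem memLp_glue {a : ℝ} {F₁ F₂ : ℝ → ℂ} (h₁ : Continuous F₁) (h₂ : Continuous F₂) :
    MemLp (glue a F₁ F₂) 2 (vol c d) := by
  have e : glue a F₁ F₂ = (Iio a).piecewise F₁ F₂ := by
    funext x
    simp [glue, Set.piecewise]
  rw [e]
  exact MemLp.piecewise measurableSet_Iio ((memLp_continuous h₁).restrict _)
    ((memLp_continuous h₂).restrict _)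

theorem setIntegral_glue {a : ℝ} (hca : c ≤ a) (had : a ≤ d) {u u₁ u₂ : ℝ → ℂ}
    (hu₁ : Continuous u₁) (hu₂ : Continuous u₂) (h₁ : ∀ x < a, u x = u₁ x)
    (h₂ : ∀ x, a ≤ x → u x = u₂ x) :
    ∫ x in Ioo c d, u x = (∫ x in c..a, u₁ x) + ∫ x in a..d, u₂ x := by
  have e1 : ∫ x in Ioo c a, u x = ∫ x in c..a, u₁ x := by
    rw [intervalIntegral.integral_of_le hca, integral_Ioc_eq_integral_Ioo]
    exact setIntegral_congr_fun measurableSet_Ioo fun x hx => h₁ x hx.2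
  have e2 : ∫ x in Ico a d, u x = ∫ x in a..d, u₂ x := by
    rw [intervalIntegral.integral_of_le had, ← integral_Ico_eq_integral_Ioc]
    exact setIntegral_congr_fun measurableSet_Ico fun x hx => h₂ x hx.1
  have i1 : IntegrableOn u (Ioo c a) :=
    ((hu₁.integrableOn_Icc (a := c) (b := a)).mono_set Ioo_subset_Icc_self).congr_fun
      (fun x hx => (h₁ x hx.2).symm) measurableSet_Ioo
  have i2 : IntegrableOn u (Ico a d) :=
    ((hu₂.integrableOn_Icc (a := a) (b := d)).mono_set Ico_subset_Icc_self).congr_fun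
      (fun x hx => (h₂ x hx.1).symm) measurableSet_Ico
  rw [← e1, ← e2]
  rcases hca.eq_or_lt with rfl | hca
  · rw [Ioo_self, setIntegral_empty, zero_add, integral_Ico_eq_integral_Ioo]
  · rw [← Ioo_union_Ico_eq_Ioo hca had,
      setIntegral_union (by rw [Set.disjoint_left]; exact fun x hx hx' => not_lt.mpr hx'.1 hx.2)
        measurableSet_Ico i1 i2]

/-- A continuous, piecewise continuously differentiable function has its derivative as weak
derivative. -/
theorem hasWeakDeriv_glue {a : ℝ} (hca : c ≤ a) (had : a ≤ d) {F₁ F₂ G₁ G₂ : ℝ → ℂ}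
    (h₁ : ∀ x, HasDerivAt F₁ (G₁ x) x) (h₂ : ∀ x, HasDerivAt F₂ (G₂ x) x) (hG₁ : Continuous G₁)
    (hG₂ : Continuous G₂) (hF : F₁ a = F₂ a) :
    HasWeakDeriv c d (glue a F₁ F₂) (glue a G₁ G₂) := by
  have hF₁ : Continuous F₁ := continuous_iff_continuousAt.mpr fun x => (h₁ x).continuousAt
  have hF₂ : Continuous F₂ := continuous_iff_continuousAt.mpr fun x => (h₂ x).continuousAt
  refine ⟨memLp_glue hF₁ hF₂, memLp_glue hG₁ hG₂, fun φ hφ hs ht => ?_⟩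
  have hc := hφ.continuous_deriv (by simp)
  rw [eq_neg_iff_add_eq_zero, ← integral_add
    (integrable_smul (memLp_glue hF₁ hF₂) hc hs.deriv)
    (integrable_smul (memLp_glue hG₁ hG₂) hφ.continuous hs)]
  rw [setIntegral_glue hca had (u₁ := fun x => deriv φ x • F₁ x + φ x • G₁ x)
    (u₂ := fun x => deriv φ x • F₂ x + φ x • G₂ x) (by fun_prop) (by fun_prop)
    (fun x hx => by simp only [glue, if_pos hx])
    (fun x hx => by simp only [glue, if_neg (not_lt.mpr hx)]),
    intervalIntegral_deriv_smul_add h₁ hG₁ hφ, intervalIntegral_deriv_smul_add h₂ hG₂ hφ, hF,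
    image_eq_zero_of_notMem_tsupport (f := φ) (x := c) fun h => lt_irrefl _ (ht h).1,
    image_eq_zero_of_notMem_tsupport (f := φ) (x := d) fun h => lt_irrefl _ (ht h).2]
  simp

theorem hasWeakDeriv_of_hasDerivAt (hcd : c ≤ d) {F G : ℝ → ℂ} (hF : ∀ x, HasDerivAt F (G x) x)
    (hG : Continuous G) : HasWeakDeriv c d F G := by
  have h := hasWeakDeriv_glue (a := d) hcd le_rfl hF hF hG hG rfl
  have e : ∀ F : ℝ → ℂ, glue d F F = F := fun F => by funext x; simp [glue]
  rwa [e, e] at h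

theorem HasWeakDeriv.mono {c' d' : ℝ} (hf : HasWeakDeriv c d f g) (hc : c ≤ c') (hd : d' ≤ d) :
    HasWeakDeriv c' d' f g := by
  refine ⟨hf.memLp.mono_measure (vol_mono hc hd), hf.memLp_deriv.mono_measure (vol_mono hc hd),
    fun φ hφ hs ht => ?_⟩
  have hsub : Ioo c' d' ⊆ Ioo c d := Ioo_subset_Ioo hc hd
  have key := hf.integral_eq φ hφ hs (ht.trans hsub)
  rw [setIntegral_eq_of_subset_of_forall_sdiff_eq_zero measurableSet_Ioo hsub,
    setIntegral_eq_of_subset_of_forall_sdiff_eq_zero measurableSet_Ioo hsub] at key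
  · exact key
  · intro x hx
    rw [image_eq_zero_of_notMem_tsupport fun h => hx.2 (ht h), zero_smul]
  · intro x hx
    have : x ∉ tsupport (deriv φ) := fun h => hx.2 (ht (tsupport_deriv_subset h))
    rw [image_eq_zero_of_notMem_tsupport this, zero_smul]

/-- Weak solutions of `f'' = z² f` are classical. -/
theorem HasWeakDeriv₂.exists_exp (hcd : c < d) {z : ℂ} (hz : z ≠ 0) (hf : HasWeakDeriv₂ c d f h)
    (hh : h =ᵐ[vol c d] fun x => z ^ 2 * f x) :
    ∃ m n : ℂ, f =ᵐ[vol c d] fun x => m * Complex.exp (z * x) + n * Complex.exp (-(z * x)) := by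
  obtain ⟨g, h1, h2⟩ := hf
  -- For `w = ±z` the combination `g - w f` solves `u' = -w u`; the integrating factor `e^{wx}`
  -- makes it constant. The two solutions then determine `f` because `z ≠ 0`.
  have key : ∀ w : ℂ, w ^ 2 = z ^ 2 → ∃ C : ℂ, (fun x : ℝ => g x - w * f x) =ᵐ[vol c d]
      fun x => C * Complex.exp (-(w * x)) := fun w hw => by
    have h3 := (h2.add (h1.smul (-w))).exp_mul w
    have h4 : HasWeakDeriv c d (fun x : ℝ => Complex.exp (w * x) * (g x - w * f x)) 0 := by
      refine h3.congr (Eventually.of_forall fun x => ?_) ?_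
      · simp only [Pi.add_apply, Pi.smul_apply, smul_eq_mul]
        ring
      · filter_upwards [hh] with x hx
        simp only [Pi.add_apply, Pi.smul_apply, smul_eq_mul, Pi.zero_apply]
        rw [hx, ← hw]
        ring
    obtain ⟨C, hC⟩ := h4.exists_const hcd
    refine ⟨C, ?_⟩
    filter_upwards [hC] with x hx
    rw [← hx, Complex.exp_neg]
    field_simp
  obtain ⟨C₁, hC₁⟩ := key z rfl
  obtain ⟨C₂, hC₂⟩ := key (-z) (neg_sq z)
  refine ⟨C₂ / (2 * z), -C₁ / (2 * z), ?_⟩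
  filter_upwards [hC₁, hC₂] with x hx₁ hx₂
  rw [neg_mul, neg_mul, neg_neg] at hx₂
  field_simp
  linear_combination hx₂ - hx₁

/-! ### Traces -/

/-- A one-sided neighbourhood has positive measure, so it meets every conull set. This makes
one-sided traces unique. -/
theorem neBot_nhdsLT_inf_ae (a : ℝ) : (𝓝[<] a ⊓ ae (volume : Measure ℝ)).NeBot := by
  rw [inf_neBot_iff]
  intro s hs t ht
  obtain ⟨b, hb, hbs⟩ := mem_nhdsLT_iff_exists_Ioo_subset.mp hs
  by_contra hne
  have h1 : Ioo b a ⊆ tᶜ := fun x hx hxt => hne ⟨x, hbs hx, hxt⟩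
  have h2 : volume (Ioo b a) = 0 := measure_mono_null h1 (mem_ae_iff.mp ht)
  rw [Real.volume_Ioo, ENNReal.ofReal_eq_zero] at h2
  have hb : b < a := hb
  linarith

theorem neBot_nhdsGT_inf_ae (a : ℝ) : (𝓝[>] a ⊓ ae (volume : Measure ℝ)).NeBot := by
  rw [inf_neBot_iff]
  intro s hs t ht
  obtain ⟨b, hb, hbs⟩ := mem_nhdsGT_iff_exists_Ioo_subset.mp hs
  by_contra hne
  have h1 : Ioo a b ⊆ tᶜ := fun x hx hxt => hne ⟨x, hbs hx, hxt⟩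
  have h2 : volume (Ioo a b) = 0 := measure_mono_null h1 (mem_ae_iff.mp ht)
  rw [Real.volume_Ioo, ENNReal.ofReal_eq_zero] at h2
  have hb : a < b := hb
  linarith

theorem HasTrace.mono {l l' : Filter ℝ} {y : ℂ} (hf : HasTrace l f y) (hl : l' ≤ l) :
    HasTrace l' f y := Tendsto.mono_left hf (inf_le_inf_right _ hl)

theorem hasTrace_of_ae_eq {F : ℝ → ℂ} (hF : Continuous F) (hf : f =ᵐ[vol c d] F) {l : Filter ℝ}
    {a : ℝ} (hl : l ≤ 𝓝 a) (hcd : Ioo c d ∈ l) : HasTrace l f (F a) := by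
  have h1 : HasTrace l F (F a) := (hF.tendsto a).mono_left (inf_le_left.trans hl)
  exact h1.congr hf.symm hcd

theorem HasTrace.eq_left {F : ℝ → ℂ} {y : ℂ} {a : ℝ} (hF : Continuous F) (hf : f =ᵐ[vol c a] F)
    (hc : c < a) (h : HasTrace (𝓝[<] a) f y) : y = F a := by
  have := neBot_nhdsLT_inf_ae a
  exact tendsto_nhds_unique h (hasTrace_of_ae_eq hF hf nhdsWithin_le_nhds (Ioo_mem_nhdsLT hc))

theorem HasTrace.eq_right {F : ℝ → ℂ} {y : ℂ} {a : ℝ} (hF : Continuous F) (hf : f =ᵐ[vol a d] F)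
    (hd : a < d) (h : HasTrace (𝓝[>] a) f y) : y = F a := by
  have := neBot_nhdsGT_inf_ae a
  exact tendsto_nhds_unique h (hasTrace_of_ae_eq hF hf nhdsWithin_le_nhds (Ioo_mem_nhdsGT hd))

end Sobolev


/-! ## The eigenvalue equation -/

section Eigen

variable {L a : ℝ} {α z : ℂ} {v w p : ℝ → ℂ}

/-- Subtracting the particular solution `P` reduces to the homogeneous equation. -/
theorem exists_exp_add_particular {c d : ℝ} (hcd : c < d) (hz : z ≠ 0) (hw : HasWeakDeriv₂ c d w p)
    {P P₁ P₂ : ℝ → ℂ} (hP : ∀ x, HasDerivAt P (P₁ x) x) (hP₁ : ∀ x, HasDerivAt P₁ (P₂ x) x)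
    (hP₂ : Continuous P₂) (hp : p =ᵐ[vol c d] fun x => z ^ 2 * w x + (P₂ x - z ^ 2 * P x)) :
    ∃ m n : ℂ, w =ᵐ[vol c d]
      fun x => m * Complex.exp (z * x) + n * Complex.exp (-(z * x)) + P x := by
  have hP₁c : Continuous P₁ := continuous_iff_continuousAt.mpr fun x => (hP₁ x).continuousAt
  have h1 : HasWeakDeriv₂ c d P P₂ := ⟨P₁, hasWeakDeriv_of_hasDerivAt hcd.le hP hP₁c,
    hasWeakDeriv_of_hasDerivAt hcd.le hP₁ hP₂⟩
  obtain ⟨m, n, h⟩ := (hw.add (h1.smul (-1))).exists_exp hcd hz (by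
    filter_upwards [hp] with x hx
    simp only [Pi.add_apply, Pi.smul_apply, smul_eq_mul, hx]
    ring)
  refine ⟨m, n, ?_⟩
  filter_upwards [h] with x hx
  simp only [Pi.add_apply, Pi.smul_apply, smul_eq_mul] at hx
  linear_combination hx

theorem hasDerivAt_sinh_mul (z : ℂ) (x : ℝ) :
    HasDerivAt (fun x : ℝ => Complex.sinh (z * x)) (z * Complex.cosh (z * x)) x := by
  have h := ((hasDerivAt_id (x : ℂ)).const_mul z).csinh.comp_ofReal
  refine h.congr_deriv ?_
  simp [mul_comm]

theorem hasDerivAt_cosh_mul (z : ℂ) (x : ℝ) :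
    HasDerivAt (fun x : ℝ => Complex.cosh (z * x)) (z * Complex.sinh (z * x)) x := by
  have h := ((hasDerivAt_id (x : ℂ)).const_mul z).ccosh.comp_ofReal
  refine h.congr_deriv ?_
  simp [mul_comm]

/-- The solution of `w'' = z² w + 2 z k sinh(z x)`, `w(0) = 0`, with parameter `m`. -/
def waveSol (z m k : ℂ) (x : ℝ) : ℂ :=
  m * Complex.sinh (z * x) + k * (x * Complex.cosh (z * x))

/-- The derivative of `waveSol`. -/
def waveSol₁ (z m k : ℂ) (x : ℝ) : ℂ :=
  m * (z * Complex.cosh (z * x)) + k * (Complex.cosh (z * x) + x * (z * Complex.sinh (z * x)))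

/-- The second derivative of `waveSol`. -/
def waveSol₂ (z m k : ℂ) (x : ℝ) : ℂ :=
  z ^ 2 * waveSol z m k x + 2 * z * k * Complex.sinh (z * x)

theorem hasDerivAt_waveSol (z m k : ℂ) (x : ℝ) :
    HasDerivAt (waveSol z m k) (waveSol₁ z m k x) x := by
  have h1 := ((hasDerivAt_id (x : ℂ)).comp_ofReal).mul (hasDerivAt_cosh_mul z x)
  refine (((hasDerivAt_sinh_mul z x).const_mul m).add (h1.const_mul k)).congr_deriv ?_
  simp [waveSol₁]

theorem hasDerivAt_waveSol₁ (z m k : ℂ) (x : ℝ) :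
    HasDerivAt (waveSol₁ z m k) (waveSol₂ z m k x) x := by
  have h1 := ((hasDerivAt_id (x : ℂ)).comp_ofReal).mul ((hasDerivAt_sinh_mul z x).const_mul z)
  refine ((((hasDerivAt_cosh_mul z x).const_mul z).const_mul m).add
    (((hasDerivAt_cosh_mul z x).add h1).const_mul k)).congr_deriv ?_
  simp [waveSol₂, waveSol]
  ring

theorem continuous_waveSol (z m k : ℂ) : Continuous (waveSol z m k) :=
  continuous_iff_continuousAt.mpr fun x => (hasDerivAt_waveSol z m k x).continuousAt

theorem continuous_waveSol₁ (z m k : ℂ) : Continuous (waveSol₁ z m k) :=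
  continuous_iff_continuousAt.mpr fun x => (hasDerivAt_waveSol₁ z m k x).continuousAt

theorem continuous_waveSol₂ (z m k : ℂ) : Continuous (waveSol₂ z m k) := by
  have := continuous_waveSol z m k
  unfold waveSol₂
  fun_prop

theorem continuous_sub_left (L : ℝ) : Continuous fun x : ℝ => L - x := by fun_prop

theorem hasDerivAt_waveSol_reflect (L : ℝ) (z m k : ℂ) (x : ℝ) :
    HasDerivAt (fun x => waveSol z m k (L - x)) (-waveSol₁ z m k (L - x)) x :=
  HasDerivAt.comp_const_sub (f := waveSol z m k) L x (hasDerivAt_waveSol z m k (L - x))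

theorem hasDerivAt_waveSol₁_reflect (L : ℝ) (z m k : ℂ) (x : ℝ) :
    HasDerivAt (fun x => -waveSol₁ z m k (L - x)) (waveSol₂ z m k (L - x)) x := by
  exact (HasDerivAt.comp_const_sub (f := waveSol₁ z m k) L x
    (hasDerivAt_waveSol₁ z m k (L - x))).fun_neg.congr_deriv (neg_neg _)

/-- The solutions of the (possibly inhomogeneous) eigenvalue equation. -/
theorem InDomain.exists_waveSol (ha : a ∈ Ioo 0 L) (hz : z ≠ 0) (hdom : InDomain L a α v w)
    (hsec : IsSecondDeriv L a w p) {c k : ℂ}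
    (hp : p =ᵐ[vol 0 L] fun x => z * v x + c * z *
      glue a (waveSol z 1 0) (fun x => waveSol z k 0 (L - x)) x)
    (hv : v =ᵐ[vol 0 L] fun x => z * w x + c *
      glue a (waveSol z 1 0) (fun x => waveSol z k 0 (L - x)) x) :
    ∃ m₁ m₂ : ℂ, w =ᵐ[vol 0 a] waveSol z m₁ c ∧
      w =ᵐ[vol a L] (fun x => waveSol z m₂ (c * k) (L - x)) ∧
      z * waveSol z m₁ c a + c * waveSol z 1 0 a =
        z * waveSol z m₂ (c * k) (L - a) + c * waveSol z k 0 (L - a) ∧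
      -waveSol₁ z m₂ (c * k) (L - a) - waveSol₁ z m₁ c a =
        α * (z * waveSol z m₁ c a + c * waveSol z 1 0 a) := by
  obtain ⟨ha0, haL⟩ := ha
  set w₀ := glue a (waveSol z 1 0) (fun x => waveSol z k 0 (L - x)) with hw₀
  have l0 : ∀ᵐ x ∂vol 0 a, w₀ x = waveSol z 1 0 x := by
    filter_upwards [ae_restrict_mem measurableSet_Ioo] with x hx
    simp only [hw₀, glue, if_pos hx.2]
  have r0 : ∀ᵐ x ∂vol a L, w₀ x = waveSol z k 0 (L - x) := by
    filter_upwards [ae_restrict_mem measurableSet_Ioo] with x hx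
    simp only [hw₀, glue, if_neg (not_lt.mpr hx.1.le)]
  have mL : vol 0 a ≤ vol 0 L := vol_mono le_rfl haL.le
  have mR : vol a L ≤ vol 0 L := vol_mono ha0.le le_rfl
  have hpl := ae_mono mL hp
  have hpr := ae_mono mR hp
  have hvl := ae_mono mL hv
  have hvr := ae_mono mR hv
  -- Here `c = 0` gives eigenvectors, while general `c` means that `(T - z)U` is `c` times the glued
  -- eigenvector `(z w₀, w₀)`. Inserting `v` in the equation for `p` gives forcing `2 z c w₀`, for
  -- which `waveSol z 0 c` is a particular solution on the left.
  obtain ⟨m, n, hmn⟩ := exists_exp_add_particular ha0 hz hsec.1 (hasDerivAt_waveSol z 0 c)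
    (hasDerivAt_waveSol₁ z 0 c) (continuous_waveSol₂ z 0 c) (by
      filter_upwards [hpl, hvl, l0] with x h1 h2 h3
      rw [h1, h2, h3]
      simp only [waveSol₂, waveSol]
      ring)
  have hn : n = -m := by
    have hc : Continuous fun x : ℝ => m * Complex.exp (z * x) + n * Complex.exp (-(z * x)) +
        waveSol z 0 c x := by
      have := continuous_waveSol z 0 c
      fun_prop
    have := HasTrace.eq_right hc hmn ha0 hdom.w_mem.2.1
    simp [waveSol] at this
    linear_combination -this
  have hwl : w =ᵐ[vol 0 a] waveSol z (2 * m) c := by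
    filter_upwards [hmn] with x hx
    rw [hx, hn]
    simp only [waveSol, Complex.sinh]
    ring
  obtain ⟨m', n', hmn'⟩ := exists_exp_add_particular haL hz hsec.2
    (hasDerivAt_waveSol_reflect L z 0 (c * k)) (hasDerivAt_waveSol₁_reflect L z 0 (c * k))
    ((continuous_waveSol₂ z 0 (c * k)).comp (continuous_sub_left L)) (by
      filter_upwards [hpr, hvr, r0] with x h1 h2 h3
      rw [h1, h2, h3]
      simp only [waveSol₂, waveSol]
      ring)
  -- The condition at `L` ties the two exponentials together, leaving a multiple of `sinh (z(L -
  -- x))`; on the left the condition at `0` did the same for `sinh (z x)`.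
  have hn' : n' = -m' * Complex.exp (z * L) ^ 2 := by
    have hc : Continuous fun x : ℝ => m' * Complex.exp (z * x) + n' * Complex.exp (-(z * x)) +
        waveSol z 0 (c * k) (L - x) := by
      have := (continuous_waveSol z 0 (c * k)).comp (continuous_sub_left L)
      simp only [Function.comp_def] at this
      fun_prop
    have := HasTrace.eq_left hc hmn' haL hdom.w_mem.2.2
    simp only [waveSol, sub_self, Complex.ofReal_zero, mul_zero, zero_mul, add_zero,
      Complex.exp_neg] at this
    field_simp at this
    linear_combination -this
  have hwr : w =ᵐ[vol a L] fun x => waveSol z (-2 * m' * Complex.exp (z * L)) (c * k) (L - x) := by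
    filter_upwards [hmn'] with x hx
    rw [hx, hn']
    have e1 : Complex.exp (z * (L - x : ℝ)) = Complex.exp (z * L) * Complex.exp (-(z * x)) := by
      rw [← Complex.exp_add]
      push_cast
      ring_nf
    have e2 : Complex.exp (-(z * (L - x : ℝ))) = (Complex.exp (z * L))⁻¹ * Complex.exp (z * x) := by
      rw [← Complex.exp_neg, ← Complex.exp_add]
      push_cast
      ring_nf
    simp only [waveSol, Complex.sinh, e1, e2]
    field_simp
    ring
  refine ⟨_, _, hwl, hwr, ?_⟩
  obtain ⟨w', y₁, y₂, y, hw', hy₁, hy₂, hy, hjump⟩ := hdom.jump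
  have hl' := (hw'.mono le_rfl haL.le).unique ((hasWeakDeriv_of_hasDerivAt ha0.le
    (hasDerivAt_waveSol z (2 * m) c) (continuous_waveSol₁ _ _ _)).congr hwl.symm .rfl)
  have hr' := (hw'.mono ha0.le le_rfl).unique ((hasWeakDeriv_of_hasDerivAt haL.le
    (hasDerivAt_waveSol_reflect L z (-2 * m' * Complex.exp (z * L)) (c * k))
    ((continuous_waveSol₁ _ _ _).comp (continuous_sub_left L)).neg).congr hwr.symm .rfl)
  have ey₁ := hy₁.eq_left (continuous_waveSol₁ _ _ _) hl' ha0
  have ey₂ := hy₂.eq_right ((continuous_waveSol₁ _ _ _).comp (continuous_sub_left L)).neg hr' haL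
  have hvl' : v =ᵐ[vol 0 a] fun x => z * waveSol z (2 * m) c x + c * waveSol z 1 0 x := by
    filter_upwards [hvl, hwl, l0] with x h1 h2 h3
    rw [h1, h2, h3]
  have hvr' : v =ᵐ[vol a L] fun x => z * waveSol z (-2 * m' * Complex.exp (z * L)) (c * k) (L - x) +
      c * waveSol z k 0 (L - x) := by
    filter_upwards [hvr, hwr, r0] with x h1 h2 h3
    rw [h1, h2, h3]
  have eyl := (hy.mono nhdsWithin_le_nhds).eq_left
    (((continuous_waveSol z (2 * m) c).const_mul z).add ((continuous_waveSol z 1 0).const_mul c))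
    hvl' ha0
  have eyr := (hy.mono nhdsWithin_le_nhds).eq_right
    ((((continuous_waveSol z (-2 * m' * Complex.exp (z * L)) (c * k)).comp
      (continuous_sub_left L)).const_mul z).add
      (((continuous_waveSol z k 0).comp (continuous_sub_left L)).const_mul c)) hvr' haL
  refine ⟨eyl.symm.trans eyr, ?_⟩
  rw [ey₁, ey₂, eyl] at hjump
  exact hjump

/-- There are no nonzero solutions for the spectral parameter `0`. -/
theorem InDomain.ae_eq_zero (ha : a ∈ Ioo 0 L) (hdom : InDomain L a α v w)
    (hsec : IsSecondDeriv L a w p) (hp : p =ᵐ[vol 0 L] 0) (hv : v =ᵐ[vol 0 L] 0) :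
    w =ᵐ[vol 0 L] 0 := by
  obtain ⟨ha0, haL⟩ := ha
  obtain ⟨w', y₁, y₂, y, hw', hy₁, hy₂, hy, hjump⟩ := hdom.jump
  have mL : vol 0 a ≤ vol 0 L := vol_mono le_rfl haL.le
  have mR : vol a L ≤ vol 0 L := vol_mono ha0.le le_rfl
  obtain ⟨g₁, hg₁, hg₁'⟩ := hsec.1
  obtain ⟨g₂, hg₂, hg₂'⟩ := hsec.2
  obtain ⟨C₁, hC₁⟩ := (hg₁'.congr .rfl (ae_mono mL hp)).exists_const ha0
  obtain ⟨C₂, hC₂⟩ := (hg₂'.congr .rfl (ae_mono mR hp)).exists_const haL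
  have h1 : w' =ᵐ[vol 0 a] fun _ => C₁ := ((hw'.mono le_rfl haL.le).unique hg₁).trans hC₁
  have h2 : w' =ᵐ[vol a L] fun _ => C₂ := ((hw'.mono ha0.le le_rfl).unique hg₂).trans hC₂
  have e1 := hy₁.eq_left continuous_const h1 ha0
  have e2 := hy₂.eq_right continuous_const h2 haL
  have e3 := (hy.mono nhdsWithin_le_nhds).eq_left (F := 0) continuous_const (ae_mono mL hv) ha0
  -- As `v = 0` the jump condition is void of jump: `w'` has the same constant value on both sides,
  -- so `w` is affine and vanishes at both ends.
  have hC : C₂ = C₁ := by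
    rw [e1, e2, e3, Pi.zero_apply, mul_zero] at hjump
    exact sub_eq_zero.mp hjump
  rw [hC] at h2
  have h3 : w' =ᵐ[vol 0 L] fun _ => C₁ := ae_of_ae_of_ae h1 h2
  have hL : 0 < L := ha0.trans haL
  have hx : HasWeakDeriv 0 L (fun x => (x : ℂ)) fun _ => 1 :=
    hasWeakDeriv_of_hasDerivAt hL.le (fun x => (hasDerivAt_id (x : ℂ)).comp_ofReal) continuous_const
  obtain ⟨D, hD⟩ := ((hw'.add (hx.smul (-C₁))).congr .rfl (g' := 0) (by
    filter_upwards [h3] with x hx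
    simp [hx])).exists_const hL
  have hw : w =ᵐ[vol 0 L] fun x => C₁ * x + D := by
    filter_upwards [hD] with x hx
    simp only [Pi.add_apply, Pi.smul_apply, smul_eq_mul] at hx
    linear_combination hx
  have hc : Continuous fun x : ℝ => C₁ * x + D := by fun_prop
  have t0 := hdom.w_mem.2.1.eq_right hc hw hL
  have tL := hdom.w_mem.2.2.eq_left hc hw hL
  simp only [Complex.ofReal_zero, mul_zero, zero_add] at t0
  rw [← t0, add_zero] at tL
  have hC0 : C₁ = 0 :=
    (mul_eq_zero.mp tL.symm).resolve_right (Complex.ofReal_ne_zero.mpr hL.ne')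
  filter_upwards [hw] with x hx
  rw [hx, hC0, ← t0]
  simp

/-- The glued solution is in the domain if it satisfies the transmission conditions. -/
theorem inDomain_glue (ha : a ∈ Ioo 0 L) {k : ℂ}
    (hcont : waveSol z 1 0 a = waveSol z k 0 (L - a))
    (hjump : -waveSol₁ z k 0 (L - a) - waveSol₁ z 1 0 a = α * (z * waveSol z 1 0 a)) :
    InDomain L a α (z • glue a (waveSol z 1 0) (fun x => waveSol z k 0 (L - x)))
      (glue a (waveSol z 1 0) (fun x => waveSol z k 0 (L - x))) ∧
    IsSecondDeriv L a (glue a (waveSol z 1 0) (fun x => waveSol z k 0 (L - x)))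
      (z ^ 2 • glue a (waveSol z 1 0) (fun x => waveSol z k 0 (L - x))) := by
  obtain ⟨ha0, haL⟩ := ha
  set w₀ := glue a (waveSol z 1 0) (fun x => waveSol z k 0 (L - x)) with hw₀
  set w₁ := glue a (waveSol₁ z 1 0) (fun x => -waveSol₁ z k 0 (L - x)) with hw₁
  have l0 : ∀ᵐ x ∂vol 0 a, w₀ x = waveSol z 1 0 x := by
    filter_upwards [ae_restrict_mem measurableSet_Ioo] with x hx
    simp only [hw₀, glue, if_pos hx.2]
  have r0 : ∀ᵐ x ∂vol a L, w₀ x = waveSol z k 0 (L - x) := by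
    filter_upwards [ae_restrict_mem measurableSet_Ioo] with x hx
    simp only [hw₀, glue, if_neg (not_lt.mpr hx.1.le)]
  have l1 : ∀ᵐ x ∂vol 0 a, w₁ x = waveSol₁ z 1 0 x := by
    filter_upwards [ae_restrict_mem measurableSet_Ioo] with x hx
    simp only [hw₁, glue, if_pos hx.2]
  have r1 : ∀ᵐ x ∂vol a L, w₁ x = -waveSol₁ z k 0 (L - x) := by
    filter_upwards [ae_restrict_mem measurableSet_Ioo] with x hx
    simp only [hw₁, glue, if_neg (not_lt.mpr hx.1.le)]
  have cR := (continuous_waveSol z k 0).comp (continuous_sub_left L)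
  have cR₁ := ((continuous_waveSol₁ z k 0).comp (continuous_sub_left L)).neg
  have hweak : HasWeakDeriv 0 L w₀ w₁ := hasWeakDeriv_glue ha0.le haL.le (hasDerivAt_waveSol z 1 0)
    (hasDerivAt_waveSol_reflect L z k 0) (continuous_waveSol₁ z 1 0) cR₁ hcont
  have hH10 : MemH10 0 L w₀ := by
    refine ⟨⟨w₁, hweak⟩, ?_, ?_⟩
    · have := hasTrace_of_ae_eq (l := 𝓝[>] 0) (continuous_waveSol z 1 0) l0 nhdsWithin_le_nhds
        (Ioo_mem_nhdsGT ha0)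
      simpa [waveSol] using this
    · have := hasTrace_of_ae_eq (l := 𝓝[<] L) cR r0 nhdsWithin_le_nhds (Ioo_mem_nhdsLT haL)
      simpa [waveSol] using this
  have hsec : IsSecondDeriv L a w₀ (z ^ 2 • w₀) := by
    constructor
    · refine HasWeakDeriv₂.congr (f := waveSol z 1 0) (g := waveSol₂ z 1 0)
        ⟨waveSol₁ z 1 0, hasWeakDeriv_of_hasDerivAt ha0.le (hasDerivAt_waveSol z 1 0)
          (continuous_waveSol₁ z 1 0), hasWeakDeriv_of_hasDerivAt ha0.le (hasDerivAt_waveSol₁ z 1 0)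
          (continuous_waveSol₂ z 1 0)⟩ ?_ ?_
      · filter_upwards [l0] with x hx using hx.symm
      · filter_upwards [l0] with x hx
        simp [hx, waveSol₂]
    · refine HasWeakDeriv₂.congr (f := fun x => waveSol z k 0 (L - x))
        (g := fun x => waveSol₂ z k 0 (L - x))
        ⟨fun x => -waveSol₁ z k 0 (L - x), hasWeakDeriv_of_hasDerivAt haL.le
          (hasDerivAt_waveSol_reflect L z k 0) cR₁, hasWeakDeriv_of_hasDerivAt haL.le
          (hasDerivAt_waveSol₁_reflect L z k 0)
          ((continuous_waveSol₂ z k 0).comp (continuous_sub_left L))⟩ ?_ ?_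
      · filter_upwards [r0] with x hx using hx.symm
      · filter_upwards [r0] with x hx
        simp [hx, waveSol₂]
  have hcw : Continuous w₀ := by
    have e : w₀ = fun x => if a ≤ x then waveSol z k 0 (L - x) else waveSol z 1 0 x := by
      funext x
      by_cases hx : x < a
      · simp [hw₀, glue, hx, not_le.mpr hx]
      · simp [hw₀, glue, hx, not_lt.mp hx]
    rw [e]
    exact Continuous.if_le cR (continuous_waveSol z 1 0) continuous_const continuous_id
      fun x hx => by
        have hx : a = x := hx
        rw [← hx]
        exact hcont.symm
  refine ⟨⟨hH10.smul z, hH10, ⟨_, hsec.1⟩, ⟨_, hsec.2⟩, w₁, waveSol₁ z 1 0 a,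
    -waveSol₁ z k 0 (L - a), z * waveSol z 1 0 a, hweak, ?_, ?_, ?_, hjump⟩, hsec⟩
  · exact hasTrace_of_ae_eq (continuous_waveSol₁ z 1 0) l1 nhdsWithin_le_nhds (Ioo_mem_nhdsLT ha0)
  · exact hasTrace_of_ae_eq cR₁ r1 nhdsWithin_le_nhds (Ioo_mem_nhdsGT haL)
  · have h1 : HasTrace (𝓝 a) w₀ (w₀ a) := (hcw.tendsto a).mono_left inf_le_left
    have h2 : w₀ a = waveSol z 1 0 a := by simp [hw₀, glue, hcont]
    rw [h2] at h1
    exact h1.smul z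

end Eigen


/-! ## Algebraic multiplicities -/

section RootSpace

variable {V : Type*} [AddCommGroup V] [Module ℂ V] {T : V →ₗ.[ℂ] V} {z : ℂ}

theorem mem_rootSpace_succ {k : ℕ} {U : V} :
    U ∈ rootSpace T z (k + 1) ↔ ∃ h : U ∈ T.domain, T ⟨U, h⟩ - z • U ∈ rootSpace T z k := by
  simp only [rootSpace, Submodule.mem_map, Submodule.mem_comap]
  constructor
  · rintro ⟨⟨U', h⟩, h1, rfl⟩
    exact ⟨h, h1⟩
  · rintro ⟨h, h1⟩
    exact ⟨⟨U, h⟩, h1, rfl⟩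

/-- Each root space is determined by the preceding one, so the chain is stationary once it stalls.
-/
theorem rootSpace_succ_eq_of_eq {n : ℕ} (h : rootSpace T z (n + 1) = rootSpace T z n) (k : ℕ) :
    rootSpace T z (n + k) = rootSpace T z n := by
  induction k with
  | zero => rfl
  | succ k ih =>
    rw [← h]
    ext U
    rw [← add_assoc, mem_rootSpace_succ, mem_rootSpace_succ, ih]

theorem algMultiplicity_eq_zero (h : rootSpace T z 1 = ⊥) : algMultiplicity T z = 0 := by
  have h0 : ∀ k, rootSpace T z k = ⊥ := fun k => by
    have := rootSpace_succ_eq_of_eq (n := 0) (h.trans rfl) k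
    rwa [zero_add] at this
  have h1 : (⨆ k, rootSpace T z k) = ⊥ := by
    rw [iSup_congr h0, iSup_const]
  unfold algMultiplicity
  rw [h1]
  simp

theorem algMultiplicity_eq_one {u : V} (hu : u ≠ 0)
    (h1 : rootSpace T z 1 = Submodule.span ℂ {u}) (h2 : rootSpace T z 2 ≤ rootSpace T z 1) :
    algMultiplicity T z = 1 := by
  have h12 : rootSpace T z 1 ≤ rootSpace T z 2 := fun U hU => by
    obtain ⟨h, hU'⟩ := mem_rootSpace_succ.mp hU
    refine mem_rootSpace_succ.mpr ⟨h, ?_⟩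
    rw [show T ⟨U, h⟩ - z • U = 0 from hU']
    exact zero_mem _
  have h0 : (⨆ k, rootSpace T z k) = Submodule.span ℂ {u} := by
    refine le_antisymm (iSup_le fun k => ?_) (h1 ▸ le_iSup (rootSpace T z) 1)
    cases k with
    | zero => exact bot_le
    | succ k =>
      rw [add_comm, rootSpace_succ_eq_of_eq (n := 1) (le_antisymm h2 h12), h1]
  unfold algMultiplicity
  rw [h0]
  have h3 : Module.finrank ℂ (Submodule.span ℂ {u}) = 1 := finrank_span_singleton hu
  rw [← Module.finrank_eq_rank, h3]
  simp

end RootSpace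

/-! ### The characteristic function and the multiplicities of the wave operator -/

section Multiplicity

variable {L a : ℝ} {α z : ℂ}

/-- The characteristic function of the damped wave operator. -/
def charFun (L a : ℝ) (α z : ℂ) : ℂ :=
  Complex.sinh (z * a) * Complex.cosh (z * (L - a : ℝ)) +
    Complex.cosh (z * a) * Complex.sinh (z * (L - a : ℝ)) +
    α * (Complex.sinh (z * a) * Complex.sinh (z * (L - a : ℝ)))

/-- The derivative of the characteristic function. -/
def charDeriv (L a : ℝ) (α z : ℂ) : ℂ :=
  a * (Complex.cosh (z * a) * Complex.cosh (z * (L - a : ℝ)) +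
    Complex.sinh (z * a) * Complex.sinh (z * (L - a : ℝ)) +
    α * (Complex.cosh (z * a) * Complex.sinh (z * (L - a : ℝ)))) +
  (L - a : ℝ) * (Complex.sinh (z * a) * Complex.sinh (z * (L - a : ℝ)) +
    Complex.cosh (z * a) * Complex.cosh (z * (L - a : ℝ)) +
    α * (Complex.sinh (z * a) * Complex.cosh (z * (L - a : ℝ))))

theorem hasDerivAt_charFun (L a : ℝ) (α z : ℂ) :
    HasDerivAt (charFun L a α) (charDeriv L a α z) z := by
  have hs : ∀ b : ℝ, HasDerivAt (fun z : ℂ => Complex.sinh (z * b)) (Complex.cosh (z * b) * b) z :=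
    fun b => by simpa using ((hasDerivAt_id z).mul_const (b : ℂ)).csinh
  have hc : ∀ b : ℝ, HasDerivAt (fun z : ℂ => Complex.cosh (z * b)) (Complex.sinh (z * b) * b) z :=
    fun b => by simpa using ((hasDerivAt_id z).mul_const (b : ℂ)).ccosh
  refine ((((hs a).mul (hc (L - a))).add ((hc a).mul (hs (L - a)))).add
    (((hs a).mul (hs (L - a))).const_mul α)).congr_deriv ?_
  simp only [charDeriv]
  ring

theorem waveOperator_sub_smul_spec (ha : a ∈ Ioo 0 L) {U R : StateSpace L}
    (hU : U ∈ (waveOperator ha α).domain) (h : waveOperator ha α ⟨U, hU⟩ - z • U = R) :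
    ∃ p : ℝ → ℂ, IsSecondDeriv L a U.2 p ∧ (p =ᵐ[vol 0 L] fun x => z * U.1 x + R.1 x) ∧
      (U.1 =ᵐ[vol 0 L] fun x => z * (U.2 : L2 L) x + (R.2 : L2 L) x) := by
  refine ⟨secondDeriv ha ⟨U, hU⟩, secondDeriv_spec ha ⟨U, hU⟩, ?_, ?_⟩
  · have h1 : secondDeriv ha ⟨U, hU⟩ = z • U.1 + R.1 := by
      have := congrArg Prod.fst h
      rw [← this]
      exact (add_sub_cancel _ _).symm
    rw [h1]
    filter_upwards [Lp.coeFn_add (z • U.1) R.1, Lp.coeFn_smul z U.1] with x hx hx'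
    rw [hx, Pi.add_apply, hx', Pi.smul_apply, smul_eq_mul]
  · have h1 : U.1 = z • (U.2 : L2 L) + (R.2 : L2 L) := by
      have := congrArg (fun V : StateSpace L => (V.2 : L2 L)) h
      rw [← this]
      exact (add_sub_cancel _ _).symm
    have h2 := Lp.coeFn_add (z • (U.2 : L2 L)) (R.2 : L2 L)
    rw [← h1] at h2
    filter_upwards [h2, Lp.coeFn_smul z (U.2 : L2 L)] with x hx hx'
    rw [hx, Pi.add_apply, hx', Pi.smul_apply, smul_eq_mul]

theorem InDomain.exists_mem (ha : a ∈ Ioo 0 L) {v w : ℝ → ℂ} (h : InDomain L a α v w) :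
    ∃ U ∈ (waveOperator ha α).domain, (U.1 : ℝ → ℂ) =ᵐ[vol 0 L] v ∧
      ((U.2 : L2 L) : ℝ → ℂ) =ᵐ[vol 0 L] w := by
  obtain ⟨v', hv'⟩ := h.v_mem.1
  obtain ⟨w', hw'⟩ := h.w_mem.1
  have ev := hv'.memLp.coeFn_toLp
  have ew := hw'.memLp.coeFn_toLp
  exact ⟨(hv'.memLp.toLp v, ⟨hw'.memLp.toLp w, h.w_mem.1.congr ew.symm⟩),
    h.congr ha ev.symm ew.symm, ev, ew⟩

/-- Eliminating the right amplitude `m₂` from continuity and jump at `a` leaves `m₁ * charFun = 0`.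
-/
theorem algMultiplicity_waveOperator_eq_zero (ha : a ∈ Ioo 0 L) (h : z = 0 ∨ charFun L a α z ≠ 0) :
    algMultiplicity (waveOperator ha α) z = 0 := by
  refine algMultiplicity_eq_zero ((Submodule.eq_bot_iff _).mpr fun U hU => ?_)
  obtain ⟨hdom, hU0⟩ := mem_rootSpace_succ.mp hU
  obtain ⟨p, hsec, hp, hv⟩ := waveOperator_sub_smul_spec (R := 0) ha hdom hU0
  have z1 := Lp.coeFn_zero ℂ 2 (vol 0 L)
  have hp : p =ᵐ[vol 0 L] fun x => z * U.1 x := by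
    filter_upwards [hp, z1] with x h1 h2
    rw [h1]
    simpa using h2
  have hv : U.1 =ᵐ[vol 0 L] fun x => z * (U.2 : L2 L) x := by
    filter_upwards [hv, z1] with x h1 h2
    rw [h1]
    simpa using h2
  have hw : ((U.2 : L2 L) : ℝ → ℂ) =ᵐ[vol 0 L] 0 := by
    by_cases hz : z = 0
    · refine InDomain.ae_eq_zero ha hdom hsec (hp.trans ?_) (hv.trans ?_) <;>
        exact Eventually.of_forall fun x => by simp [hz]
    have hF := h.resolve_left hz
    obtain ⟨m₁, m₂, hl, hr, e1, e2⟩ := InDomain.exists_waveSol ha hz hdom hsec (c := 0) (k := 0)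
      (by simpa using hp) (by simpa using hv)
    simp only [waveSol, waveSol₁, zero_mul, mul_zero, add_zero] at e1 e2
    have e1 := mul_left_cancel₀ hz e1
    have e2 : m₂ * Complex.cosh (z * (L - a : ℝ)) + m₁ * Complex.cosh (z * a) +
        α * (m₁ * Complex.sinh (z * a)) = 0 := mul_left_cancel₀ hz (by linear_combination -e2)
    have hm₁ : m₁ = 0 := by
      refine (mul_eq_zero (b := charFun L a α z).mp ?_).resolve_right hF
      unfold charFun
      linear_combination Complex.cosh (z * (L - a : ℝ)) * e1 + Complex.sinh (z * (L - a : ℝ)) * e2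
    have hm₂ : m₂ = 0 := by
      rw [hm₁] at e1 e2
      linear_combination Complex.cosh (z * (L - a : ℝ)) * e2 +
        Complex.sinh (z * (L - a : ℝ)) * e1 - m₂ * Complex.cosh_sq_sub_sinh_sq (z * (L - a : ℝ))
    refine ae_of_ae_of_ae (hl.trans ?_) (hr.trans ?_) <;>
      exact Eventually.of_forall fun x => by simp [hm₁, hm₂, waveSol]
  have hv0 : (U.1 : ℝ → ℂ) =ᵐ[vol 0 L] 0 := by
    filter_upwards [hv, hw] with x h1 h2
    rw [h1, h2]
    simp
  exact Prod.ext (Lp.eq_zero_iff_ae_eq_zero.mpr hv0)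
    (Subtype.ext (Lp.eq_zero_iff_ae_eq_zero.mpr hw))

/-- Eigenvectors are multiples of one glued solution `u`. If `(T - z)U = c u`, the transmission
conditions reduce to `c * charDeriv = 0`, so a simple zero admits no longer chain. -/
theorem algMultiplicity_waveOperator_eq_one (ha : a ∈ Ioo 0 L) (hz : z ≠ 0)
    (hF : charFun L a α z = 0) (hF' : charDeriv L a α z ≠ 0) :
    algMultiplicity (waveOperator ha α) z = 1 := by
  have hcs := Complex.cosh_sq_sub_sinh_sq (z * (L - a : ℝ))
  -- The amplitude `k` on the right is the quotient of the `sinh` values at `a`. If `sinh (z(L -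
  -- a))` vanishes then so does `sinh (z a)`, and the derivative condition fixes `k` instead.
  obtain ⟨k, k1, k2⟩ : ∃ k, Complex.sinh (z * a) = k * Complex.sinh (z * (L - a : ℝ)) ∧
      Complex.cosh (z * a) + k * Complex.cosh (z * (L - a : ℝ)) + α * Complex.sinh (z * a) = 0 := by
    unfold charFun at hF
    by_cases hs : Complex.sinh (z * (L - a : ℝ)) = 0
    · have hc : Complex.cosh (z * (L - a : ℝ)) ≠ 0 := fun hc => by
        rw [hs, hc] at hcs
        simp at hcs
      have hs' : Complex.sinh (z * a) = 0 := by
        rw [hs, mul_zero, mul_zero, mul_zero, add_zero, add_zero] at hF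
        exact (mul_eq_zero.mp hF).resolve_right hc
      exact ⟨-Complex.cosh (z * a) / Complex.cosh (z * (L - a : ℝ)), by rw [hs, hs', mul_zero],
        by rw [hs']; field_simp; ring⟩
    · refine ⟨Complex.sinh (z * a) / Complex.sinh (z * (L - a : ℝ)), by field_simp, ?_⟩
      field_simp
      linear_combination hF
  obtain ⟨hdom₀, hsec₀⟩ := inDomain_glue (z := z) (α := α) (k := k) ha
    (by simpa [waveSol] using k1)
    (by simp only [waveSol, waveSol₁]; linear_combination -z * k2)
  set w₀ := glue a (waveSol z 1 0) (fun x => waveSol z k 0 (L - x)) with hw₀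
  have l0 : ∀ᵐ x ∂vol 0 a, w₀ x = waveSol z 1 0 x := by
    filter_upwards [ae_restrict_mem measurableSet_Ioo] with x hx
    simp only [hw₀, glue, if_pos hx.2]
  have r0 : ∀ᵐ x ∂vol a L, w₀ x = waveSol z k 0 (L - x) := by
    filter_upwards [ae_restrict_mem measurableSet_Ioo] with x hx
    simp only [hw₀, glue, if_neg (not_lt.mpr hx.1.le)]
  obtain ⟨u, hu, hu1, hu2⟩ := hdom₀.exists_mem ha
  have hu0 : u ≠ 0 := fun h0 => by
    have h1 : w₀ =ᵐ[vol 0 a] 0 := by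
      refine ae_mono (vol_mono le_rfl ha.2.le) ?_
      filter_upwards [hu2, Lp.coeFn_zero ℂ 2 (vol 0 L)] with x hx hx'
      rw [← hx, h0]
      exact hx'
    -- A vanishing eigenvector would make the derivative of `sinh (z x)` vanish almost everywhere,
    -- contradicting its value `z` at `0`.
    have h2 : waveSol z 1 0 =ᵐ[vol 0 a] 0 := (EventuallyEq.symm l0).trans h1
    have h3 := ((hasWeakDeriv_of_hasDerivAt ha.1.le (hasDerivAt_waveSol z 1 0)
      (continuous_waveSol₁ z 1 0)).congr h2 .rfl).unique (HasWeakDeriv.zero 0 a)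
    have t0 : HasTrace (𝓝[>] 0) 0 0 := tendsto_const_nhds
    have := t0.eq_right (continuous_waveSol₁ z 1 0) h3.symm ha.1
    simp [waveSol₁] at this
    exact hz this.symm
  -- With `c = 0` this identifies the eigenspace; with arbitrary `c` it excludes root vectors of
  -- second order.
  have key : ∀ (U : StateSpace L) (hU : U ∈ (waveOperator ha α).domain) (c : ℂ),
      waveOperator ha α ⟨U, hU⟩ - z • U = c • u → c = 0 ∧ ∃ m : ℂ, m • u = U := by
    intro U hU c hc
    obtain ⟨p, hsec, hp, hv⟩ := waveOperator_sub_smul_spec ha hU hc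
    have hp : p =ᵐ[vol 0 L] fun x => z * U.1 x + c * z * w₀ x := by
      filter_upwards [hp, hu1, Lp.coeFn_smul c u.1] with x h1 h2 h3
      have h3 : (c • u).1 x = c * u.1 x := h3
      rw [h1, h3, h2, Pi.smul_apply, smul_eq_mul, mul_assoc]
    have hv : U.1 =ᵐ[vol 0 L] fun x => z * (U.2 : L2 L) x + c * w₀ x := by
      filter_upwards [hv, hu2, Lp.coeFn_smul c (u.2 : L2 L)] with x h1 h2 h3
      have h3 : ((c • u).2 : L2 L) x = c * (u.2 : L2 L) x := h3
      rw [h1, h3, h2]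
    obtain ⟨m₁, m₂, hl, hr, e1, e2⟩ := InDomain.exists_waveSol ha hz hU hsec hp hv
    simp only [waveSol, waveSol₁] at e1 e2
    have e1 : m₁ * Complex.sinh (z * a) + c * (a * Complex.cosh (z * a)) =
        m₂ * Complex.sinh (z * (L - a : ℝ)) +
        c * k * ((L - a : ℝ) * Complex.cosh (z * (L - a : ℝ))) :=
      mul_left_cancel₀ hz (by linear_combination e1 - c * k1)
    have e2 : m₂ * Complex.cosh (z * (L - a : ℝ)) + m₁ * (Complex.cosh (z * a) +
        α * Complex.sinh (z * a)) + c * (a * Complex.sinh (z * a) +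
        k * ((L - a : ℝ) * Complex.sinh (z * (L - a : ℝ))) + α * a * Complex.cosh (z * a)) = 0 :=
      mul_left_cancel₀ hz (by linear_combination -e2 - c * k2)
    have hc0 : c = 0 := by
      refine (mul_eq_zero (b := charDeriv L a α z).mp ?_).resolve_right hF'
      unfold charFun at hF
      unfold charDeriv
      linear_combination Complex.cosh (z * (L - a : ℝ)) * e1 + Complex.sinh (z * (L - a : ℝ)) * e2
        - m₁ * hF + c * (L - a : ℝ) * (Complex.cosh (z * (L - a : ℝ)) * k2 +
          Complex.sinh (z * (L - a : ℝ)) * k1)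
    refine ⟨hc0, m₁, ?_⟩
    rw [hc0, k1] at e1
    rw [hc0] at e2
    have hm₂ : m₂ = k * m₁ := by
      linear_combination Complex.cosh (z * (L - a : ℝ)) * e2 + Complex.sinh (z * (L - a : ℝ)) * e1
        - m₁ * Complex.cosh (z * (L - a : ℝ)) * k2 - (m₂ - k * m₁) * hcs
    have hw : ((U.2 : L2 L) : ℝ → ℂ) =ᵐ[vol 0 L] fun x => m₁ * w₀ x := by
      refine ae_of_ae_of_ae (a := a) ?_ ?_
      · filter_upwards [hl, l0] with x h1 h2
        rw [h1, h2, hc0]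
        simp [waveSol]
      · filter_upwards [hr, r0] with x h1 h2
        rw [h1, h2, hc0, hm₂]
        simp only [waveSol]
        ring
    refine Prod.ext (Lp.ext ?_) (Subtype.ext (Lp.ext ?_))
    · filter_upwards [hv, hw, hu1, Lp.coeFn_smul m₁ u.1] with x h1 h2 h3 h4
      have h4 : (m₁ • u).1 x = m₁ * u.1 x := h4
      rw [h4, h1, h2, h3, hc0, Pi.smul_apply, smul_eq_mul]
      ring
    · filter_upwards [hw, hu2, Lp.coeFn_smul m₁ (u.2 : L2 L)] with x h2 h3 h4
      have h4 : ((m₁ • u).2 : L2 L) x = m₁ * (u.2 : L2 L) x := h4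
      rw [h4, h2, h3]
  have hu' : u ∈ rootSpace (waveOperator ha α) z 1 := by
    refine mem_rootSpace_succ.mpr ⟨hu, ?_⟩
    have hs := secondDeriv_spec ha ⟨u, hu⟩
    have hq := hs.unique (hsec₀.congr ha hu2.symm .rfl)
    refine sub_eq_zero.mpr (Prod.ext (Lp.ext ?_) (Subtype.ext (Lp.ext ?_)))
    · filter_upwards [hq, hu1, Lp.coeFn_smul z u.1] with x h1 h2 h3
      have h3 : (z • u).1 x = z * u.1 x := h3
      have h1 : (waveOperator ha α ⟨u, hu⟩).1 x = _ := h1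
      rw [h1, h3, h2]
      simp only [Pi.smul_apply, smul_eq_mul]
      ring
    · filter_upwards [hu1, hu2, Lp.coeFn_smul z (u.2 : L2 L)] with x h1 h2 h3
      have h3 : ((z • u).2 : L2 L) x = z * (u.2 : L2 L) x := h3
      rw [h3, h2]
      exact h1
  have h1 : rootSpace (waveOperator ha α) z 1 = Submodule.span ℂ {u} := by
    refine le_antisymm (fun U hU => ?_) ((Submodule.span_singleton_le_iff_mem _ _).mpr hu')
    obtain ⟨hU', h0⟩ := mem_rootSpace_succ.mp hU
    exact Submodule.mem_span_singleton.mpr (key U hU' 0 (by rw [zero_smul]; exact h0)).2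
  refine algMultiplicity_eq_one hu0 h1 fun U hU => ?_
  obtain ⟨hU', h0⟩ := mem_rootSpace_succ.mp hU
  rw [h1, Submodule.mem_span_singleton] at h0
  obtain ⟨c, hc⟩ := h0
  rw [h1]
  exact Submodule.mem_span_singleton.mpr (key U hU' c hc.symm).2

end Multiplicity


/-! ## The eigenvalues for the damping coefficients `2` and `-2` -/

section CharPoly

variable {L a p q : ℝ}

/-- The value `2` is special: the function is `sinh(zL) + cosh(zL) - cosh(z(L - 2a))`, in which
`e^{-zL}` cancels. -/
theorem charFun_two (L a : ℝ) (z : ℂ) :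
    charFun L a 2 z =
      Complex.exp (z * L) / 2 * expPoly 2 (-1) (-1) (2 * a) (2 * (L - a)) z := by
  have h1 : Complex.exp (z * L) = Complex.exp (z * a) * Complex.exp (z * (L - a : ℝ)) := by
    rw [← Complex.exp_add]
    push_cast
    ring_nf
  have h2 : ∀ b : ℝ, Complex.exp (-((2 * b : ℝ) * z)) = (Complex.exp (z * b))⁻¹ ^ 2 := fun b => by
    rw [← Complex.exp_neg, ← Complex.exp_nat_mul]
    push_cast
    ring_nf
  simp only [charFun, expPoly, h1, h2, Complex.sinh, Complex.cosh, Complex.exp_neg]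
  have e1 := Complex.exp_ne_zero (z * a)
  have e2 := Complex.exp_ne_zero (z * (L - a : ℝ))
  generalize Complex.exp (z * a) = u at *
  generalize Complex.exp (z * (L - a : ℝ)) = v at *
  push_cast
  field_simp
  ring

theorem charFun_neg (L a : ℝ) (α z : ℂ) : charFun L a (-α) z = -charFun L a α (-z) := by
  simp only [charFun, neg_mul, Complex.sinh_neg, Complex.cosh_neg]
  ring

theorem charDeriv_neg (L a : ℝ) (α z : ℂ) : charDeriv L a (-α) z = charDeriv L a α (-z) := by
  simp only [charDeriv, neg_mul, Complex.sinh_neg, Complex.cosh_neg]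
  ring

theorem expPoly_dual_neg (z : ℂ) :
    expPoly 1 1 (-2) (q - p) q (-z) = -(Complex.exp (q * z) * expPoly 2 (-1) (-1) p q z) := by
  rw [expPoly_eq_dual, neg_neg, mul_neg, neg_neg, sub_sub_cancel, ← mul_neg]
  congr 1
  simp only [expPoly]
  push_cast
  ring

/-- At a double zero two linear equations give `e^{-pρ} = 2q/(q-p)` and `e^{-qρ} = -2p/(q-p)`. The
first has modulus above `1`, so `Re ρ < 0`, and the second should then be at least as large in
modulus, contradicting `p < q`. For `p = 2a` and `q = 2(L-a)` this inequality is `a < L/2`. -/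
theorem deriv_expPoly_ne_zero (hp : 0 < p) (hpq : p < q) {ρ : ℂ}
    (h : expPoly 2 (-1) (-1) p q ρ = 0) : deriv (expPoly 2 (-1) (-1) p q) ρ ≠ 0 := by
  intro h'
  rw [deriv_expPoly] at h'
  simp only [expPoly] at h h'
  push_cast at h h'
  set X := Complex.exp (-(p * ρ)) with hX
  set Y := Complex.exp (-(q * ρ)) with hY
  have hX' : ‖X‖ = Real.exp (-(p * ρ.re)) := by simp [hX, Complex.norm_exp]
  have hY' : ‖Y‖ = Real.exp (-(q * ρ.re)) := by simp [hY, Complex.norm_exp]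
  have hpq' : 0 < q - p := sub_pos.mpr hpq
  have eX : ((q - p : ℝ) : ℂ) * X = ((2 * q : ℝ) : ℂ) := by
    push_cast
    linear_combination -q * h - h'
  have eY : ((q - p : ℝ) : ℂ) * Y = ((-(2 * p) : ℝ) : ℂ) := by
    push_cast
    linear_combination h' + p * h
  have nX := congrArg norm eX
  have nY := congrArg norm eY
  rw [norm_mul, Complex.norm_real, Complex.norm_real, Real.norm_of_nonneg hpq'.le, hX',
    Real.norm_of_nonneg (by linarith)] at nX
  rw [norm_mul, Complex.norm_real, Complex.norm_real, Real.norm_of_nonneg hpq'.le, hY',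
    norm_neg, Real.norm_of_nonneg (by linarith)] at nY
  have h1 : 1 < Real.exp (-(p * ρ.re)) := by
    by_contra! hle
    nlinarith
  rw [Real.one_lt_exp_iff] at h1
  have hre : ρ.re < 0 := by
    by_contra! hle
    nlinarith
  have h2 : Real.exp (-(p * ρ.re)) ≤ Real.exp (-(q * ρ.re)) := Real.exp_le_exp.mpr (by nlinarith)
  nlinarith

theorem im_ne_zero_of_expPoly_eq_zero (hp : 0 < p) (hq : 0 < q) {ρ : ℂ}
    (h : expPoly 2 (-1) (-1) p q ρ = 0) (hρ : ρ ≠ 0) : ρ.im ≠ 0 := by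
  intro him
  have hre : ρ = (ρ.re : ℂ) := Complex.ext rfl (by simpa using him)
  have hx : ρ.re ≠ 0 := fun h0 => hρ (by rw [hre, h0, Complex.ofReal_zero])
  rw [hre, expPoly_ofReal, Complex.ofReal_eq_zero] at h
  unfold realExpPoly at h
  rcases hx.lt_or_gt with hx | hx
  · have h1 : 1 < Real.exp (-(p * ρ.re)) := Real.one_lt_exp_iff.mpr (by nlinarith)
    have h2 : 1 < Real.exp (-(q * ρ.re)) := Real.one_lt_exp_iff.mpr (by nlinarith)
    linarith
  · have h1 : Real.exp (-(p * ρ.re)) < 1 := Real.exp_lt_one_iff.mpr (by nlinarith)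
    have h2 : Real.exp (-(q * ρ.re)) < 1 := Real.exp_lt_one_iff.mpr (by nlinarith)
    linarith

theorem wavePoly_two (hp : 0 < p) (hpq : p < q) : WavePoly 2 (-1) (-1) p q (p + q) where
  A_pos := two_pos
  C_ne := by norm_num
  r_pos := hp
  r_lt := hpq
  sum_eq := by norm_num
  slope := by ring
  slope_pos := by linarith
  pos x hx := by
    have h1 : Real.exp (-(p * x)) < 1 := Real.exp_lt_one_iff.mpr (by nlinarith)
    have h2 : Real.exp (-(q * x)) < 1 := Real.exp_lt_one_iff.mpr (by nlinarith)
    unfold realExpPoly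
    linarith
  simple _ h := deriv_expPoly_ne_zero hp hpq h
  nonreal _ h hρ := im_ne_zero_of_expPoly_eq_zero hp (hp.trans hpq) h hρ

theorem expPoly_dual_eq_zero_iff {z : ℂ} :
    expPoly 1 1 (-2) (q - p) q z = 0 ↔ expPoly 2 (-1) (-1) p q (-z) = 0 := by
  have h := expPoly_dual_neg (p := p) (q := q) (-z)
  rw [neg_neg] at h
  simp [h, Complex.exp_ne_zero]

/-- The zeros are the negatives of those of `2 - e^{-pz} - e^{-qz}`, so simplicity and non-reality
transfer. The slope at `0` is again `p + q`, but the leading coefficient drops from `2` to `1`. -/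
theorem wavePoly_one (hp : 0 < p) (hpq : p < q) :
    WavePoly 1 1 (-2) (q - p) q (p + q) where
  A_pos := one_pos
  C_ne := by norm_num
  r_pos := sub_pos.mpr hpq
  r_lt := by linarith
  sum_eq := by norm_num
  slope := by ring
  slope_pos := by linarith
  pos x hx := by
    have h1 : Real.exp (-(q * x)) < 1 := Real.exp_lt_one_iff.mpr (by nlinarith)
    have h2 : Real.exp (-(q * x)) < Real.exp (-((q - p) * x)) := Real.exp_lt_exp.mpr (by nlinarith)
    unfold realExpPoly
    linarith
  simple ρ h := by
    have h0 := expPoly_dual_eq_zero_iff.mp h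
    have hd := deriv_expPoly_ne_zero hp hpq h0
    intro h'
    have e : expPoly 2 (-1) (-1) p q =
        fun z => -(Complex.exp (-(q * z)) * expPoly 1 1 (-2) (q - p) q (-z)) := by
      funext z
      rw [expPoly_dual_neg, mul_neg, neg_neg, ← mul_assoc, ← Complex.exp_add]
      simp
    have h1 : HasDerivAt (expPoly 1 1 (-2) (q - p) q) 0 (-(-ρ)) := by
      have := (differentiable_expPoly (A := 1) (B := 1) (C := -2) (r := q - p) (q := q) ρ).hasDerivAt
      rw [h'] at this
      rwa [neg_neg]
    have h2 : HasDerivAt (fun z : ℂ => Complex.exp (-(q * z)))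
        (Complex.exp (-(q * -ρ)) * -(q * 1)) (-ρ) := (((hasDerivAt_id _).const_mul _).neg).cexp
    have h3 := (h2.fun_mul (h1.scomp (-ρ) (hasDerivAt_neg (-ρ)))).fun_neg
    refine hd ?_
    rw [e]
    refine (HasDerivAt.congr_deriv h3 ?_).deriv
    simp [h]
  nonreal ρ h hρ := by
    have := im_ne_zero_of_expPoly_eq_zero hp (hp.trans hpq) (expPoly_dual_eq_zero_iff.mp h)
      (neg_ne_zero.mpr hρ)
    simpa using this

theorem charDeriv_two_ne_zero (ha : 0 < a) (ha2 : a < L / 2) {z : ℂ} (hz : charFun L a 2 z = 0) :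
    charDeriv L a 2 z ≠ 0 := by
  have hE : expPoly 2 (-1) (-1) (2 * a) (2 * (L - a)) z = 0 := by
    rw [charFun_two] at hz
    exact (mul_eq_zero.mp hz).resolve_left (div_ne_zero (Complex.exp_ne_zero _) two_ne_zero)
  have hd := deriv_expPoly_ne_zero (by linarith) (by linarith) hE
  have h1 : HasDerivAt (fun z : ℂ => Complex.exp (z * L) / 2)
      (Complex.exp (z * L) * (1 * L) / 2) z := (((hasDerivAt_id z).mul_const _).cexp).div_const 2
  have h2 := h1.fun_mul (differentiable_expPoly (A := 2) (B := -1) (C := -1) (r := 2 * a)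
    (q := 2 * (L - a)) z).hasDerivAt
  simp only [← charFun_two] at h2
  rw [(hasDerivAt_charFun L a 2 z).unique h2, hE, mul_zero, zero_add]
  exact mul_ne_zero (div_ne_zero (Complex.exp_ne_zero _) two_ne_zero) hd

/-- The eigenvalues are the nonzero zeros themselves of `2 - e^{-2az} - e^{-2(L-a)z}`; as a
`negZeros` set they belong to the dual polynomial. -/
theorem algMultiplicity_two (ha : a ∈ Ioo 0 L) (ha2 : a < L / 2) (z : ℂ) :
    algMultiplicity (waveOperator ha 2) z =
      (negZeros 1 1 (-2) (2 * (L - a) - 2 * a) (2 * (L - a))).indicator 1 z := by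
  have hF : charFun L a 2 z = 0 ↔ expPoly 1 1 (-2) (2 * (L - a) - 2 * a) (2 * (L - a)) (-z) = 0 := by
    rw [charFun_two, expPoly_dual_eq_zero_iff, neg_neg]
    simp [Complex.exp_ne_zero]
  by_cases hz : z ∈ negZeros 1 1 (-2) (2 * (L - a) - 2 * a) (2 * (L - a))
  · rw [indicator_of_mem hz, Pi.one_apply]
    have h0 := hF.mpr hz.1
    exact algMultiplicity_waveOperator_eq_one ha hz.2 h0 (charDeriv_two_ne_zero ha.1 ha2 h0)
  · rw [indicator_of_notMem hz]
    refine algMultiplicity_waveOperator_eq_zero ha ?_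
    by_contra! hcon
    exact hz ⟨hF.mp hcon.2, hcon.1⟩

theorem algMultiplicity_neg_two (ha : a ∈ Ioo 0 L) (ha2 : a < L / 2) (z : ℂ) :
    algMultiplicity (waveOperator ha (-2)) z =
      (negZeros 2 (-1) (-1) (2 * a) (2 * (L - a))).indicator 1 z := by
  have hF : charFun L a (-2) z = 0 ↔ expPoly 2 (-1) (-1) (2 * a) (2 * (L - a)) (-z) = 0 := by
    rw [charFun_neg, charFun_two]
    simp [Complex.exp_ne_zero]
  by_cases hz : z ∈ negZeros 2 (-1) (-1) (2 * a) (2 * (L - a))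
  · rw [indicator_of_mem hz, Pi.one_apply]
    have h0 := hF.mpr hz.1
    refine algMultiplicity_waveOperator_eq_one ha hz.2 h0 ?_
    rw [charFun_neg, neg_eq_zero] at h0
    rw [charDeriv_neg]
    exact charDeriv_two_ne_zero ha.1 ha2 h0
  · rw [indicator_of_notMem hz]
    refine algMultiplicity_waveOperator_eq_zero ha ?_
    by_contra! hcon
    exact hz ⟨hF.mp hcon.2, hcon.1⟩

theorem mem_negZeros_neg_iff {μ : ℂ} :
    -μ ∈ negZeros 1 1 (-2) (q - p) q ↔ μ ∈ negZeros 2 (-1) (-1) p q := by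
  simp only [negZeros, mem_ofPred_eq, expPoly_dual_eq_zero_iff, neg_neg, ne_eq, neg_eq_zero]

end CharPoly


/-! ## Eigenvalue sequences, branch cuts and the spectral determinant -/

section Spectral

/-- Two meromorphic functions that agree on a half-plane and are analytic at a point agree near
that point. -/
theorem eventuallyEq_of_meromorphic {f g : ℂ → ℂ} (hf : Meromorphic f) (hg : Meromorphic g)
    {x : ℝ} (h : ∀ s : ℂ, x < s.re → f s = g s) {z : ℂ} (hfz : AnalyticAt ℂ f z)
    (hgz : AnalyticAt ℂ g z) : f =ᶠ[𝓝 z] g := by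
  have hm : Meromorphic (f - g) := fun s => (hf s).sub (hg s)
  have h1 : meromorphicOrderAt (f - g) ((x + 1 : ℝ) : ℂ) = ⊤ := by
    rw [meromorphicOrderAt_eq_top_iff]
    refine Filter.Eventually.filter_mono nhdsWithin_le_nhds ?_
    filter_upwards [(isOpen_lt continuous_const Complex.continuous_re).mem_nhds
      (show x < (((x + 1 : ℝ) : ℂ)).re by simp)] with s hs
    simp [h s hs]
  have h2 : meromorphicOrderAt (f - g) z = ⊤ := by
    by_contra hne
    exact (hm.meromorphicOn (s := univ)).meromorphicOrderAt_ne_top_of_isPreconnected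
      isPreconnected_univ (mem_univ _) (mem_univ _) hne h1
  rw [(hfz.sub hgz).meromorphicOrderAt_eq] at h2
  have h3 : analyticOrderAt (f - g) z = ⊤ := by
    simpa using h2
  filter_upwards [analyticOrderAt_eq_top.mp h3] with s hs
  exact sub_eq_zero.mp hs

/-! ### Eigenvalue sequences as enumerations of the spectrum -/

section Sequence

variable {V : Type*} [AddCommGroup V] [Module ℂ V] {T : V →ₗ.[ℂ] V} {M : Set ℂ}

theorem isEigenvalueSequence_of_equiv (h : ∀ z, algMultiplicity T z = M.indicator 1 z)
    (e : ℕ ≃ M) : IsEigenvalueSequence T fun j => (e j : ℂ) := by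
  intro z
  rw [h]
  by_cases hz : z ∈ M
  · rw [indicator_of_mem hz, Pi.one_apply, encard_eq_one]
    refine ⟨e.symm ⟨z, hz⟩, ?_⟩
    ext j
    rw [mem_ofPred_eq, mem_singleton_iff, Equiv.eq_symm_apply, Subtype.ext_iff]
  · rw [indicator_of_notMem hz, encard_eq_zero, eq_empty_iff_forall_notMem]
    rintro j rfl
    exact hz (e j).2

theorem IsEigenvalueSequence.exists_equiv (h : ∀ z, algMultiplicity T z = M.indicator 1 z)
    {ev : ℕ → ℂ} (hev : IsEigenvalueSequence T ev) : ∃ e : ℕ ≃ M, ∀ j, (e j : ℂ) = ev j := by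
  have h1 : ∀ j, ev j ∈ M := fun j => by
    by_contra hj
    have h2 := hev (ev j)
    rw [h, indicator_of_notMem hj, encard_eq_zero] at h2
    exact (h2 ▸ (rfl : j ∈ {i | ev i = ev j}) : j ∈ (∅ : Set ℕ))
  have h2 : ∀ z ∈ M, ∃ i, {j | ev j = z} = {i} := fun z hz => by
    rw [← encard_eq_one, hev z, h, indicator_of_mem hz, Pi.one_apply]
  refine ⟨Equiv.ofBijective (fun j => ⟨ev j, h1 j⟩) ⟨fun i j hij => ?_, fun z => ?_⟩, fun j => rfl⟩
  · obtain ⟨k, hk⟩ := h2 (ev j) (h1 j)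
    have hi : i ∈ {l | ev l = ev j} := congrArg Subtype.val hij
    have hj : j ∈ {l | ev l = ev j} := rfl
    rw [hk] at hi hj
    exact hi.trans hj.symm
  · obtain ⟨k, hk⟩ := h2 z z.2
    exact ⟨k, Subtype.ext (hk.ge rfl)⟩

end Sequence

/-! ### Admissible cuts and the logarithms they define -/

section Cut

variable {M : Set ℂ} {κ δ : ℝ} {N : ℕ}

/-- The condition `|Re| ≤ κ|Im|` excludes thin sectors around the real axis. The angle `1/(κ + 2)`
works: for `0 < t ≤ 1/(κ + 2)`, `κ sin t ≤ κ t ≤ 1 - 2t < 1 - t²/2 ≤ cos t`. -/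
theorem SectorSet.exists_admissible (hM : SectorSet M κ δ N) (cut : BranchCut) :
    ∃ ε, ∀ ev : ℕ → ℂ, (∀ j, ev j ∈ M) → cut.Admissible ε ev := by
  have hκ := hM.kappa_nonneg
  have hε : 0 < 1 / (κ + 2) := by positivity
  have hε1 : 1 / (κ + 2) ≤ 1 / 2 := one_div_le_one_div_of_le two_pos (by linarith)
  have key : ∀ t : ℝ, 0 < t → t ≤ 1 / (κ + 2) → 0 < Real.sin t ∧
      κ * Real.sin t < Real.cos t := fun t ht ht' => by
    have h1 := Real.sin_lt ht
    have h2 := Real.one_sub_sq_div_two_le_cos (x := t)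
    have h3 : t * (κ + 2) ≤ 1 := (le_div_iff₀ (by linarith)).mp ht'
    refine ⟨Real.sin_pos_of_pos_of_lt_pi ht (by linarith [Real.pi_gt_three]), ?_⟩
    nlinarith
  have key' : ∀ r t : ℝ, 0 < r → 0 < t → t ≤ 1 / (κ + 2) → ∀ μ ∈ M,
      |μ.re| = r * Real.cos t → |μ.im| = r * Real.sin t → False := by
    intro r t hr ht ht' μ hμ h1 h2
    have h3 := hM.sector μ hμ
    rw [h1, h2] at h3
    nlinarith [(key t ht ht').2]
  refine ⟨1 / (κ + 2), fun ev hev => ⟨⟨hε, by linarith [Real.pi_gt_three]⟩, ?_⟩⟩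
  intro j r hr φ hφ heq
  have hre : (ev j).re = r * Real.cos φ := by
    rw [heq, Complex.re_ofReal_mul, Complex.exp_ofReal_mul_I_re]
  have him : (ev j).im = r * Real.sin φ := by
    rw [heq, Complex.im_ofReal_mul, Complex.exp_ofReal_mul_I_im]
  cases cut with
  | belowNegative =>
    obtain ⟨t, rfl⟩ : ∃ t, φ = t + Real.pi := ⟨φ - Real.pi, by ring⟩
    have ht : 0 < t := by linarith [hφ.1]
    have ht' : t ≤ 1 / (κ + 2) := by linarith [hφ.2]
    obtain ⟨hs, hc⟩ := key t ht ht'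
    have hc' : 0 < Real.cos t := lt_of_le_of_lt (by positivity) hc
    rw [Real.cos_add_pi, mul_neg] at hre
    rw [Real.sin_add_pi, mul_neg] at him
    refine key' r t hr ht ht' (ev j) (hev j) ?_ ?_
    · rw [hre, abs_neg, abs_of_pos (mul_pos hr hc')]
    · rw [him, abs_neg, abs_of_pos (mul_pos hr hs)]
  | belowPositive =>
    obtain ⟨t, rfl⟩ : ∃ t, φ = -t := ⟨-φ, by ring⟩
    have ht : 0 < t := by linarith [hφ.2]
    have ht' : t ≤ 1 / (κ + 2) := by linarith [hφ.1]
    obtain ⟨hs, hc⟩ := key t ht ht'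
    have hc' : 0 < Real.cos t := lt_of_le_of_lt (by positivity) hc
    rw [Real.cos_neg] at hre
    rw [Real.sin_neg, mul_neg] at him
    refine key' r t hr ht ht' (ev j) (hev j) ?_ ?_
    · rw [hre, abs_of_pos (mul_pos hr hc')]
    · rw [him, abs_neg, abs_of_pos (mul_pos hr hs)]

/-- Admissibility, shifted by `2π`, excludes principal arguments in `(-π, -π + ε]`, so the principal
argument already lies in the chosen range. -/
theorem logCut_belowNegative {ε : ℝ} {ev : ℕ → ℂ} (h : BranchCut.belowNegative.Admissible ε ev)
    {j : ℕ} (hj : ev j ≠ 0) : logCut (BranchCut.belowNegative.angle ε) (ev j) =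
      Complex.log (ev j) := by
  have h1 : -Real.pi + ε < (ev j).arg := by
    by_contra! hle
    refine h.2 j ‖ev j‖ (norm_pos_iff.mpr hj) ((ev j).arg + 2 * Real.pi)
      ⟨by linarith [Complex.neg_pi_lt_arg (ev j)], by linarith⟩ ?_
    conv_lhs => rw [← Complex.norm_mul_exp_arg_mul_I (ev j)]
    push_cast
    rw [add_mul, Complex.exp_add, Complex.exp_two_pi_mul_I, mul_one]
  have h2 : toIocMod Real.two_pi_pos (BranchCut.belowNegative.angle ε) (ev j).arg = (ev j).arg :=
    (toIocMod_eq_self Real.two_pi_pos).mpr ⟨h1, by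
      have := Complex.arg_le_pi (ev j)
      have := h.1.1
      simp only [BranchCut.angle]
      linarith⟩
  rw [logCut, h2, Complex.log]

/-- For a nonreal admissible eigenvalue the chosen argument lies in `(0, 2π)`; subtracting `π` gives
the principal argument of its negative. -/
theorem logCut_belowPositive {ε : ℝ} {ev : ℕ → ℂ} (h : BranchCut.belowPositive.Admissible ε ev)
    {j : ℕ} (hj : (ev j).im ≠ 0) : logCut (BranchCut.belowPositive.angle ε) (ev j) =
      Complex.log (-ev j) + Real.pi * Complex.I := by
  have h0 : ev j ≠ 0 := fun h0 => hj (by rw [h0, Complex.zero_im])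
  have hε := h.1
  have h2 : toIocMod Real.two_pi_pos (BranchCut.belowPositive.angle ε) (ev j).arg =
      (-ev j).arg + Real.pi := by
    rcases hj.lt_or_gt with him | him
    · have hneg : (ev j).arg < 0 := Complex.arg_neg_iff.mpr him
      have h1 : (ev j).arg < -ε := by
        by_contra! hle
        exact h.2 j ‖ev j‖ (norm_pos_iff.mpr h0) (ev j).arg ⟨hle, hneg⟩
          (Complex.norm_mul_exp_arg_mul_I (ev j)).symm
      rw [Complex.arg_neg_eq_arg_add_pi_of_im_neg him, ← toIocMod_add_right,
        (toIocMod_eq_self Real.two_pi_pos).mpr]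
      · ring
      · simp only [BranchCut.angle]
        exact ⟨by linarith [Complex.neg_pi_lt_arg (ev j), Real.pi_pos, hε.1], by linarith⟩
    · rw [Complex.arg_neg_eq_arg_sub_pi_of_im_pos him, sub_add_cancel, toIocMod_eq_self]
      simp only [BranchCut.angle]
      have := Complex.arg_nonneg_iff.mpr him.le
      exact ⟨by linarith [hε.1], by linarith [Complex.arg_le_pi (ev j), hε.2]⟩
  rw [logCut, h2, Complex.log, norm_neg]
  push_cast
  ring

end Cut

/-! ### Existence, uniqueness and value of the determinant -/

section Det

variable {L a : ℝ} {α : ℂ} {M : Set ℂ} {κ δ : ℝ} {N : ℕ} {Z : ℂ → ℂ} {D : ℂ} {cut : BranchCut}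

/-- Any other enumeration and admissible `ε` give the same sum for `Re s > 1`, so the identity
theorem for meromorphic functions gives the same derivative at `0`. -/
theorem isSpectralDet_iff (ha : a ∈ Ioo 0 L) (hM : SectorSet M κ δ N) (hinf : M.Infinite)
    (hmult : ∀ z, algMultiplicity (waveOperator ha α) z = M.indicator 1 z)
    (hsum : ∀ ε (e : ℕ ≃ M), cut.Admissible ε (fun j => (e j : ℂ)) → ∀ s : ℂ, 1 < s.re →
      HasSum (fun j => Complex.exp (-s * logCut (cut.angle ε) (e j))) (Z s))
    (hmer : Meromorphic Z) (han : AnalyticAt ℂ Z 0) :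
    IsSpectralDet L α cut a D ↔ D = Complex.exp (-deriv Z 0) := by
  constructor
  · rintro ⟨ha', ev, ε, Z', hev, hε, hZ', rfl⟩
    obtain ⟨e, he⟩ := hev.exists_equiv hmult
    obtain rfl : (fun j => (e j : ℂ)) = ev := funext he
    rw [(eventuallyEq_of_meromorphic hZ'.meromorphic hmer (x := 1)
      (fun s hs => (hZ'.hasSum s hs).unique (hsum ε e hε s hs)) hZ'.analyticAt han).deriv_eq]
  · rintro rfl
    have := hM.countable
    have := hinf.to_subtype
    obtain ⟨e⟩ := nonempty_equiv_of_countable (α := ℕ) (β := M)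
    obtain ⟨ε, hε⟩ := hM.exists_admissible cut
    have hε := hε (fun j => (e j : ℂ)) fun j => (e j).2
    exact ⟨ha, fun j => (e j : ℂ), ε, Z, isEigenvalueSequence_of_equiv hmult e, hε,
      ⟨hsum ε e hε, hmer, han⟩, rfl⟩

theorem isSpectralDet_belowNegative_iff (ha : a ∈ Ioo 0 L) (hM : SectorSet M κ δ N)
    (hinf : M.Infinite) (hmult : ∀ z, algMultiplicity (waveOperator ha α) z = M.indicator 1 z)
    (hsum : ∀ s : ℂ, 1 < s.re → HasSum (fun μ : M => Complex.exp (-s * Complex.log μ)) (Z s))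
    (hmer : Meromorphic Z) (han : AnalyticAt ℂ Z 0) :
    IsSpectralDet L α .belowNegative a D ↔ D = Complex.exp (-deriv Z 0) := by
  refine isSpectralDet_iff ha hM hinf hmult (fun ε e hε s hs => ?_) hmer han
  have h1 := (Equiv.hasSum_iff e).mpr (hsum s hs)
  refine h1.congr_fun ?_
  intro j
  rw [logCut_belowNegative hε (norm_pos_iff.mp (hM.norm_pos (e j).2))]
  rfl

/-- Zeta equals `e^{-iπs}` times the principal zeta function of the negated eigenvalues, so `ζ(0)`
enters the derivative at `0`. -/
theorem isSpectralDet_belowPositive_iff (ha : a ∈ Ioo 0 L) (hM : SectorSet M κ δ N)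
    (hinf : M.Infinite) (hmult : ∀ z, algMultiplicity (waveOperator ha α) z = M.indicator 1 z)
    {M' : Set ℂ} (hM' : ∀ μ, -μ ∈ M' ↔ μ ∈ M)
    (hsum : ∀ s : ℂ, 1 < s.re → HasSum (fun μ : M' => Complex.exp (-s * Complex.log μ)) (Z s))
    (hmer : Meromorphic Z) (han : AnalyticAt ℂ Z 0) :
    IsSpectralDet L α .belowPositive a D ↔
      D = Complex.exp (-(deriv Z 0 - Real.pi * Complex.I * Z 0)) := by
  have hexp : ∀ s : ℂ, HasDerivAt (fun s : ℂ => Complex.exp (-s * (Real.pi * Complex.I)))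
      (Complex.exp (-s * (Real.pi * Complex.I)) * (-1 * (Real.pi * Complex.I))) s :=
    fun s => ((hasDerivAt_neg s).mul_const _).cexp
  have hana : ∀ s, AnalyticAt ℂ (fun s : ℂ => Complex.exp (-s * (Real.pi * Complex.I))) s :=
    fun s => Differentiable.analyticAt (fun s => (hexp s).differentiableAt) s
  have hd := ((hexp 0).fun_mul han.differentiableAt.hasDerivAt).deriv
  have hd' : deriv (fun s => Complex.exp (-s * (Real.pi * Complex.I)) * Z s) 0 =
      deriv Z 0 - Real.pi * Complex.I * Z 0 := by
    rw [hd]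
    simp
    ring
  rw [← hd']
  refine isSpectralDet_iff ha hM hinf hmult (fun ε e hε s hs => ?_)
    (fun s => (hana s).meromorphicAt.mul (hmer s)) ((hana 0).mul han)
  let n : M ≃ M' := (Equiv.neg ℂ).subtypeEquiv fun μ => (hM' μ).symm
  have h1 := ((Equiv.hasSum_iff (e.trans n)).mpr (hsum s hs)).mul_left
    (Complex.exp (-s * (Real.pi * Complex.I)))
  refine h1.congr_fun ?_
  intro j
  have him : (e j : ℂ).im ≠ 0 := abs_pos.mp (hM.delta_pos.trans_le (hM.gap _ (e j).2))
  rw [logCut_belowPositive hε him, mul_add, add_comm, Complex.exp_add]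
  rfl

end Det

end Spectral

/-- The determinant is `2L / A` below the negative axis and `-2L / A` below the positive one, `A`
being the leading coefficient of the polynomial used. Thus it is `2L` and `-L` for `α = 2`, and `L`
and `-2L` for `α = -2`. -/
theorem exists_forall_isSpectralDet_iff (L : ℝ) (α : ℂ) (hα : α = 2 ∨ α = -2)
    (cut : BranchCut) :
    ∃ D₀ : ℂ, ∀ a ∈ Ioo 0 (L / 2), ∀ D, IsSpectralDet L α cut a D ↔ D = D₀ := by
  have hW : ∀ a ∈ Ioo 0 (L / 2), WavePoly 2 (-1) (-1) (2 * a) (2 * (L - a)) (2 * L) ∧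
      WavePoly 1 1 (-2) (2 * (L - a) - 2 * a) (2 * (L - a)) (2 * L) := fun a ha => by
    have h1 : 0 < 2 * a := by linarith [ha.1]
    have h2 : 2 * a < 2 * (L - a) := by linarith [ha.2]
    -- Here `a` disappears: the slope at `0` is the sum of the two frequencies.
    have e : 2 * a + 2 * (L - a) = 2 * L := by ring
    exact ⟨e ▸ wavePoly_two h1 h2, e ▸ wavePoly_one h1 h2⟩
  have haL : ∀ a ∈ Ioo 0 (L / 2), a ∈ Ioo 0 L := fun a ha => ⟨ha.1, by linarith [ha.1, ha.2]⟩
  rcases hα with rfl | rfl <;> cases cut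
  · refine ⟨Complex.exp (-(Real.log 1 - Real.log (2 * L) : ℝ)), fun a ha D => ?_⟩
    have h := (hW a ha).2
    obtain ⟨κ, δ, N, hM⟩ := h.exists_sectorSet
    obtain ⟨Z, hsum, hmer, han, -, hder⟩ := h.exists_zeta
    rw [isSpectralDet_belowNegative_iff (haL a ha) hM h.infinite_negZeros
      (algMultiplicity_two _ ha.2) hsum hmer han, hder]
  · refine ⟨Complex.exp (-((Real.log 2 - Real.log (2 * L) : ℝ) - Real.pi * Complex.I * -1)),
      fun a ha D => ?_⟩
    have h := (hW a ha).2
    obtain ⟨κ, δ, N, hM⟩ := h.exists_sectorSet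
    obtain ⟨Z, hsum, hmer, han, h0, hder⟩ := (hW a ha).1.exists_zeta
    rw [isSpectralDet_belowPositive_iff (haL a ha) hM h.infinite_negZeros
      (algMultiplicity_two _ ha.2) (fun μ => by rw [← mem_negZeros_neg_iff, neg_neg])
      hsum hmer han, hder, h0]
  · refine ⟨Complex.exp (-(Real.log 2 - Real.log (2 * L) : ℝ)), fun a ha D => ?_⟩
    have h := (hW a ha).1
    obtain ⟨κ, δ, N, hM⟩ := h.exists_sectorSet
    obtain ⟨Z, hsum, hmer, han, -, hder⟩ := h.exists_zeta
    rw [isSpectralDet_belowNegative_iff (haL a ha) hM h.infinite_negZeros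
      (algMultiplicity_neg_two _ ha.2) hsum hmer han, hder]
  · refine ⟨Complex.exp (-((Real.log 1 - Real.log (2 * L) : ℝ) - Real.pi * Complex.I * -1)),
      fun a ha D => ?_⟩
    have h := (hW a ha).1
    obtain ⟨κ, δ, N, hM⟩ := h.exists_sectorSet
    obtain ⟨Z, hsum, hmer, han, h0, hder⟩ := (hW a ha).2.exists_zeta
    rw [isSpectralDet_belowPositive_iff (haL a ha) hM h.infinite_negZeros
      (algMultiplicity_neg_two _ ha.2) (fun _ => mem_negZeros_neg_iff)
      hsum hmer han, hder, h0]

end DampedWave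
end

theorem mainTheorem4 (L : ℝ) (hL : 0 < L) (α : ℂ) (hα : α = 2 ∨ α = -2)
    (cut : DampedWave.BranchCut) :
    (∀ a ∈ Set.Ioo 0 (L / 2), ∃! D : ℂ, DampedWave.IsSpectralDet L α cut a D) ∧
      ContinuousOn (DampedWave.spectralDet L α cut) (Set.Ioo 0 (L / 2)) := by
  obtain ⟨D₀, hD₀⟩ := DampedWave.exists_forall_isSpectralDet_iff L α hα cut
  refine ⟨fun a ha => ⟨D₀, (hD₀ a ha D₀).mpr rfl, fun D hD => (hD₀ a ha D).mp hD⟩, ?_⟩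
  refine (continuousOn_const (c := D₀)).congr fun a ha => ?_
  have h : ∃ D, DampedWave.IsSpectralDet L α cut a D := ⟨D₀, (hD₀ a ha D₀).mpr rfl⟩
  rw [DampedWave.spectralDet, dif_pos h]
  exact (hD₀ a ha _).mp h.choose_spec
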